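/- Let $k$ be a von Neumann regular ring (associative with unit, not necessarily commutative: for every $x\in k$ there is $y\in k$ with $xyx=x$), let $V$ be a $k$-$k$-bimodule, placed in degree $1$, and let $T(V)=\bigoplus_{n\ge 0}V^{\otimes n}$ be its tensor ring over $k$ (so $V^{\otimes 0}=k$), which is graded. For additive subgroups $E,F$ of $T(V)$ let $EF$ be the additive subgroup generated by the products $ef$ with $e\in E$, $f\in F$. Let $N\ge 2$, let $R$ be a sub-$k$-$k$-bimodule of $V^{\otimes N}$, let $I(R)$ be the two-sided ideal of $T(V)$ generated by $R$, and let $A=T(V)/I(R)$ with the induced grading. Put $$I(R)_n=\sum_{i+N+j=n}V^{\otimes i}R\,V^{\otimes j}\quad(n\ge 0),\qquad W_{N+1}=(VR)\cap(RV).$$ Let ${}_Ak$ and $k_A$ be $k$, concentrated in degree $0$, as a left and as a right $A$-module through the projection $A\to A_0=k$. The group $\mathrm{Tor}_3^A(k_A,{}_Ak)$ is graded by computing it from a resolution of ${}_Ak$ by graded-free left $A$-modules; it is said to be concentrated in degree $d$ if all its components of degree $\ne d$ vanish. Then $\mathrm{Tor}_3^A(k_A,{}_Ak)$ is concentrated in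 degree $N+1$ if and only if both of the following hold. (ec) For every integer $n$ with $N+2\le n\le 2N-1$, $$(V^{\otimes(n-N)}R)\cap\bigl(RV^{\otimes(n-N)}+VRV^{\otimes(n-N-1)}+\cdots+V^{\otimes(n-N-1)}RV\bigr)=V^{\otimes(n-N-1)}W_{N+1}.$$ (d) For every integer $n\ge 2N$, $$(V^{\otimes(n-N)}R)\cap(I(R)_{n-1}V)=V^{\otimes(n-N-1)}W_{N+1}+I(R)_{n-N}R.$$ Moreover, if (ec) holds, then the identities in (d) are distributivity relations: for every $n\ge 2N$, with $$E=V^{\otimes(n-N)}R,\qquad F=I(R)_{n-N}V^{\otimes N},\qquad G=V^{\otimes(n-2N+1)}I(R)_{2N-2}V,$$ the left-hand side of the identity in (d) equals $E\cap(F+G)$ and its right-hand side equals $(E\cap F)+(E\cap G)$. -/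

import Mathlib

open scoped TensorProduct

universe u v w

/-- A ring `k` is von Neumann regular if every `x` admits `y` with `x y x = x`. -/
def IsVonNeumannRegular (k : Type u) [Ring k] : Prop :=
  ∀ x : k, ∃ y : k, x * y * x = x

/-! ### The tensor ring of a bimodule over a noncommutative ring -/

section TensorRing

variable (k : Type u) (V : Type v) [Ring k] [AddCommGroup V] [Module k V] [Module kᵐᵒᵖ V]

/-- The relations of the tensor ring `T_k(V)` on the free ring on the disjoint union of `k` and `V`:
the ring structure of `k`, the additivity of `V`, and the two actions of `k` on `V` become those
of the ring. -/
inductive TensorRing.Rel : FreeAlgebra ℤ (k ⊕ V) → FreeAlgebra ℤ (k ⊕ V) → Prop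
  | one : Rel (FreeAlgebra.ι ℤ (Sum.inl 1)) 1
  | mul (a b : k) : Rel (FreeAlgebra.ι ℤ (Sum.inl (a * b)))
      (FreeAlgebra.ι ℤ (Sum.inl a) * FreeAlgebra.ι ℤ (Sum.inl b))
  | add_scalar (a b : k) : Rel (FreeAlgebra.ι ℤ (Sum.inl (a + b)))
      (FreeAlgebra.ι ℤ (Sum.inl a) + FreeAlgebra.ι ℤ (Sum.inl b))
  | add_vector (x y : V) : Rel (FreeAlgebra.ι ℤ (Sum.inr (x + y)))
      (FreeAlgebra.ι ℤ (Sum.inr x) + FreeAlgebra.ι ℤ (Sum.inr y))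
  | smul_left (a : k) (x : V) : Rel (FreeAlgebra.ι ℤ (Sum.inr (a • x)))
      (FreeAlgebra.ι ℤ (Sum.inl a) * FreeAlgebra.ι ℤ (Sum.inr x))
  | smul_right (a : k) (x : V) : Rel (FreeAlgebra.ι ℤ (Sum.inr (MulOpposite.op a • x)))
      (FreeAlgebra.ι ℤ (Sum.inr x) * FreeAlgebra.ι ℤ (Sum.inl a))

/-- The tensor ring `T(V) = ⨁ V^{⊗ n}` (tensor powers over `k`) of the `k`-`k`-bimodule `V`,
presented as the universal ring under `k` and `V` (see `TensorRing.lift`). -/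
def TensorRing : Type (max u v) := RingQuot (TensorRing.Rel k V)

noncomputable instance : Ring (TensorRing k V) :=
  inferInstanceAs (Ring (RingQuot (TensorRing.Rel k V)))

namespace TensorRing

/-- The quotient map from the free ring. -/
noncomputable def mk : FreeAlgebra ℤ (k ⊕ V) →+* TensorRing k V :=
  RingQuot.mkRingHom (Rel k V)

variable {k V} in
theorem mk_rel {x y : FreeAlgebra ℤ (k ⊕ V)} (h : Rel k V x y) : mk k V x = mk k V y :=
  RingQuot.mkRingHom_rel h

/-- The ring homomorphism `k → T(V)`. -/
noncomputable def scalar : k →+* TensorRing k V :=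
  RingHom.mk'
    { toFun := fun a => mk k V (FreeAlgebra.ι ℤ (Sum.inl a))
      map_one' := by rw [mk_rel Rel.one, map_one]
      map_mul' := fun a b => by rw [mk_rel (Rel.mul a b), map_mul] }
    (fun a b => (mk_rel (Rel.add_scalar a b)).trans (map_add _ _ _))

/-- The additive map `V → T(V)`. -/
noncomputable def vector : V →+ TensorRing k V :=
  AddMonoidHom.mk' (fun x => mk k V (FreeAlgebra.ι ℤ (Sum.inr x)))
    (fun x y => (mk_rel (Rel.add_vector x y)).trans (map_add _ _ _))

theorem vector_smul (a : k) (x : V) : vector k V (a • x) = scalar k V a * vector k V x :=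
  (mk_rel (Rel.smul_left a x)).trans (map_mul (mk k V) _ _)

theorem vector_op_smul (a : k) (x : V) :
    vector k V (MulOpposite.op a • x) = vector k V x * scalar k V a :=
  (mk_rel (Rel.smul_right a x)).trans (map_mul (mk k V) _ _)

variable {k V}

/-- The universal property of the tensor ring. -/
noncomputable def lift {B : Type w} [Ring B] (f : k →+* B) (g : V →+ B)
    (hl : ∀ (a : k) (x : V), g (a • x) = f a * g x)
    (hr : ∀ (a : k) (x : V), g (MulOpposite.op a • x) = g x * f a) : TensorRing k V →+* B :=
  (RingQuot.lift (r := Rel k V)).toFun ⟨(FreeAlgebra.lift ℤ (Sum.elim f g) : FreeAlgebra ℤ (k ⊕ V) →ₐ[ℤ] B).toRingHom, by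
    intro x y h
    induction h <;> simp [hl, hr]⟩

theorem lift_scalar {B : Type w} [Ring B] (f : k →+* B) (g : V →+ B) (hl) (hr) (a : k) :
    lift f g hl hr (scalar k V a) = f a := by
  refine (RingQuot.lift_mkRingHom_apply _ (r := Rel k V) _ _).trans ?_
  simp

theorem lift_vector {B : Type w} [Ring B] (f : k →+* B) (g : V →+ B) (hl) (hr) (x : V) :
    lift f g hl hr (vector k V x) = g x := by
  refine (RingQuot.lift_mkRingHom_apply _ (r := Rel k V) _ _).trans ?_
  simp

/-- The tensor ring is generated by `k` and `V`. -/
theorem induction {P : TensorRing k V → Prop} (hs : ∀ a, P (scalar k V a))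
    (hv : ∀ x, P (vector k V x)) (hadd : ∀ x y, P x → P y → P (x + y))
    (hmul : ∀ x y, P x → P y → P (x * y)) (t : TensorRing k V) : P t := by
  obtain ⟨t, rfl⟩ := RingQuot.mkRingHom_surjective (Rel k V) t
  induction t using FreeAlgebra.induction with
  | grade0 r =>
    have h : mk k V (algebraMap ℤ _ r) = scalar k V (r : k) := by
      rw [eq_intCast, map_intCast, map_intCast]
    exact h ▸ hs _
  | grade1 x =>
    rcases x with a | x
    · exact hs a
    · exact hv x
  | mul x y hx hy => rw [map_mul]; exact hmul _ _ hx hy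
  | add x y hx hy => rw [map_add]; exact hadd _ _ hx hy

variable (k V)

/-- The component `V^{⊗ n}` of degree `n` of `T(V)`: it is `k` for `n = 0`, and in general the
set of sums of products of `n` elements of `V`. -/
noncomputable def tensorPow : ℕ → Submodule ℤ (TensorRing k V)
  | 0 => LinearMap.range (scalar k V).toAddMonoidHom.toIntLinearMap
  | n + 1 => tensorPow n * LinearMap.range (vector k V).toIntLinearMap

end TensorRing

end TensorRing

/-! ### Graded modules, their canonical graded-free resolutions, and graded Tor -/

section Graded

/-- A family of submodules with a compatible family of projections is a direct sum
decomposition. -/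
theorem isInternal_of_proj {M : Type w} [AddCommGroup M] (C : ℕ → Submodule ℤ M)
    (p : ℕ → M →ₗ[ℤ] M) (hp : ∀ n, ∀ x ∈ C n, p n x = x)
    (hp' : ∀ n m, m ≠ n → ∀ x ∈ C m, p n x = 0) (htop : iSup C = ⊤) :
    DirectSum.IsInternal C := by
  refine DirectSum.isInternal_submodule_of_iSupIndep_of_iSup_eq_top ?_ htop
  intro n
  rw [Submodule.disjoint_def]
  intro x hx hx'
  have hle : (⨆ m, ⨆ (_ : m ≠ n), C m) ≤ LinearMap.ker (p n) :=
    iSup₂_le fun m hm y hy => hp' n m hm y hy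
  rw [← hp n x hx]
  exact hle hx'

variable {A : Type v} [Ring A] (𝒜 : ℕ → Submodule ℤ A)

/-- A graded left module over the `ℕ`-graded ring `A`, living in degrees `≥ 0`. -/
structure GrMod where
  /-- the underlying module -/
  carrier : Type w
  [addCommGroup : AddCommGroup carrier]
  [module : Module A carrier]
  /-- the homogeneous component of a given degree -/
  comp : ℕ → Submodule ℤ carrier
  smul_mem : ∀ {i j : ℕ} {a : A} {x : carrier}, a ∈ 𝒜 i → x ∈ comp j → a • x ∈ comp (i + j)
  isInternal : DirectSum.IsInternal comp

attribute [instance] GrMod.addCommGroup GrMod.module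

namespace GrMod

variable {𝒜}

/-- The projections of a graded module onto its components. -/
theorem exists_proj (M : GrMod.{v, w} 𝒜) : ∃ p : ℕ → M.carrier →ₗ[ℤ] M.carrier,
    (∀ n x, p n x ∈ M.comp n) ∧ (∀ n, ∀ x ∈ M.comp n, p n x = x) ∧
    (∀ n m, m ≠ n → ∀ x ∈ M.comp m, p n x = 0) ∧
    (∀ x, x ∈ Submodule.span ℤ (Set.range fun n => p n x)) := by
  classical
  let _ := M.isInternal.chooseDecomposition
  let p : ℕ → M.carrier →ₗ[ℤ] M.carrier := fun n =>
    (M.comp n).subtype ∘ₗ DirectSum.component ℤ ℕ (fun i => M.comp i) n ∘ₗ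
      (DirectSum.decomposeLinearEquiv M.comp).toLinearMap
  have hp : ∀ n x, p n x = (DirectSum.decompose M.comp x n : M.carrier) := fun n x => rfl
  refine ⟨p, fun n x => ?_, fun n x hx => ?_, fun n m hm x hx => ?_, fun x => ?_⟩
  · rw [hp]; exact SetLike.coe_mem _
  · rw [hp]; exact DirectSum.decompose_of_mem_same _ hx
  · rw [hp]; exact DirectSum.decompose_of_mem_ne _ hx hm
  · have h := DirectSum.sum_support_decompose M.comp x
    have h2 : ∑ i ∈ (DirectSum.decompose M.comp x).support,
        (DirectSum.decompose M.comp x i : M.carrier) ∈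
          Submodule.span ℤ (Set.range fun n => p n x) :=
      Submodule.sum_mem _ fun i _ => Submodule.subset_span ⟨i, rfl⟩
    rwa [h] at h2

variable [GradedRing 𝒜] (M : GrMod.{v, w} 𝒜)

/-- The homogeneous elements of `M`, with their degrees. -/
abbrev Homog : Type w := Σ i : ℕ, M.comp i

/-- The component of degree `n` of the graded-free module on the homogeneous elements of `M`. -/
noncomputable def freeComp (n : ℕ) : Submodule ℤ (M.Homog →₀ A) :=
  Submodule.span ℤ {f | ∃ (s : M.Homog) (j : ℕ) (a : A), a ∈ 𝒜 j ∧ j + s.1 = n ∧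
    f = Finsupp.single s a}

theorem freeComp_isInternal : DirectSum.IsInternal M.freeComp := by
  classical
  let q : ℕ → M.Homog → A →ₗ[ℤ] A := fun n s =>
    if s.1 ≤ n then (𝒜 (n - s.1)).subtype ∘ₗ
      DirectSum.component ℤ ℕ (fun i => 𝒜 i) (n - s.1) ∘ₗ
      (DirectSum.decomposeLinearEquiv 𝒜).toLinearMap else 0
  refine isInternal_of_proj M.freeComp
    (fun n => Finsupp.lsum ℤ fun s => Finsupp.lsingle s ∘ₗ q n s) ?_ ?_ ?_
  · intro n x hx
    induction hx using Submodule.span_induction with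
    | mem x hx =>
      obtain ⟨s, j, a, ha, rfl, rfl⟩ := hx
      have : q (j + s.1) s a = a := by
        simp only [q, le_add_iff_nonneg_left, zero_le, if_true]
        exact DirectSum.decompose_of_mem_same _ (by rwa [Nat.add_sub_cancel])
      simp [this]
    | zero => simp
    | add x y _ _ hx hy => rw [map_add, hx, hy]
    | smul c x _ hx => rw [map_smul, hx]
  · intro n m hm x hx
    induction hx using Submodule.span_induction with
    | mem x hx =>
      obtain ⟨s, j, a, ha, rfl, rfl⟩ := hx
      have : q n s a = 0 := by
        simp only [q]
        split_ifs with h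
        · exact DirectSum.decompose_of_mem_ne _ ha (by omega)
        · rfl
      simp [this]
    | zero => simp
    | add x y _ _ hx hy => rw [map_add, hx, hy, add_zero]
    | smul c x _ hx => rw [map_smul, hx, smul_zero]
  · rw [eq_top_iff]
    intro f _
    induction f using Finsupp.induction_linear with
    | zero => exact Submodule.zero_mem _
    | add f g hf hg => exact Submodule.add_mem _ (hf trivial) (hg trivial)
    | single s a =>
      rw [← DirectSum.sum_support_decompose 𝒜 a, Finsupp.single_finsetSum]
      refine Submodule.sum_mem _ fun j _ => ?_
      exact Submodule.mem_iSup_of_mem (j + s.1)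
        (Submodule.subset_span ⟨s, j, _, SetLike.coe_mem _, rfl, rfl⟩)

/-- The graded-free module with one basis element of degree `i` for each element of `M_i`. -/
noncomputable def free : GrMod.{v, max v w} 𝒜 where
  carrier := M.Homog →₀ A
  comp := M.freeComp
  smul_mem := by
    intro i j a x ha hx
    induction hx using Submodule.span_induction with
    | mem x hx =>
      obtain ⟨s, l, b, hb, rfl, rfl⟩ := hx
      refine Submodule.subset_span ⟨s, i + l, a * b, SetLike.mul_mem_graded ha hb, by omega, ?_⟩
      simp
    | zero => simp
    | add x y _ _ hx hy => rw [smul_add]; exact Submodule.add_mem _ hx hy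
    | smul c x _ hx => rw [smul_comm]; exact Submodule.smul_mem _ _ hx
  isInternal := M.freeComp_isInternal

/-- The canonical surjection from the graded-free module onto `M`. -/
noncomputable def cover : M.free.carrier →ₗ[A] M.carrier :=
  Finsupp.linearCombination A fun s : M.Homog => (s.2 : M.carrier)

theorem cover_mem {n : ℕ} {x : M.free.carrier} (hx : x ∈ M.free.comp n) :
    M.cover x ∈ M.comp n := by
  change x ∈ M.freeComp n at hx
  induction hx using Submodule.span_induction with
  | mem x hx =>
    obtain ⟨s, l, b, hb, rfl, rfl⟩ := hx
    have : M.cover (Finsupp.single s b) = b • (s.2 : M.carrier) :=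
      Finsupp.linearCombination_single A b s
    rw [this]
    exact M.smul_mem hb s.2.2
  | zero => rw [map_zero]; exact Submodule.zero_mem _
  | add x y _ _ hx hy => rw [map_add]; exact Submodule.add_mem _ hx hy
  | smul c x _ hx => exact (map_zsmul M.cover c x).symm ▸ Submodule.smul_mem _ c hx

/-- The kernel of the canonical surjection `M.free → M`, as a graded module. -/
noncomputable def syzygy : GrMod.{v, max v w} 𝒜 where
  carrier := LinearMap.ker M.cover
  comp n := (M.free.comp n).comap (LinearMap.ker M.cover).subtype.toAddMonoidHom.toIntLinearMap
  smul_mem := by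
    intro i j a x ha hx
    exact M.free.smul_mem ha hx
  isInternal := by
    obtain ⟨p, hp, hp1, hp2, hp3⟩ := M.free.exists_proj
    obtain ⟨r, hr, hr1, hr2, -⟩ := M.exists_proj
    have htop : ∀ x : M.free.carrier, x ∈ iSup M.free.comp := fun x => by
      rw [M.free.isInternal.submodule_iSup_eq_top]; trivial
    have hcomm : ∀ n x, M.cover (p n x) = r n (M.cover x) := by
      intro n x
      induction htop x using Submodule.iSup_induction' with
      | mem m x hx =>
        by_cases h : m = n
        · subst h; rw [hp1 m x hx, hr1 m _ (M.cover_mem hx)]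
        · rw [hp2 n m h x hx, hr2 n m h _ (M.cover_mem hx), map_zero]
      | zero => simp
      | add x y _ _ hx hy => simp only [map_add, hx, hy]
    have hker : ∀ n (x : LinearMap.ker M.cover), p n x ∈ LinearMap.ker M.cover := by
      intro n x
      rw [LinearMap.mem_ker, hcomm, LinearMap.mem_ker.mp x.2, map_zero]
    let p' : ℕ → LinearMap.ker M.cover →ₗ[ℤ] LinearMap.ker M.cover := fun n =>
      AddMonoidHom.toIntLinearMap
        { toFun := fun x => ⟨p n x, hker n x⟩
          map_zero' := Subtype.ext (map_zero (p n))
          map_add' := fun x y => Subtype.ext (map_add (p n) _ _) }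
    refine isInternal_of_proj _ p' (fun n x hx => Subtype.ext (hp1 n x hx))
      (fun n m h x hx => Subtype.ext (hp2 n m h x hx)) ?_
    rw [eq_top_iff]
    intro x _
    have hx : x ∈ Submodule.span ℤ (Set.range fun n => p' n x) := by
      have h := hp3 (x : M.free.carrier)
      have : Set.range (fun n => p n (x : M.free.carrier)) =
          (LinearMap.ker M.cover).subtype.toAddMonoidHom.toIntLinearMap ''
            Set.range (fun n => p' n x) := by
        rw [← Set.range_comp]; rfl
      rw [this, Submodule.span_image] at h
      obtain ⟨y, hy, hyx⟩ := h
      have hyx' : y = x := Subtype.ext hyx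
      exact hyx' ▸ hy
    refine Submodule.span_le.mpr ?_ hx
    rintro _ ⟨n, rfl⟩
    exact Submodule.mem_iSup_of_mem n (hp n x)

/-- The iterated syzygies of `M`. -/
noncomputable def iterSyzygy : ℕ → GrMod.{v, max v w} 𝒜
  | 0 => M.syzygy
  | n + 1 => (iterSyzygy n).syzygy

/-- The modules `P₀, P₁, …` of the canonical graded-free resolution of `M`: `P₀` is the free
module on the homogeneous elements of `M`, then `P₁` is the one on the homogeneous elements of
the kernel of `P₀ → M`, and so on. -/
noncomputable def resolution : ℕ → GrMod.{v, max v w} 𝒜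
  | 0 => M.free
  | n + 1 => (M.iterSyzygy n).free

/-- The differentials `P_{n+1} → P_n` of the canonical graded-free resolution of `M`. -/
noncomputable def resolutionD :
    (n : ℕ) → (M.resolution (n + 1)).carrier →ₗ[A] (M.resolution n).carrier
  | 0 => (LinearMap.ker M.cover).subtype ∘ₗ M.syzygy.cover
  | n + 1 => (LinearMap.ker (M.iterSyzygy n).cover).subtype ∘ₗ (M.iterSyzygy n).syzygy.cover

theorem cover_surjective : Function.Surjective M.cover := by
  intro x
  have hx : x ∈ iSup M.comp := by rw [M.isInternal.submodule_iSup_eq_top]; trivial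
  induction hx using Submodule.iSup_induction' with
  | mem i x hx =>
    exact ⟨Finsupp.single ⟨i, x, hx⟩ 1,
      (Finsupp.linearCombination_single A 1 (⟨i, x, hx⟩ : M.Homog)).trans (one_smul A x)⟩
  | zero => exact ⟨0, map_zero _⟩
  | add x y _ _ hx hy =>
    obtain ⟨a, rfl⟩ := hx
    obtain ⟨b, rfl⟩ := hy
    exact ⟨a + b, map_add _ _ _⟩

/-- The canonical resolution is exact at `P₀`. -/
theorem range_resolutionD_zero : LinearMap.range (M.resolutionD 0) = LinearMap.ker M.cover := by
  exact (LinearMap.range_comp_of_range_eq_top (LinearMap.ker M.cover).subtype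
    (LinearMap.range_eq_top.mpr M.syzygy.cover_surjective)).trans (Submodule.range_subtype _)

/-- The canonical resolution is exact at `P_{n+1}`. -/
theorem range_resolutionD_succ (n : ℕ) :
    LinearMap.range (M.resolutionD (n + 1)) = LinearMap.ker (M.resolutionD n) := by
  have h : LinearMap.ker (M.resolutionD n) = LinearMap.ker (M.iterSyzygy n).cover := by
    cases n with
    | zero => exact LinearMap.ker_comp_of_ker_eq_bot _ (Submodule.ker_subtype _)
    | succ n => exact LinearMap.ker_comp_of_ker_eq_bot _ (Submodule.ker_subtype _)
  rw [h]
  exact (LinearMap.range_comp_of_range_eq_top (LinearMap.ker (M.iterSyzygy n).cover).subtype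
    (LinearMap.range_eq_top.mpr (M.iterSyzygy n).syzygy.cover_surjective)).trans
    (Submodule.range_subtype _)

end GrMod

/-! The tensor product `X ⊗_A Y` of a right module and a left module over a noncommutative ring. -/

section BalancedTensor

variable (A) (X : Type u) [AddCommGroup X] [Module Aᵐᵒᵖ X]

/-- The tensor product `X ⊗_A Y` of a right `A`-module and a left `A`-module: the quotient of
`X ⊗_ℤ Y` by the elements `xa ⊗ y - x ⊗ ay`. -/
def BalancedTensor (Y : Type w) [AddCommGroup Y] [Module A Y] : Type (max u w) :=
  (X ⊗[ℤ] Y) ⧸ AddSubgroup.closure {t : X ⊗[ℤ] Y | ∃ (x : X) (a : A) (y : Y),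
    t = (MulOpposite.op a • x) ⊗ₜ[ℤ] y - x ⊗ₜ[ℤ] (a • y)}

namespace BalancedTensor

noncomputable instance (Y : Type w) [AddCommGroup Y] [Module A Y] :
    AddCommGroup (BalancedTensor A X Y) :=
  inferInstanceAs (AddCommGroup ((X ⊗[ℤ] Y) ⧸ AddSubgroup.closure _))

/-- The class of `x ⊗ y` in `X ⊗_A Y`. -/
def tmul {X : Type u} [AddCommGroup X] [Module Aᵐᵒᵖ X] {Y : Type w} [AddCommGroup Y] [Module A Y] (x : X) (y : Y) : BalancedTensor A X Y :=
  QuotientAddGroup.mk (x ⊗ₜ[ℤ] y)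

/-- The map `X ⊗_A Y → X ⊗_A Z` induced by an `A`-linear map `Y → Z`. -/
noncomputable def map {Y : Type w} [AddCommGroup Y] [Module A Y] {Z : Type w} [AddCommGroup Z]
    [Module A Z] (f : Y →ₗ[A] Z) : BalancedTensor A X Y →ₗ[ℤ] BalancedTensor A X Z :=
  AddMonoidHom.toIntLinearMap <| QuotientAddGroup.map _ _
    (TensorProduct.map LinearMap.id f.toAddMonoidHom.toIntLinearMap).toAddMonoidHom (by
      rw [AddSubgroup.closure_le]
      rintro _ ⟨x, a, y, rfl⟩
      refine AddSubgroup.subset_closure ⟨x, a, f y, ?_⟩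
      rw [map_sub]
      change _ - x ⊗ₜ[ℤ] f (a • y) = _
      rw [map_smul]
      rfl)

theorem map_tmul {Y : Type w} [AddCommGroup Y] [Module A Y] {Z : Type w} [AddCommGroup Z]
    [Module A Z] (f : Y →ₗ[A] Z) (x : X) (y : Y) :
    map A X f (tmul A x y) = tmul A x (f y) := rfl

end BalancedTensor

end BalancedTensor

variable {𝒜}
variable {X : Type u} [AddCommGroup X] [Module Aᵐᵒᵖ X] (𝒳 : ℕ → Submodule ℤ X)

/-- The component of degree `m` of the tensor product `X ⊗_A M` of graded modules. -/
noncomputable def GrMod.tensorComp (M : GrMod.{v, w} 𝒜) (m : ℕ) :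
    Submodule ℤ (BalancedTensor A X M.carrier) :=
  Submodule.span ℤ {t | ∃ (i j : ℕ) (x : X) (y : M.carrier), x ∈ 𝒳 i ∧ y ∈ M.comp j ∧
    i + j = m ∧ t = BalancedTensor.tmul A x y}

variable [GradedRing 𝒜] (M : GrMod.{v, w} 𝒜)

/-- The `n`-cycles of degree `m` of the complex `X ⊗_A P`, where `P` is the canonical graded-free
resolution of `M`. -/
noncomputable def torCycles : (n m : ℕ) →
    Submodule ℤ (BalancedTensor A X (M.resolution n).carrier)
  | 0, m => (M.resolution 0).tensorComp 𝒳 m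
  | n + 1, m => (M.resolution (n + 1)).tensorComp 𝒳 m ⊓
      LinearMap.ker (BalancedTensor.map A X (M.resolutionD n))

/-- The `n`-boundaries of degree `m` of the complex `X ⊗_A P`, where `P` is the canonical
graded-free resolution of `M`. -/
noncomputable def torBoundaries (n m : ℕ) :
    Submodule ℤ (BalancedTensor A X (M.resolution n).carrier) :=
  ((M.resolution (n + 1)).tensorComp 𝒳 m).map (BalancedTensor.map A X (M.resolutionD n))

/-- The component of degree `m` of the graded module `Tor_n^A(X, M)`: the homology in homological
degree `n` and internal degree `m` of `X ⊗_A P`, where `P` is the canonical graded-free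
resolution of `M`. -/
abbrev GrTor (n m : ℕ) : Type _ :=
  torCycles 𝒳 M n m ⧸ (torBoundaries 𝒳 M n m).submoduleOf (torCycles 𝒳 M n m)

end Graded

/-- A graded module, given by its components, is concentrated in degree `d` if the other
components vanish. -/
def IsConcentratedInDegree (T : ℕ → Type w) (d : ℕ) : Prop :=
  ∀ m, m ≠ d → Subsingleton (T m)

/-! ### Algebras with homogeneous relations of degree `N` -/

open TensorRing in
/-- A sub-`k`-`k`-bimodule `R` of `V^{⊗ N}`, where `N ≥ 2`. -/
structure HomogeneousRelations (k : Type u) (V : Type v) [Ring k] [AddCommGroup V] [Module k V]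
    [Module kᵐᵒᵖ V] (N : ℕ) where
  /-- the underlying additive group -/
  carrier : Submodule ℤ (TensorRing k V)
  scalar_mul_mem : ∀ (a : k) {x : TensorRing k V}, x ∈ carrier → scalar k V a * x ∈ carrier
  mul_scalar_mem : ∀ (a : k) {x : TensorRing k V}, x ∈ carrier → x * scalar k V a ∈ carrier
  le_tensorPow : carrier ≤ tensorPow k V N
  two_le : 2 ≤ N

namespace HomogeneousRelations

open TensorRing

variable {k : Type u} {V : Type v} [Ring k] [AddCommGroup V] [Module k V] [Module kᵐᵒᵖ V] {N : ℕ}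
variable (R : HomogeneousRelations k V N)

/-- The component `I(R)_n = ∑_{i+N+j=n} V^{⊗ i} R V^{⊗ j}` of the ideal generated by `R`. -/
noncomputable def idealComp (n : ℕ) : Submodule ℤ (TensorRing k V) :=
  ⨆ (i : ℕ) (j : ℕ) (_ : i + N + j = n), tensorPow k V i * R.carrier * tensorPow k V j

/-- `W_n = ⋂_{i+N+j=n} V^{⊗ i} R V^{⊗ j}`. -/
noncomputable def W (n : ℕ) : Submodule ℤ (TensorRing k V) :=
  ⨅ (i : ℕ) (j : ℕ) (_ : i + N + j = n), tensorPow k V i * R.carrier * tensorPow k V j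

/-- The two-sided ideal `I(R)` of `T(V)` generated by `R`. -/
noncomputable abbrev ideal : Ideal (TensorRing k V) :=
  (TwoSidedIdeal.span (R.carrier : Set (TensorRing k V))).asIdeal

/-- The algebra `A = T(V)/I(R)`. -/
def Alg : Type (max u v) := TensorRing k V ⧸ R.ideal

noncomputable instance : Ring R.Alg := inferInstanceAs (Ring (TensorRing k V ⧸ R.ideal))

/-- The projection `T(V) → A`. -/
noncomputable def proj : TensorRing k V →+* R.Alg := Ideal.Quotient.mk R.ideal

/-- The universal property of `A`. -/
noncomputable def lift {B : Type w} [Ring B] (f : TensorRing k V →+* B)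
    (hf : ∀ x ∈ R.carrier, f x = 0) : R.Alg →+* B :=
  Ideal.Quotient.lift R.ideal f (fun x hx => by
    have h : TwoSidedIdeal.span (R.carrier : Set (TensorRing k V)) ≤ TwoSidedIdeal.ker f :=
      TwoSidedIdeal.span_le.mpr fun y hy => (TwoSidedIdeal.mem_ker f).mpr (hf y hy)
    exact (TwoSidedIdeal.mem_ker f).mp (h hx))

theorem lift_proj {B : Type w} [Ring B] (f : TensorRing k V →+* B)
    (hf : ∀ x ∈ R.carrier, f x = 0) (x : TensorRing k V) : R.lift f hf (R.proj x) = f x := rfl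

/-- The component `A_n` of `A`, the image of `V^{⊗ n}`. -/
noncomputable def algComp (n : ℕ) : Submodule ℤ R.Alg :=
  (tensorPow k V n).map R.proj.toAddMonoidHom.toIntLinearMap

theorem tensorPow_induction {P : ℕ → TensorRing k V → Prop} (h0 : ∀ a, P 0 (scalar k V a))
    (hadd : ∀ n x y, P n x → P n y → P n (x + y))
    (hmul : ∀ n x v, x ∈ tensorPow k V n → P n x → P (n + 1) (x * vector k V v)) :
    ∀ (n : ℕ) (x : TensorRing k V), x ∈ tensorPow k V n → P n x := by
  intro n
  induction n with
  | zero => rintro _ ⟨a, rfl⟩; exact h0 a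
  | succ n ih =>
    intro x hx
    refine Submodule.mul_induction_on hx ?_ (fun x y => hadd _ x y)
    rintro y hy _ ⟨v, rfl⟩
    exact hmul n y v hy (ih y hy)

theorem mul_scalar_mem_tensorPow (n : ℕ) (x : TensorRing k V) (hx : x ∈ tensorPow k V n) (a : k) :
    x * scalar k V a ∈ tensorPow k V n := by
  revert a
  refine tensorPow_induction (P := fun n x => ∀ a : k, x * scalar k V a ∈ tensorPow k V n)
    ?_ ?_ ?_ n x hx
  · intro b a
    exact ⟨b * a, map_mul (scalar k V) b a⟩
  · intro n x y hx hy a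
    rw [add_mul]; exact Submodule.add_mem _ (hx a) (hy a)
  · intro n x v hx _ a
    rw [mul_assoc, ← vector_op_smul]
    exact Submodule.mul_mem_mul hx ⟨_, rfl⟩

theorem mul_mem_tensorPow (i j : ℕ) (x y : TensorRing k V) (hx : x ∈ tensorPow k V i)
    (hy : y ∈ tensorPow k V j) : x * y ∈ tensorPow k V (i + j) := by
  refine tensorPow_induction (P := fun j y => x * y ∈ tensorPow k V (i + j)) ?_ ?_ ?_ j y hy
  · intro a; exact mul_scalar_mem_tensorPow i x hx a
  · intro n y z hy hz; rw [mul_add]; exact Submodule.add_mem _ hy hz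
  · intro n y v _ hy
    rw [← mul_assoc]
    exact Submodule.mul_mem_mul hy ⟨v, rfl⟩

theorem exists_tensorPow_decomp (x : TensorRing k V) : x ∈ iSup (tensorPow k V) := by
  induction x using TensorRing.induction with
  | hs a => exact Submodule.mem_iSup_of_mem 0 ⟨a, rfl⟩
  | hv x =>
    refine Submodule.mem_iSup_of_mem 1 ?_
    rw [← one_mul (vector k V x)]
    exact Submodule.mul_mem_mul (M := tensorPow k V 0) ⟨1, map_one (scalar k V)⟩ ⟨x, rfl⟩
  | hadd x y hx hy => exact Submodule.add_mem _ hx hy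
  | hmul x y hx hy =>
    induction hx using Submodule.iSup_induction' with
    | mem i x hx =>
      induction hy using Submodule.iSup_induction' with
      | mem j y hy => exact Submodule.mem_iSup_of_mem (i + j) (mul_mem_tensorPow i j x y hx hy)
      | zero => simp
      | add y z _ _ hy hz => rw [mul_add]; exact Submodule.add_mem _ hy hz
    | zero => simp
    | add x z _ _ hx hz => rw [add_mul]; exact Submodule.add_mem _ hx hz

noncomputable instance : GradedRing R.algComp where
  one_mem := ⟨1, ⟨1, map_one (scalar k V)⟩, map_one R.proj⟩
  mul_mem := by
    rintro i j _ _ ⟨x, hx, rfl⟩ ⟨y, hy, rfl⟩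
    exact ⟨x * y, mul_mem_tensorPow i j x y hx hy, map_mul R.proj x y⟩
  toDecomposition := by
    refine DirectSum.IsInternal.chooseDecomposition _ ?_
    let g : V →+ Polynomial R.Alg :=
      (Polynomial.monomial 1).toAddMonoidHom.comp (R.proj.toAddMonoidHom.comp (vector k V))
    have hg : ∀ x, g x = Polynomial.monomial 1 (R.proj (vector k V x)) := fun x => rfl
    let φ : TensorRing k V →+* Polynomial R.Alg :=
      TensorRing.lift (Polynomial.C.comp (R.proj.comp (scalar k V))) g
        (fun a x => by simp [hg, vector_smul]) (fun a x => by simp [hg, vector_op_smul])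
    have hφ : ∀ (n : ℕ) (x : TensorRing k V), x ∈ tensorPow k V n →
        φ x = Polynomial.monomial n (R.proj x) := by
      refine tensorPow_induction ?_ ?_ ?_
      · intro a; exact TensorRing.lift_scalar _ _ _ _ a
      · intro n x y hx hy; rw [map_add, hx, hy, map_add, map_add]
      · intro n x v _ hx
        have hv : φ (vector k V v) = g v := TensorRing.lift_vector _ _ _ _ v
        rw [map_mul, hx, hv, hg, Polynomial.monomial_mul_monomial, map_mul R.proj]
    let ψ : R.Alg →+* Polynomial R.Alg := R.lift φ (fun x hx => by
      have hx0 : R.proj x = 0 := by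
        refine Ideal.Quotient.eq_zero_iff_mem.mpr ?_
        exact TwoSidedIdeal.subset_span hx
      rw [hφ N x (R.le_tensorPow hx), hx0, map_zero])
    refine isInternal_of_proj R.algComp
      (fun n => ((Polynomial.lcoeff R.Alg n).toAddMonoidHom.comp ψ.toAddMonoidHom).toIntLinearMap)
      ?_ ?_ ?_
    · rintro n _ ⟨x, hx, rfl⟩
      change (φ x).coeff n = R.proj x
      rw [hφ n x hx, Polynomial.coeff_monomial_same]
    · rintro n m hm _ ⟨x, hx, rfl⟩
      change (φ x).coeff n = 0
      rw [hφ m x hx, Polynomial.coeff_monomial_of_ne _ hm.symm]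
    · rw [eq_top_iff]
      intro y _
      obtain ⟨x, rfl⟩ := Ideal.Quotient.mk_surjective y
      have hx := exists_tensorPow_decomp x
      have h := Submodule.mem_map_of_mem (f := R.proj.toAddMonoidHom.toIntLinearMap) hx
      rw [Submodule.map_iSup] at h
      exact h

/-- The projection `ε : A → A_0 = k`, which is the identity on `k` and vanishes on `V`. -/
noncomputable def augmentation : R.Alg →+* k :=
  R.lift (TensorRing.lift (RingHom.id k) 0 (by simp) (by simp)) (by
    have h : ∀ (n : ℕ) (x : TensorRing k V), x ∈ tensorPow k V n → 1 ≤ n →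
        TensorRing.lift (RingHom.id k) (0 : V →+ k) (by simp) (by simp) x = 0 := by
      refine tensorPow_induction ?_ ?_ ?_
      · intro a h; omega
      · intro n x y hx hy hn; rw [map_add, hx hn, hy hn, add_zero]
      · intro n x v _ _ _; rw [map_mul, TensorRing.lift_vector]; simp
    intro x hx
    exact h N x (R.le_tensorPow hx) (by have := R.two_le; omega))

/-- The ring `k`, viewed as a left and a right `A`-module through `ε : A → k`. -/
def TrivialModule (_R : HomogeneousRelations k V N) : Type u := k

instance : AddCommGroup R.TrivialModule := inferInstanceAs (AddCommGroup k)

noncomputable instance : Module R.Alg R.TrivialModule :=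
  Module.compHom k R.augmentation

noncomputable instance : Module R.Algᵐᵒᵖ R.TrivialModule :=
  Module.compHom k R.augmentation.op

/-- The grading of `k`, concentrated in degree `0`. -/
def trivialComp (n : ℕ) : Submodule ℤ R.TrivialModule := if n = 0 then ⊤ else ⊥

theorem augmentation_eq_zero {n : ℕ} (hn : n ≠ 0) {a : R.Alg} (ha : a ∈ R.algComp n) :
    R.augmentation a = 0 := by
  obtain ⟨x, hx, rfl⟩ := ha
  have h : ∀ (n : ℕ) (x : TensorRing k V), x ∈ tensorPow k V n → n ≠ 0 →
      R.augmentation (R.proj x) = 0 := by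
    refine tensorPow_induction ?_ ?_ ?_
    · intro a h; exact absurd rfl h
    · intro n x y hx hy hn; rw [map_add, map_add, hx hn, hy hn, add_zero]
    · intro n x v _ _ _
      rw [map_mul, map_mul]
      have : R.augmentation (R.proj (vector k V v)) = 0 := TensorRing.lift_vector _ _ _ _ v
      rw [this, mul_zero]
  exact h n x hx hn

/-- The graded left `A`-module `_A k`. -/
noncomputable def trivialGrMod : GrMod.{max u v, u} R.algComp where
  carrier := R.TrivialModule
  comp := R.trivialComp
  smul_mem := by
    intro i j a x ha hx
    by_cases hj : j = 0
    · by_cases hi : i = 0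
      · subst hi hj; simp [trivialComp]
      · have : a • x = 0 := by
          have h : ∀ y : k, R.augmentation a * y = 0 := fun y => by
            rw [R.augmentation_eq_zero hi ha, zero_mul]
          exact h x
        rw [this]; exact Submodule.zero_mem _
    · have : x = 0 := by simpa [trivialComp, hj] using hx
      rw [this, smul_zero]; exact Submodule.zero_mem _
  isInternal := by
    refine isInternal_of_proj _ (fun n => if n = 0 then LinearMap.id else 0) ?_ ?_ ?_
    · intro n x hx
      by_cases hn : n = 0
      · simp [hn]
      · have : x = 0 := by simpa [trivialComp, hn] using hx
        simp [this]
    · intro n m hm x hx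
      by_cases hn : n = 0
      · have : x = 0 := by
          have hm0 : m ≠ 0 := fun h => hm (h.trans hn.symm)
          simpa [trivialComp, hm0] using hx
        simp [this]
      · simp [hn]
    · exact eq_top_iff.mpr fun x _ => Submodule.mem_iSup_of_mem 0 (by simp [trivialComp])

/-- The component of degree `m` of `Tor_n^A(k_A, _A k)`. -/
noncomputable abbrev Tor (n m : ℕ) : Type _ := GrTor R.trivialComp R.trivialGrMod n m

/-- The extra condition (ec): for `N + 2 ≤ n ≤ 2N - 1`,
`(V^{⊗(n-N)} R) ∩ (R V^{⊗(n-N)} + ⋯ + V^{⊗(n-N-1)} R V) = V^{⊗(n-N-1)} W_{N+1}`. -/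
def ExtraCondition : Prop :=
  ∀ n, N + 2 ≤ n → n ≤ 2 * N - 1 →
    (tensorPow k V (n - N) * R.carrier) ⊓
        (⨆ i ∈ Finset.range (n - N), tensorPow k V i * R.carrier * tensorPow k V (n - N - i)) =
      tensorPow k V (n - N - 1) * R.W (N + 1)

end HomogeneousRelations

/-! Over a von Neumann regular ring every module is flat. Inside `T(V)` this takes an equational
form (`exists_matrix_of_sum_mem_mul`): if `J` is stable under right multiplication by `k`, all `y i`
lie in `V^{⊗q}` and `∑ x i * y i` lies in `J V^{⊗q}`, then a square matrix `Q` over `k` satisfies `Q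
y = y` and has all entries of `x Q` in `J`. Two things follow. Products in `T(V)` behave well under
intersection (`mul_inf_mul_le`, `mul_inf_mul`), and `A ⊗_k S`, realized as `T(V)S / I(R)S` for a
subgroup `S` of `V^{⊗q}`, is flat over `A` (`isEquationallyFlat_tensorPair`).

Hence `A ⊗ R → A ⊗ V → A → k → 0` is exact with flat terms before `k`. Let `K` be the kernel of its
first map. It lies in `A₊(A ⊗ R)`, so dimension shifting (`subsingleton_grTor_iff`) and comparison
with the canonical resolution (`compare_resolutions`) show that `Tor_3` vanishes in degree `m`
exactly when `K_m ⊆ A₊K`. This is `subsingleton_tor_three_iff`.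

In degree `n ≥ N`, `K` is the quotient of `V^{⊗(n-N)}R ∩ I(R)_{n-1}V` by `I(R)_{n-N}R`. The
numerator is zero for `n ≤ N` and equals `W_{N+1}` for `n = N+1`. Since `A₊` is generated by `V`,
concentration of `Tor_3` in degree `N+1` means that `K` is generated by `W_{N+1}`, that is, the
numerator is `V^{⊗(n-N-1)}W_{N+1} + I(R)_{n-N}R` for all `n ≥ N+2` (`kernelDecomposable_iff`). For
`n ≤ 2N-1` the last summand is zero and the identity is (ec); for `n ≥ 2N` it is (d).

For the distributivity statement, `F + G = I(R)_{n-1}V` comes from splitting the sum that defines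
`I(R)_{n-1}`, and `E ∩ F = I(R)_{n-N}R` is flatness. The equality `E ∩ G = V^{⊗(n-N-1)}W_{N+1}` is
the case `2N-1` of (ec) (the definition of `W_3` if `N = 2`) multiplied on the left by
`V^{⊗(n-2N+1)}`, an operation that preserves the intersection. -/

/-! ### Generalized inverses over a von Neumann regular ring. -/

section VNR

variable {k : Type u} [Ring k]

/-- A finitely generated right ideal is generated by an idempotent: `∑ c i * y i` lies in the ideal
and is a left unit for its generators. -/
theorem IsVonNeumannRegular.exists_row (hk : IsVonNeumannRegular k) {ι : Type w} [Fintype ι]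
    (c : ι → k) : ∃ y : ι → k, ∀ j, (∑ i, c i * y i) * c j = c j := by
  classical
  suffices h : ∀ s : Finset ι, ∃ y : ι → k, ∀ j ∈ s, (∑ i ∈ s, c i * y i) * c j = c j by
    obtain ⟨y, hy⟩ := h Finset.univ
    exact ⟨y, fun j => hy j (Finset.mem_univ j)⟩
  intro s
  induction s using Finset.induction_on with
  | empty => exact ⟨0, by simp⟩
  | insert a s ha ih =>
    obtain ⟨y, hy⟩ := ih
    set e := ∑ i ∈ s, c i * y i with he
    obtain ⟨z, hz⟩ := hk ((1 - e) * c a)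
    -- Adding the generator `c a` changes `e` into `e + (1 - e) c_a z (1 - e)`, with `z` a
    -- quasi-inverse of `(1 - e) c_a`. The right factor `1 - e` leaves the old equations intact.
    refine ⟨fun i => if i = a then z * (1 - e) else y i - y i * c a * z * (1 - e), ?_⟩
    have hsum : ∑ i ∈ insert a s, c i * (if i = a then z * (1 - e) else
        y i - y i * c a * z * (1 - e)) = e + (1 - e) * c a * z * (1 - e) := by
      rw [Finset.sum_insert ha, if_pos rfl]
      have : ∑ i ∈ s, c i * (if i = a then z * (1 - e) else y i - y i * c a * z * (1 - e)) =
          ∑ i ∈ s, (c i * y i - c i * y i * (c a * z * (1 - e))) := by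
        refine Finset.sum_congr rfl fun i hi => ?_
        rw [if_neg (ne_of_mem_of_not_mem hi ha)]
        noncomm_ring
      rw [this, Finset.sum_sub_distrib, ← Finset.sum_mul, ← he]
      noncomm_ring
    rw [hsum]
    intro j hj
    rcases Finset.mem_insert.mp hj with rfl | hj
    · calc (e + (1 - e) * c j * z * (1 - e)) * c j
          = e * c j + (1 - e) * c j * z * ((1 - e) * c j) := by noncomm_ring
        _ = c j := by rw [hz]; noncomm_ring
    · have h0 : (1 - e) * c j = 0 := by rw [sub_mul, hy j hj, one_mul, sub_self]
      rw [add_mul, hy j hj, mul_assoc, h0, mul_zero, add_zero]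

/-- Rectangular matrices over a von Neumann regular ring have generalized inverses. -/
theorem IsVonNeumannRegular.exists_matrix (hk : IsVonNeumannRegular k) {ι : Type v} {κ : Type w}
    [Fintype ι] [Fintype κ] (c : Matrix ι κ k) : ∃ μ : Matrix κ ι k, c * μ * c = c := by
  classical
  suffices h : ∀ s : Finset ι, ∃ μ : Matrix κ ι k, ∀ j ∈ s, (c * μ * c) j = c j by
    obtain ⟨μ, hμ⟩ := h Finset.univ
    exact ⟨μ, funext fun j => hμ j (Finset.mem_univ j)⟩
  intro s
  induction s using Finset.induction_on with
  | empty => exact ⟨0, by simp⟩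
  | insert a s ha ih =>
    obtain ⟨μ, hμ⟩ := ih
    obtain ⟨y, hy⟩ := hk.exists_row fun l => (c - c * μ * c) a l
    let Y : Matrix κ Unit k := fun l _ => y l
    let r : Matrix Unit ι k := fun _ i => (1 - c * μ : Matrix ι ι k) a i
    have hr : ∀ u l, (r * c) u l = (c - c * μ * c) a l := by
      intro u l
      have : (r * c) u l = ((1 - c * μ : Matrix ι ι k) * c) a l := rfl
      rw [this, Matrix.sub_mul, Matrix.one_mul]
    -- The correction adds `(c - cμc) Y (r c)` to `cμc`. Rows already treated have zero residue, so
    -- they do not change; on row `a` the choice of `y` makes the added term equal to the residue.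
    refine ⟨μ + (1 - μ * c) * (Y * r), ?_⟩
    have key : c * (μ + (1 - μ * c) * (Y * r)) * c =
        c * μ * c + (c - c * μ * c) * Y * (r * c) := by
      simp only [Matrix.mul_add, Matrix.add_mul, Matrix.mul_sub, Matrix.sub_mul,
        Matrix.one_mul, Matrix.mul_assoc]
    rw [key]
    intro j hj
    ext l
    have h1 : ((c - c * μ * c) * Y * (r * c)) j l =
        (∑ i, (c - c * μ * c) j i * y i) * (c - c * μ * c) a l := by
      rw [Matrix.mul_apply]
      simp only [Finset.univ_unique, Finset.sum_singleton, hr]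
      rfl
    rw [Matrix.add_apply, h1]
    rcases Finset.mem_insert.mp hj with rfl | hj
    · rw [hy l, Matrix.sub_apply]; abel
    · have h0 : ∀ i, (c - c * μ * c) j i = 0 := fun i => by
        rw [Matrix.sub_apply, hμ j hj, sub_self]
      simp [h0, hμ j hj]

end VNR

/-! ### Injectivity of the multiplication `T(V) ⊗_k V → T(V)`. -/

namespace TensorRing

variable {k : Type u} {V : Type v} [Ring k] [AddCommGroup V] [Module k V] [Module kᵐᵒᵖ V]

variable (k V) in
/-- The relations of the left module `T(V) ⊗_k V` on the generators `1 ⊗ v`. -/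
noncomputable def tensorRelations : Submodule (TensorRing k V) (V →₀ TensorRing k V) :=
  Submodule.span _ {g | ∃ c : V →₀ k, (c.sum fun v a => a • v) = 0 ∧
    g = c.mapRange (scalar k V) (map_zero _)}

/-- The class of `1 ⊗ v` in `T(V) ⊗_k V`. -/
noncomputable def oneTensor (x : V) : (V →₀ TensorRing k V) ⧸ tensorRelations k V :=
  (tensorRelations k V).mkQ (Finsupp.single x 1)

theorem oneTensor_add (x y : V) :
    oneTensor (k := k) (x + y) = oneTensor x + oneTensor y := by
  rw [oneTensor, oneTensor, oneTensor, ← map_add, ← sub_eq_zero, ← map_sub,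
    Submodule.mkQ_apply, Submodule.Quotient.mk_eq_zero]
  refine Submodule.subset_span
    ⟨Finsupp.single (x + y) 1 - (Finsupp.single x 1 + Finsupp.single y 1), ?_, ?_⟩
  · rw [Finsupp.sum_sub_index (by simp [sub_smul]), Finsupp.sum_add_index' (by simp)
      (by simp [add_smul])]
    simp
  · have := Finsupp.mapRange_sub (f := scalar k V) (hf := map_zero _) (map_sub _)
      (Finsupp.single (x + y) 1) (Finsupp.single x 1 + Finsupp.single y 1)
    rw [this, Finsupp.mapRange_add (map_add _)]
    simp

theorem oneTensor_smul (a : k) (x : V) : oneTensor (k := k) (a • x) = scalar k V a • oneTensor x := by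
  rw [oneTensor, oneTensor, ← map_smul, ← sub_eq_zero, ← map_sub,
    Submodule.mkQ_apply, Submodule.Quotient.mk_eq_zero]
  refine Submodule.subset_span ⟨Finsupp.single (a • x) 1 - Finsupp.single x a, ?_, ?_⟩
  · rw [Finsupp.sum_sub_index (by simp [sub_smul])]
    simp
  · rw [Finsupp.mapRange_sub (map_sub _)]
    simp

theorem oneTensor_zero : oneTensor (k := k) (0 : V) = 0 := by
  simpa using oneTensor_smul (0 : k) (0 : V)

variable [SMulCommClass k kᵐᵒᵖ V]

/-- The action of `T(V)` on `(T(V) ⊗_k V) × k` in which `v` maps `(0, c)` to `1 ⊗ v c`. -/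
noncomputable def tensorAction :
    TensorRing k V →+* AddMonoid.End (((V →₀ TensorRing k V) ⧸ tensorRelations k V) × k) :=
  lift
    (RingHom.mk'
      { toFun := fun a => AddMonoidHom.mk' (fun p => (scalar k V a • p.1, a * p.2))
          (fun p q => Prod.ext (smul_add _ _ _) (mul_add _ _ _))
        map_one' := by
          ext p
          · change scalar k V 1 • p.1 = p.1; simp
          · change 1 * p.2 = p.2; simp
        map_mul' := fun a b => by
          ext p
          · change scalar k V (a * b) • p.1 = scalar k V a • scalar k V b • p.1
            rw [map_mul, mul_smul]
          · exact mul_assoc _ _ _ }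
      (fun a b => by
        ext p
        · change scalar k V (a + b) • p.1 = scalar k V a • p.1 + scalar k V b • p.1
          rw [map_add, add_smul]
        · exact add_mul _ _ _))
    (AddMonoidHom.mk'
      (fun x => AddMonoidHom.mk'
        (fun p => (vector k V x • p.1 + oneTensor (MulOpposite.op p.2 • x), 0))
        (fun p q => Prod.ext (by
          simp only [Prod.fst_add, Prod.snd_add, MulOpposite.op_add, add_smul, smul_add,
            oneTensor_add]
          abel) (add_zero _).symm))
      (fun x y => by
        ext p
        · change vector k V (x + y) • p.1 + oneTensor (MulOpposite.op p.2 • (x + y)) =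
            (vector k V x • p.1 + oneTensor (MulOpposite.op p.2 • x)) +
              (vector k V y • p.1 + oneTensor (MulOpposite.op p.2 • y))
          rw [map_add, add_smul, smul_add, oneTensor_add]
          abel
        · exact (add_zero _).symm))
    (fun a x => by
      ext p
      · change vector k V (a • x) • p.1 + oneTensor (MulOpposite.op p.2 • a • x) =
          scalar k V a • (vector k V x • p.1 + oneTensor (MulOpposite.op p.2 • x))
        rw [vector_smul, mul_smul, smul_add, ← oneTensor_smul,
          ← smul_comm a (MulOpposite.op p.2) x]
      · exact (mul_zero _).symm)
    (fun a x => by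
      ext p
      · change vector k V (MulOpposite.op a • x) • p.1 +
            oneTensor (MulOpposite.op p.2 • MulOpposite.op a • x) =
          vector k V x • scalar k V a • p.1 + oneTensor (MulOpposite.op (a * p.2) • x)
        rw [vector_op_smul, mul_smul, MulOpposite.op_mul, mul_smul]
      · rfl)

theorem tensorAction_scalar (a : k) (p) :
    tensorAction (V := V) (scalar k V a) p = (scalar k V a • p.1, a * p.2) :=
  DFunLike.congr_fun (lift_scalar _ _ _ _ a) p

theorem tensorAction_vector (x : V) (p) : tensorAction (vector k V x) p =
    (vector k V x • p.1 + oneTensor (MulOpposite.op p.2 • x), 0) :=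
  DFunLike.congr_fun (lift_vector _ _ _ _ x) p

/-- The first factor is a submodule on which the action is the given one. Acting on `(0, 1)`
therefore sends `t v` to `t ⊗ v`, which inverts multiplication. -/
theorem tensorAction_apply_zero (t : TensorRing k V) (m) : tensorAction t (m, 0) = (t • m, 0) := by
  induction t using TensorRing.induction generalizing m with
  | hs a => simp [tensorAction_scalar]
  | hv x => simp [tensorAction_vector, oneTensor_zero]
  | hadd x y hx hy =>
    have : tensorAction (x + y) (m, 0) = tensorAction x (m, 0) + tensorAction y (m, 0) := by
      rw [map_add]; rfl
    rw [this, hx, hy]; simp [add_smul]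
  | hmul x y hx hy =>
    have : tensorAction (x * y) (m, 0) = tensorAction x (tensorAction y (m, 0)) := by
      rw [map_mul]; rfl
    rw [this, hy, hx, mul_smul]

theorem tensorAction_mul_vector (t : TensorRing k V) (x : V) :
    tensorAction (t * vector k V x) (0, 1) = (t • oneTensor x, 0) := by
  have : tensorAction (t * vector k V x) (0, 1) =
      tensorAction t (tensorAction (vector k V x) (0, 1)) := by
    rw [map_mul]; rfl
  rw [this, tensorAction_vector, ← tensorAction_apply_zero]
  simp

/-- Since `T(V)` is given by generators and relations, tensors cannot be read off directly from an
element. Applying the relation to the vector `(0, 1)` under `tensorAction` recovers `∑ x i ⊗ y i`.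
-/
theorem sum_single_mem_tensorRelations {ι : Type w} [Fintype ι] (x : ι → TensorRing k V)
    (y : ι → V) (h : ∑ i, x i * vector k V (y i) = 0) :
    ∑ i, Finsupp.single (y i) (x i) ∈ tensorRelations k V := by
  rw [← Submodule.Quotient.mk_eq_zero, ← Submodule.mkQ_apply, map_sum]
  have h1 : ∀ i, (tensorRelations k V).mkQ (Finsupp.single (y i) (x i)) =
      (tensorAction (x i * vector k V (y i)) (0, 1)).1 := by
    intro i
    rw [tensorAction_mul_vector, oneTensor, ← map_smul, Finsupp.smul_single, smul_eq_mul, mul_one]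
  let ev : TensorRing k V →+ ((V →₀ TensorRing k V) ⧸ tensorRelations k V) × k :=
    AddMonoidHom.mk' (fun t => tensorAction t (0, 1)) (fun a b => by rw [map_add]; rfl)
  have h2 : ∑ i, tensorAction (x i * vector k V (y i)) (0, 1) = 0 := by
    have h3 := (map_sum ev (fun i => x i * vector k V (y i)) Finset.univ).symm
    rw [h, map_zero] at h3
    exact h3
  simp only [h1, ← Prod.fst_sum, h2, Prod.fst_zero]

end TensorRing

theorem Submodule.exists_sum_of_mem_mul {B : Type w} [Ring B] {M N : Submodule ℤ B} {x : B}
    (hx : x ∈ M * N) : ∃ (κ : Type) (_ : Fintype κ) (z y : κ → B),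
      (∀ m, z m ∈ M) ∧ (∀ m, y m ∈ N) ∧ x = ∑ m, z m * y m := by
  refine Submodule.mul_induction_on hx ?_ ?_
  · intro a ha b hb
    exact ⟨Unit, inferInstance, fun _ => a, fun _ => b, fun _ => ha, fun _ => hb, by simp⟩
  · rintro x x' ⟨κ, _, z, y, hz, hy, rfl⟩ ⟨κ', _, z', y', hz', hy', rfl⟩
    refine ⟨κ ⊕ κ', inferInstance, Sum.elim z z', Sum.elim y y', ?_, ?_, ?_⟩
    · rintro (m | m)
      exacts [hz m, hz' m]
    · rintro (m | m)
      exacts [hy m, hy' m]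
    · simp

/-- The right factors can be shared by the whole family: take the disjoint union of those used for
each element, padding the left factors with zeros. -/
theorem Submodule.exists_sum_of_forall_mem_mul {B : Type w} [Ring B] {M N : Submodule ℤ B}
    {ι : Type} [Fintype ι] {x : ι → B} (hx : ∀ i, x i ∈ M * N) :
    ∃ (κ : Type) (_ : Fintype κ) (z : ι → κ → B) (y : κ → B),
      (∀ i m, z i m ∈ M) ∧ (∀ m, y m ∈ N) ∧ ∀ i, x i = ∑ m, z i m * y m := by
  classical
  choose κ _ z y hz hy h using fun i => exists_sum_of_mem_mul (hx i)
  refine ⟨Σ i, κ i, inferInstance, fun i m => if i = m.1 then z m.1 m.2 else 0,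
    fun m => y m.1 m.2, ?_, fun m => hy _ _, ?_⟩
  · intro i m
    dsimp only
    split_ifs
    exacts [hz _ _, Submodule.zero_mem _]
  · intro i
    rw [Fintype.sum_sigma, Finset.sum_eq_single i, h i]
    · simp
    · intro j _ hj; simp [hj.symm]
    · simp

/-! ### Equational flatness over `k` and intersections of products in `T(V)`. -/

namespace TensorRing

variable {k : Type u} {V : Type v} [Ring k] [AddCommGroup V] [Module k V] [Module kᵐᵒᵖ V]

/-- With `d μ d = d`, the matrix `Q = d μ` fixes the columns of `d`, and `x Q = (x d) μ` inherits
membership in `J` from `x d`. This replaces rectangular coefficients by a square matrix acting on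
the original family, so the `y i` need not be changed. -/
theorem exists_square_matrix (hk : IsVonNeumannRegular k) {ι : Type*} {κ : Type*} [Fintype ι]
    [Fintype κ] {J : Submodule ℤ (TensorRing k V)} (hJ : ∀ x ∈ J, ∀ a, x * scalar k V a ∈ J)
    (x : ι → TensorRing k V) (d : Matrix ι κ k) (h : ∀ s, ∑ i, x i * scalar k V (d i s) ∈ J) :
    ∃ Q : Matrix ι ι k, Q * d = d ∧ ∀ j, ∑ i, x i * scalar k V (Q i j) ∈ J := by
  obtain ⟨μ, hμ⟩ := hk.exists_matrix d
  refine ⟨d * μ, hμ, fun j => ?_⟩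
  have : ∑ i, x i * scalar k V ((d * μ) i j) =
      ∑ s, (∑ i, x i * scalar k V (d i s)) * scalar k V (μ s j) := by
    simp only [Matrix.mul_apply, map_sum, map_mul, Finset.mul_sum, Finset.sum_mul, mul_assoc]
    exact Finset.sum_comm
  rw [this]
  exact Submodule.sum_mem _ fun s _ => hJ _ (h s) _

variable [SMulCommClass k kᵐᵒᵖ V]

/-- The vanishing tensor is a `T(V)`-combination of finitely many `k`-linear relations among
vectors. A generalized inverse of the matrix of these relations yields a projector that fixes the
vectors and annihilates the relations. -/
theorem exists_matrix_of_sum_vector (hk : IsVonNeumannRegular k) {ι : Type w} [Fintype ι]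
    (x : ι → TensorRing k V) (y : ι → V) (h : ∑ i, x i * vector k V (y i) = 0) :
    ∃ Q : Matrix ι ι k, (∀ i, y i = ∑ j, Q i j • y j) ∧
      ∀ j, ∑ i, x i * scalar k V (Q i j) = 0 := by
  classical
  obtain ⟨n, t, g, hg⟩ := Submodule.mem_span_set'.mp (sum_single_mem_tensorRelations x y h)
  choose c hc hgc using fun j => (g j).2
  let S : Finset V := Finset.univ.image y ∪ Finset.univ.biUnion fun j => (c j).support
  have hyS : ∀ i, y i ∈ S := fun i => Finset.mem_union_left _ (by simp)
  have hcS : ∀ j, (c j).support ⊆ S := fun j v hv =>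
    Finset.mem_union_right _ (Finset.mem_biUnion.mpr ⟨j, Finset.mem_univ j, hv⟩)
  let C : Matrix (Fin n) S k := fun j s => c j s
  obtain ⟨μ, hμ⟩ := hk.exists_matrix C
  -- `D` fixes the tuple of vectors in `S` because `C` kills it, while `C * D = 0` makes the left
  -- coefficients vanish after multiplication by `D`.
  let D : Matrix S S k := 1 - μ * C
  have hCD : C * D = 0 := by
    rw [Matrix.mul_sub, Matrix.mul_one, ← Matrix.mul_assoc, hμ, sub_self]
  have hC : ∀ j, ∑ s : S, C j s • (s : V) = 0 := by
    intro j
    rw [← hc j, Finsupp.sum_of_support_subset _ (hcS j) _ (by simp)]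
    exact Finset.sum_coe_sort S fun v => c j v • v
  have hD : ∀ r : S, (r : V) = ∑ s : S, D r s • (s : V) := by
    intro r
    have : ∑ s : S, D r s • (s : V) =
        ∑ s : S, (1 : Matrix S S k) r s • (s : V) - ∑ j, μ r j • ∑ s : S, C j s • (s : V) := by
      simp only [D, Matrix.sub_apply, sub_smul, Finset.sum_sub_distrib, Matrix.mul_apply,
        Finset.sum_smul, Finset.smul_sum, mul_smul]
      rw [Finset.sum_comm]
    rw [this]
    simp only [hC]
    simp [Matrix.one_apply]
  have hx : ∀ s, ∑ i, x i * scalar k V (D ⟨y i, hyS i⟩ s) = 0 := by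
    intro s
    -- Through `Finsupp.liftAddHom`, `F` multiplies a coefficient row by column `s` of `D`. It kills
    -- each summand `t j • g j`, as `C * D = 0`.
    let F : V → TensorRing k V →+ TensorRing k V := fun v =>
      if hv : v ∈ S then AddMonoidHom.mulRight (scalar k V (D ⟨v, hv⟩ s)) else 0
    have hF : ∀ (v) (hv : v ∈ S) (a), F v a = a * scalar k V (D ⟨v, hv⟩ s) := by
      intro v hv a
      simp [F, hv]
    have h1 := congrArg (Finsupp.liftAddHom F) hg
    rw [map_sum, map_sum] at h1
    have h2 : ∀ j, Finsupp.liftAddHom F (t j • (g j : V →₀ TensorRing k V)) = 0 := by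
      intro j
      have h3 : (t j • (g j : V →₀ TensorRing k V)).support ⊆ S := by
        refine Finsupp.support_smul.trans ?_
        rw [hgc j]
        exact Finsupp.support_mapRange.trans (hcS j)
      rw [Finsupp.liftAddHom_apply, Finsupp.sum_of_support_subset _ h3 _ (by simp),
        ← Finset.sum_coe_sort S]
      have h4 : ∀ r : S, F r ((t j • (g j : V →₀ TensorRing k V)) r) =
          t j * scalar k V (C j r * D r s) := by
        intro r
        rw [hF r r.2, Finsupp.smul_apply, hgc j, Finsupp.mapRange_apply, map_mul, smul_eq_mul,
          mul_assoc]
      simp only [h4]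
      rw [← Finset.mul_sum, ← map_sum]
      have h5 : ∑ r, C j r * D r s = 0 := congrFun (congrFun hCD j) s
      rw [h5, map_zero, mul_zero]
    simp only [h2, Finset.sum_const_zero, Finsupp.liftAddHom_apply_single] at h1
    rw [h1]
    exact Finset.sum_congr rfl fun i _ => (hF _ (hyS i) _).symm
  obtain ⟨Q, hQ, hxQ⟩ := exists_square_matrix hk (J := ⊥) (by simp) x
    (fun i s => D ⟨y i, hyS i⟩ s) (fun s => by rw [hx s]; exact Submodule.zero_mem _)
  refine ⟨Q, fun i => ?_, fun j => by simpa using hxQ j⟩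
  have h6 : ∀ i, y i = ∑ s, D ⟨y i, hyS i⟩ s • (s : V) := fun i => hD ⟨y i, hyS i⟩
  calc y i = ∑ s, D ⟨y i, hyS i⟩ s • (s : V) := h6 i
    _ = ∑ s, (∑ j, Q i j * D ⟨y j, hyS j⟩ s) • (s : V) :=
      Finset.sum_congr rfl fun s _ => by
        rw [← congrFun (congrFun hQ i) s]; rfl
    _ = ∑ j, Q i j • ∑ s, D ⟨y j, hyS j⟩ s • (s : V) := by
      simp only [Finset.sum_smul, Finset.smul_sum, mul_smul]
      exact Finset.sum_comm
    _ = ∑ j, Q i j • y j := Finset.sum_congr rfl fun j _ => by rw [← h6 j]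

/-- Induction on `q`: the case of vectors strips off the last tensor factor, and the induction
hypothesis handles what remains. -/
theorem exists_matrix_of_sum_eq_zero (hk : IsVonNeumannRegular k) (q : ℕ) :
    ∀ {ι : Type} [Fintype ι] (x y : ι → TensorRing k V), (∀ i, y i ∈ tensorPow k V q) →
      ∑ i, x i * y i = 0 → ∃ Q : Matrix ι ι k, (∀ i, y i = ∑ j, scalar k V (Q i j) * y j) ∧
        ∀ j, ∑ i, x i * scalar k V (Q i j) = 0 := by
  induction q with
  | zero =>
    intro ι _ x y hy h
    choose c hc using hy
    have hc : ∀ i, y i = scalar k V (c i) := fun i => (hc i).symm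
    obtain ⟨Q, hQ, hxQ⟩ := exists_square_matrix hk (J := ⊥) (by simp) x
      (fun i (_ : Unit) => c i) (fun s => by simpa [hc] using h)
    refine ⟨Q, fun i => ?_, fun j => by simpa using hxQ j⟩
    have e : ∑ j, Q i j * c j = c i := congrFun (congrFun hQ i) ()
    simp only [hc, ← map_mul, ← map_sum, e]
  | succ q ih =>
    intro ι _ x y hy h
    obtain ⟨κ, _, z, w, hz, hw, hyz⟩ := Submodule.exists_sum_of_forall_mem_mul hy
    choose u hu using hw
    have hu : ∀ m, w m = vector k V (u m) := fun m => (hu m).symm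
    obtain ⟨D, hD, hXD⟩ := exists_matrix_of_sum_vector hk (fun m => ∑ l, x l * z l m) u (by
      rw [← h]
      simp only [hyz, hu, Finset.mul_sum, Finset.sum_mul, mul_assoc]
      exact Finset.sum_comm)
    -- Replacing `z` by `z D` does not change the `y l`, since `D` fixes the vectors `u`, and the
    -- single relation `∑ x l * y l = 0` now splits into one relation of degree `q` for each `j`.
    let z' : κ → ι → TensorRing k V := fun j l => ∑ m, z l m * scalar k V (D m j)
    have hz' : ∀ j l, z' j l ∈ tensorPow k V q := fun j l => Submodule.sum_mem _ fun m _ =>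
      HomogeneousRelations.mul_scalar_mem_tensorPow q _ (hz l m) _
    have hyz' : ∀ l, y l = ∑ j, z' j l * vector k V (u j) := by
      intro l
      simp only [hyz, z', Finset.sum_mul]
      rw [Finset.sum_comm]
      refine Finset.sum_congr rfl fun m _ => ?_
      rw [hu, hD m, map_sum, Finset.mul_sum]
      simp only [vector_smul, mul_assoc]
    have hxz' : ∀ j, ∑ l, x l * z' j l = 0 := by
      intro j
      rw [← hXD j]
      simp only [z', Finset.mul_sum, Finset.sum_mul, mul_assoc]
      exact Finset.sum_comm
    choose P hP hxP using fun j => ih x (z' j) (hz' j) (hxz' j)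
    -- The matrices `P j` are placed side by side, so that one `Q` fixes the columns of all of them
    -- and hence every `z' j`.
    obtain ⟨Q, hQ, hxQ⟩ := exists_square_matrix hk (J := ⊥) (by simp) x
      (fun l (p : κ × ι) => P p.1 l p.2) (fun s => by simpa using hxP s.1 s.2)
    have hQz' : ∀ j l, z' j l = ∑ l', scalar k V (Q l l') * z' j l' := by
      intro j l
      have h1 : ∑ l', scalar k V (Q l l') * z' j l' =
          ∑ i, scalar k V (∑ l', Q l l' * P j l' i) * z' j i := by
        simp only [map_sum, map_mul, Finset.sum_mul, mul_assoc]
        rw [Finset.sum_comm]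
        refine Finset.sum_congr rfl fun l' _ => ?_
        rw [← Finset.mul_sum, ← hP j l']
      rw [h1, hP j l]
      refine Finset.sum_congr rfl fun i _ => ?_
      rw [← congrFun (congrFun hQ l) (j, i)]
      rfl
    refine ⟨Q, fun l => ?_, fun j => by simpa using hxQ j⟩
    simp only [hyz', Finset.mul_sum]
    rw [Finset.sum_comm]
    refine Finset.sum_congr rfl fun j _ => ?_
    rw [hQz' j l, Finset.sum_mul]
    simp only [mul_assoc]

/-- The equational criterion of flatness for `T(V) / J` and `V^{⊗ q}`. -/
theorem exists_matrix_of_sum_mem_mul (hk : IsVonNeumannRegular k) {q : ℕ}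
    {J : Submodule ℤ (TensorRing k V)} (hJ : ∀ x ∈ J, ∀ a, x * scalar k V a ∈ J)
    {ι : Type} [Fintype ι] (x y : ι → TensorRing k V) (hy : ∀ i, y i ∈ tensorPow k V q)
    (h : ∑ i, x i * y i ∈ J * tensorPow k V q) :
    ∃ Q : Matrix ι ι k, (∀ i, y i = ∑ j, scalar k V (Q i j) * y j) ∧
      ∀ j, ∑ i, x i * scalar k V (Q i j) ∈ J := by
  obtain ⟨κ, _, a, b, ha, hb, hab⟩ := Submodule.exists_sum_of_mem_mul h
  -- The expression in `J V^{⊗q}` is moved to the left with a sign. In the resulting matrix, the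
  -- rows belonging to `x` give combinations equal to combinations of the `a m`, which lie in `J`.
  obtain ⟨P, hP, hxP⟩ := exists_matrix_of_sum_eq_zero hk q (Sum.elim x (-a)) (Sum.elim y b)
    (by rintro (i | i); exacts [hy i, hb i]) (by simp [hab])
  obtain ⟨Q, hQ, hxQ⟩ := exists_square_matrix hk hJ x (fun i s => P (Sum.inl i) s) (by
    intro s
    have h1 := hxP s
    simp only [Fintype.sum_sum_type, Sum.elim_inl, Sum.elim_inr, Pi.neg_apply, neg_mul,
      Finset.sum_neg_distrib] at h1
    rw [add_neg_eq_zero.mp h1]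
    exact Submodule.sum_mem _ fun m _ => hJ _ (ha m) _)
  refine ⟨Q, fun i => ?_, hxQ⟩
  have h2 : ∀ i, y i = ∑ s, scalar k V (P (Sum.inl i) s) * Sum.elim y b s := fun i =>
    hP (Sum.inl i)
  have h1 : ∑ j, scalar k V (Q i j) * y j =
      ∑ s, scalar k V (∑ j, Q i j * P (Sum.inl j) s) * Sum.elim y b s := by
    simp only [map_sum, map_mul, Finset.sum_mul, mul_assoc]
    rw [Finset.sum_comm]
    refine Finset.sum_congr rfl fun j _ => ?_
    rw [← Finset.mul_sum, ← h2 j]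
  rw [h1, h2 i]
  refine Finset.sum_congr rfl fun s _ => ?_
  rw [← congrFun (congrFun hQ i) s]
  rfl

/-- Rewriting `∑ x i * y i` as `∑ (x Q) j * y j` puts the coefficients in `J` and keeps the right
factors in `P`. -/
theorem mul_inf_mul_le (hk : IsVonNeumannRegular k) {q : ℕ} {J P X : Submodule ℤ (TensorRing k V)}
    (hJ : ∀ x ∈ J, ∀ a, x * scalar k V a ∈ J) (hP : P ≤ tensorPow k V q) :
    X * P ⊓ J * tensorPow k V q ≤ J * P := by
  rintro t ⟨ht, ht'⟩
  obtain ⟨ι, _, x, y, -, hy, rfl⟩ := Submodule.exists_sum_of_mem_mul ht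
  obtain ⟨Q, hQ, hxQ⟩ := exists_matrix_of_sum_mem_mul hk hJ x y (fun i => hP (hy i)) ht'
  have : ∑ i, x i * y i = ∑ j, (∑ i, x i * scalar k V (Q i j)) * y j := by
    simp only [Finset.sum_mul]
    rw [Finset.sum_comm]
    refine Finset.sum_congr rfl fun i _ => ?_
    conv_lhs => rw [hQ i, Finset.mul_sum]
    simp only [mul_assoc]
  rw [this]
  exact Submodule.sum_mem _ fun j _ => Submodule.mul_mem_mul (hxQ j) (hy j)

/-- An equality `∑ x i * y i = ∑ a i * b i` is a relation whose matrix `Q` splits it: `1 - Q` fixes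
the left coefficients and kills `(y, -b)`, so each combination of the `y i` by a row of `1 - Q` is
also one of the `b i`, and lies in `P ∩ P'`. -/
theorem mul_inf_mul (hk : IsVonNeumannRegular k) {q : ℕ} {P P' X : Submodule ℤ (TensorRing k V)}
    (hP : P ≤ tensorPow k V q) (hP' : P' ≤ tensorPow k V q)
    (hsP : ∀ x ∈ P, ∀ a, scalar k V a * x ∈ P) (hsP' : ∀ x ∈ P', ∀ a, scalar k V a * x ∈ P') :
    X * P ⊓ X * P' = X * (P ⊓ P') := by
  classical
  refine le_antisymm ?_ (le_inf (mul_le_mul' le_rfl inf_le_left)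
    (mul_le_mul' le_rfl inf_le_right))
  rintro t ⟨ht, ht'⟩
  obtain ⟨ι, _, x, y, hx, hy, rfl⟩ := Submodule.exists_sum_of_mem_mul ht
  obtain ⟨κ, _, a, b, ha, hb, hab⟩ := Submodule.exists_sum_of_mem_mul ht'
  obtain ⟨Q, hQ, hxQ⟩ := exists_matrix_of_sum_eq_zero hk q (Sum.elim x a)
    (Sum.elim y (-b)) (by
      rintro (i | i)
      exacts [hP (hy i), neg_mem (hP' (hb i))]) (by simp [hab])
  have hz : ∀ s, Sum.elim x a s =
      ∑ r, Sum.elim x a r * scalar k V ((1 - Q : Matrix _ _ k) r s) := by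
    intro s
    simp only [Matrix.sub_apply, map_sub, mul_sub, Finset.sum_sub_distrib, hxQ, sub_zero,
      Matrix.one_apply]
    rw [Finset.sum_eq_single s (fun r _ hr => by rw [if_neg hr, map_zero, mul_zero]) (by simp),
      if_pos rfl, map_one, mul_one]
  have hz' : ∀ s, ∑ r, scalar k V ((1 - Q : Matrix _ _ k) s r) * Sum.elim y (-b) r = 0 := by
    intro s
    simp only [Matrix.sub_apply, map_sub, sub_mul, Finset.sum_sub_distrib, ← hQ,
      Matrix.one_apply]
    rw [Finset.sum_eq_single s
      (fun r _ hr => by rw [if_neg hr.symm, map_zero, zero_mul]) (by simp),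
      if_pos rfl, map_one, one_mul, sub_self]
  have h1 : ∑ i, x i * y i =
      ∑ r, Sum.elim x a r * ∑ i, scalar k V ((1 - Q : Matrix _ _ k) r (Sum.inl i)) * y i := by
    have h2 : ∀ i, x i = ∑ r, Sum.elim x a r * scalar k V ((1 - Q : Matrix _ _ k) r (Sum.inl i)) :=
      fun i => hz (Sum.inl i)
    simp only [Finset.mul_sum]
    rw [Finset.sum_comm]
    refine Finset.sum_congr rfl fun i _ => ?_
    conv_lhs => rw [h2 i, Finset.sum_mul]
    simp only [mul_assoc]
  rw [h1]
  refine Submodule.sum_mem _ fun r _ => Submodule.mul_mem_mul ?_ ⟨?_, ?_⟩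
  · rcases r with i | i
    exacts [hx i, ha i]
  · exact Submodule.sum_mem _ fun i _ => hsP _ (hy i) _
  · have h3 := hz' r
    simp only [Fintype.sum_sum_type, Sum.elim_inl, Sum.elim_inr, Pi.neg_apply, mul_neg,
      Finset.sum_neg_distrib] at h3
    rw [add_neg_eq_zero.mp h3]
    exact Submodule.sum_mem _ fun i _ => hsP' _ (hb i) _

end TensorRing

/-! ### Flat left modules over a noncommutative ring. -/

section EquationalFlatness

/-- Flatness of a left module over a noncommutative ring, in the form of the equational
criterion. -/
def IsEquationallyFlat (A : Type u) (M : Type v) [Ring A] [AddCommGroup M] [Module A M] : Prop :=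
  ∀ (ι : Type) [Fintype ι] (a : ι → A) (q : ι → M), ∑ i, a i • q i = 0 →
    ∃ (κ : Type) (_ : Fintype κ) (b : ι → κ → A) (y : κ → M),
      (∀ i, q i = ∑ j, b i j • y j) ∧ ∀ j, ∑ i, a i * b i j = 0

variable {A : Type u} [Ring A]

theorem Submodule.exists_sum_of_mem_ideal_smul {M : Type v} [AddCommGroup M] [Module A M]
    {𝔪 : Ideal A} {N : Submodule A M} {x : M} (hx : x ∈ 𝔪 • N) :
    ∃ (ι : Type) (_ : Fintype ι) (a : ι → A) (y : ι → M),
      (∀ i, a i ∈ 𝔪) ∧ (∀ i, y i ∈ N) ∧ x = ∑ i, a i • y i := by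
  refine Submodule.smul_induction_on hx ?_ ?_
  · intro a ha y hy
    exact ⟨Unit, inferInstance, fun _ => a, fun _ => y, fun _ => ha, fun _ => hy, by simp⟩
  · rintro x x' ⟨ι, _, a, y, ha, hy, rfl⟩ ⟨ι', _, a', y', ha', hy', rfl⟩
    refine ⟨ι ⊕ ι', inferInstance, Sum.elim a a', Sum.elim y y', ?_, ?_, by simp⟩
    · rintro (i | i)
      exacts [ha i, ha' i]
    · rintro (i | i)
      exacts [hy i, hy' i]

namespace IsEquationallyFlat

variable {M : Type v} [AddCommGroup M] [Module A M]

/-- Equations are trivialized one at a time: after the first ones, the next equation is rewritten in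
the new generators, where flatness applies again, and the earlier equations survive right
multiplication. -/
theorem system (hM : IsEquationallyFlat A M) {σ ι : Type} [Fintype σ] [Fintype ι]
    (a : σ → ι → A) (q : ι → M) (h : ∀ s, ∑ i, a s i • q i = 0) :
    ∃ (κ : Type) (_ : Fintype κ) (b : ι → κ → A) (y : κ → M),
      (∀ i, q i = ∑ j, b i j • y j) ∧ ∀ s j, ∑ i, a s i * b i j = 0 := by
  classical
  suffices H : ∀ t : Finset σ, ∃ (κ : Type) (_ : Fintype κ) (b : ι → κ → A) (y : κ → M),
      (∀ i, q i = ∑ j, b i j • y j) ∧ ∀ s ∈ t, ∀ j, ∑ i, a s i * b i j = 0 by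
    obtain ⟨κ, _, b, y, hq, hab⟩ := H Finset.univ
    exact ⟨κ, inferInstance, b, y, hq, fun s => hab s (Finset.mem_univ s)⟩
  intro t
  induction t using Finset.induction_on with
  | empty =>
    refine ⟨ι, inferInstance, fun i j => if i = j then 1 else 0, q, fun i => ?_, by simp⟩
    simp
  | insert s t hs ih =>
    obtain ⟨κ, _, b, y, hq, hab⟩ := ih
    obtain ⟨κ', _, b', y', hy, hab'⟩ := hM κ (fun j => ∑ i, a s i * b i j) y (by
      rw [← h s]
      simp only [hq, Finset.sum_smul, Finset.smul_sum, mul_smul]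
      exact Finset.sum_comm)
    have hassoc : ∀ r l, ∑ i, a r i * ∑ j, b i j * b' j l =
        ∑ j, (∑ i, a r i * b i j) * b' j l := by
      intro r l
      simp only [Finset.mul_sum, Finset.sum_mul, mul_assoc]
      exact Finset.sum_comm
    refine ⟨κ', inferInstance, fun i l => ∑ j, b i j * b' j l, y', fun i => ?_, ?_⟩
    · rw [hq i]
      simp only [hy, Finset.sum_smul, Finset.smul_sum, mul_smul]
      exact Finset.sum_comm
    · intro r hr l
      rw [hassoc]
      rcases Finset.mem_insert.mp hr with rfl | hr
      · exact hab' l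
      · simp [hab r hr]

theorem finsupp (S : Type w) : IsEquationallyFlat A (S →₀ A) := by
  classical
  intro ι _ a q h
  let T : Finset S := Finset.univ.biUnion fun i => (q i).support
  have hT : ∀ i, (q i).support ⊆ T := fun i s hs =>
    Finset.mem_biUnion.mpr ⟨i, Finset.mem_univ i, hs⟩
  let e := T.equivFin
  refine ⟨Fin T.card, inferInstance, fun i j => q i (e.symm j),
    fun j => Finsupp.single (e.symm j) 1, fun i => ?_, fun j => ?_⟩
  · rw [← Equiv.sum_comp e]
    simp only [Equiv.symm_apply_apply, Finsupp.smul_single, smul_eq_mul, mul_one]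
    rw [Finset.sum_coe_sort T fun s => Finsupp.single s (q i s)]
    conv_lhs => rw [← Finsupp.sum_single (q i)]
    exact Finsupp.sum_of_support_subset _ (hT i) _ (by simp)
  · have := DFunLike.congr_fun h (e.symm j : S)
    simpa [Finsupp.finsetSum_apply] using this

theorem prod {M' : Type w} [AddCommGroup M'] [Module A M'] (hM : IsEquationallyFlat A M)
    (hM' : IsEquationallyFlat A M') : IsEquationallyFlat A (M × M') := by
  intro ι _ a q h
  obtain ⟨κ, _, b, y, hq, hab⟩ := hM ι a (fun i => (q i).1) (by
    simpa [Prod.fst_sum] using congrArg Prod.fst h)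
  obtain ⟨κ', _, b', y', hq', hab'⟩ := hM' ι a (fun i => (q i).2) (by
    simpa [Prod.snd_sum] using congrArg Prod.snd h)
  refine ⟨κ ⊕ κ', inferInstance, fun i => Sum.elim (b i) (b' i),
    Sum.elim (fun j => (y j, 0)) (fun j => (0, y' j)), fun i => ?_, ?_⟩
  · ext
    · simp [Prod.fst_sum, hq]
    · simp [Prod.snd_sum, hq']
  · rintro (j | j)
    exacts [hab j, hab' j]

variable {F : Type v} {Q : Type w} [AddCommGroup F] [Module A F] [AddCommGroup Q] [Module A Q]

/-- Trivialize the relation in `F` by elements `y j`; their images satisfy the system `b`, which is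
trivialized in `Q` by `c`. Subtracting lifts `∑ c j l • x' l` moves the `y j` into the kernel
without changing the `z i`, because `b c = 0`. -/
theorem ker (hF : IsEquationallyFlat A F) (hQ : IsEquationallyFlat A Q) (f : F →ₗ[A] Q)
    (hf : Function.Surjective f) : IsEquationallyFlat A (LinearMap.ker f) := by
  intro ι _ a z h
  obtain ⟨κ, _, b, y, hz, hab⟩ := hF ι a (fun i => (z i : F)) (by
    simpa using congrArg (LinearMap.ker f).subtype h)
  obtain ⟨κ', _, c, x, hy, hbc⟩ := hQ.system b (fun j => f (y j)) (fun i => by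
    simp only [← map_smul, ← map_sum, ← hz]
    exact (z i).2)
  choose x' hx' using fun l => hf (x l)
  have hmem : ∀ j, y j - ∑ l, c j l • x' l ∈ LinearMap.ker f := by
    intro j
    rw [LinearMap.mem_ker, map_sub, hy j, map_sum]
    simp [hx']
  refine ⟨κ, inferInstance, b, fun j => ⟨_, hmem j⟩, fun i => Subtype.ext ?_, hab⟩
  have h0 : ∑ j, b i j • ∑ l, c j l • x' l = 0 := by
    simp only [Finset.smul_sum, ← mul_smul]
    rw [Finset.sum_comm]
    simp only [← Finset.sum_smul, hbc, zero_smul, Finset.sum_const_zero]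
  have h1 : (((∑ j, b i j • (⟨_, hmem j⟩ : LinearMap.ker f)) : LinearMap.ker f) : F) =
      ∑ j, b i j • (y j - ∑ l, c j l • x' l) := by
    simp
  rw [h1]
  simp only [smul_sub, Finset.sum_sub_distrib, h0, sub_zero, hz i]

/-- This is the vanishing of `Tor_1(A/𝔪, Q)` for flat `Q`, in the form `ker f ∩ 𝔪F ⊆ 𝔪 ker f`. -/
theorem mem_smul_ker (hQ : IsEquationallyFlat A Q) (f : F →ₗ[A] Q) (hf : Function.Surjective f)
    {𝔪 : Ideal A} {x : F} (hx : f x = 0) (hx' : x ∈ 𝔪 • (⊤ : Submodule A F)) :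
    x ∈ 𝔪 • LinearMap.ker f := by
  obtain ⟨ι, _, a, y, ha, -, rfl⟩ := Submodule.exists_sum_of_mem_ideal_smul hx'
  obtain ⟨κ, _, b, z, hy, hab⟩ := hQ ι a (fun i => f (y i)) (by simpa using hx)
  choose z' hz' using fun j => hf (z j)
  have h0 : ∑ i, a i • ∑ j, b i j • z' j = 0 := by
    simp only [Finset.smul_sum, ← mul_smul]
    rw [Finset.sum_comm]
    simp only [← Finset.sum_smul, hab, zero_smul, Finset.sum_const_zero]
  have h1 : ∑ i, a i • y i = ∑ i, a i • (y i - ∑ j, b i j • z' j) := by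
    simp only [smul_sub, Finset.sum_sub_distrib, h0, sub_zero]
  rw [h1]
  refine Submodule.sum_mem _ fun i _ => Submodule.smul_mem_smul (ha i) ?_
  rw [LinearMap.mem_ker, map_sub, hy i, map_sum]
  simp [hz']

end IsEquationallyFlat

end EquationalFlatness

/-! ### Comparison of two flat resolutions by a mapping cone. -/

section Comparison

variable {A : Type u} [Ring A] {M : Type*} [AddCommGroup M] [Module A M]
  {P₀ P₁ P₂ F₀ F₁ F₂ : Type*}
  [AddCommGroup P₀] [Module A P₀] [AddCommGroup P₁] [Module A P₁] [AddCommGroup P₂] [Module A P₂]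
  [AddCommGroup F₀] [Module A F₀] [AddCommGroup F₁] [Module A F₁] [AddCommGroup F₂] [Module A F₂]
  {π : P₀ →ₗ[A] M} {d₁ : P₁ →ₗ[A] P₀} {d₂ : P₂ →ₗ[A] P₁}
  {ε : F₀ →ₗ[A] M} {δ₁ : F₁ →ₗ[A] F₀} {δ₂ : F₂ →ₗ[A] F₁}
  {φ₀ : P₀ →ₗ[A] F₀} {φ₁ : P₁ →ₗ[A] F₁} {φ₂ : P₂ →ₗ[A] F₂}

/-- Comparison of the kernels of two partial flat resolutions of the same module, modulo an
ideal: an element of `ker d₂` in `𝔪 P₂` lies in `𝔪 (ker d₂)` if its image does, and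
elements of `ker δ₂` in `𝔪 F₂` come from `ker d₂` modulo `𝔪 (ker δ₂)`. -/
theorem compare_resolutions (hπ : Function.Surjective π) (hd₁ : Function.Exact d₁ π)
    (hd₂ : Function.Exact d₂ d₁) (hδ₁ : Function.Exact δ₁ ε)
    (hδ₂ : Function.Exact δ₂ δ₁) (hφ₀ : ∀ x, ε (φ₀ x) = π x)
    (hφ₁ : ∀ x, δ₁ (φ₁ x) = φ₀ (d₁ x)) (hφ₂ : ∀ x, δ₂ (φ₂ x) = φ₁ (d₂ x))
    (hP₀ : IsEquationallyFlat A P₀) (hP₁ : IsEquationallyFlat A P₁)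
    (hF₀ : IsEquationallyFlat A F₀) (hF₁ : IsEquationallyFlat A F₁)
    (hF₂ : IsEquationallyFlat A F₂) (𝔪 : Ideal A) :
    (∀ x, d₂ x = 0 → x ∈ 𝔪 • (⊤ : Submodule A P₂) → φ₂ x ∈ 𝔪 • LinearMap.ker δ₂ →
      x ∈ 𝔪 • LinearMap.ker d₂) ∧
    (∀ y, δ₂ y = 0 → y ∈ 𝔪 • (⊤ : Submodule A F₂) →
      ∃ x ∈ 𝔪 • (⊤ : Submodule A P₂), d₂ x = 0 ∧ y - φ₂ x ∈ 𝔪 • LinearMap.ker δ₂) := by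
  -- The maps `g₁`, `g₂`, `g₃` are the differentials of the mapping cone of `φ`, truncated by `ker
  -- δ₂`. The cone is exact, so the kernels of `g₁` and `g₂` are flat one after the other, as
  -- kernels of surjections between flat modules.
  let g₁ : (F₁ × P₀) →ₗ[A] F₀ := δ₁.comp (LinearMap.fst A F₁ P₀) - φ₀.comp (LinearMap.snd A F₁ P₀)
  have hg₁ : ∀ p, g₁ p = δ₁ p.1 - φ₀ p.2 := fun p => rfl
  have hg₁s : Function.Surjective g₁ := by
    intro f
    obtain ⟨p, hp⟩ := hπ (ε f)
    obtain ⟨f₁, hf₁⟩ := (hδ₁ (f - φ₀ p)).mp (by rw [map_sub, hφ₀, hp, sub_self])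
    exact ⟨(f₁, -p), by rw [hg₁, hf₁, map_neg]; abel⟩
  have hZ₁ := (hF₁.prod hP₀).ker hF₀ g₁ hg₁s
  let g₂ : (F₂ × P₁) →ₗ[A] LinearMap.ker g₁ := LinearMap.codRestrict _
    ((φ₁.comp (LinearMap.snd A F₂ P₁) - δ₂.comp (LinearMap.fst A F₂ P₁)).prod
      (d₁.comp (LinearMap.snd A F₂ P₁))) (by
        intro p
        change δ₁ (φ₁ p.2 - δ₂ p.1) - φ₀ (d₁ p.2) = 0
        rw [map_sub, hφ₁, hδ₂.apply_apply_eq_zero]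
        abel)
  have hg₂ : ∀ p, (g₂ p : F₁ × P₀) = (φ₁ p.2 - δ₂ p.1, d₁ p.2) := fun p => rfl
  have hg₂s : Function.Surjective g₂ := by
    rintro ⟨⟨f, p⟩, h⟩
    have h : δ₁ f = φ₀ p := sub_eq_zero.mp h
    obtain ⟨p₁, rfl⟩ := (hd₁ p).mp (by rw [← hφ₀, ← h, hδ₁.apply_apply_eq_zero])
    obtain ⟨f₂, hf₂⟩ := (hδ₂ (φ₁ p₁ - f)).mp (by rw [map_sub, h, hφ₁, sub_self])
    exact ⟨(f₂, p₁), Subtype.ext (by rw [hg₂]; simp [hf₂])⟩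
  have hZ₂ := (hF₂.prod hP₁).ker hZ₁ g₂ hg₂s
  have hker₂ : ∀ p, g₂ p = 0 ↔ φ₁ p.2 = δ₂ p.1 ∧ d₁ p.2 = 0 := by
    intro p
    rw [← Subtype.coe_inj, hg₂, ZeroMemClass.coe_zero, Prod.mk_eq_zero, sub_eq_zero]
  let g₃ : (LinearMap.ker δ₂ × P₂) →ₗ[A] LinearMap.ker g₂ := LinearMap.codRestrict _
    ((φ₂.comp (LinearMap.snd A _ P₂) -
      (LinearMap.ker δ₂).subtype.comp (LinearMap.fst A _ P₂)).prod
      (d₂.comp (LinearMap.snd A _ P₂))) (by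
        intro p
        refine (hker₂ _).mpr ⟨?_, hd₂.apply_apply_eq_zero _⟩
        change φ₁ (d₂ p.2) = δ₂ (φ₂ p.2 - (p.1 : F₂))
        rw [map_sub, hφ₂, LinearMap.mem_ker.mp p.1.2, sub_zero])
  have hg₃ : ∀ p, (g₃ p : F₂ × P₁) = (φ₂ p.2 - (p.1 : F₂), d₂ p.2) := fun p => rfl
  have hg₃s : Function.Surjective g₃ := by
    rintro ⟨⟨f, p⟩, h⟩
    obtain ⟨h, h'⟩ := (hker₂ _).mp h
    change φ₁ p = δ₂ f at h
    obtain ⟨p₂, rfl⟩ := (hd₂ p).mp h'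
    have hk : φ₂ p₂ - f ∈ LinearMap.ker δ₂ := by
      rw [LinearMap.mem_ker, map_sub, hφ₂, h, sub_self]
    exact ⟨(⟨_, hk⟩, p₂), Subtype.ext (by rw [hg₃]; simp)⟩
  constructor
  · intro x hx hx' hφx
    have hk : φ₂ x ∈ LinearMap.ker δ₂ := by rw [LinearMap.mem_ker, hφ₂, hx, map_zero]
    have hmem : ((⟨φ₂ x, hk⟩, x) : LinearMap.ker δ₂ × P₂) ∈
        𝔪 • (⊤ : Submodule A (LinearMap.ker δ₂ × P₂)) := by
      have h1 : (⟨φ₂ x, hk⟩ : LinearMap.ker δ₂) ∈ 𝔪 • (⊤ : Submodule A (LinearMap.ker δ₂)) :=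
        (Submodule.mem_smul_top_iff _ _ _).mpr hφx
      have h2 := Submodule.mem_map_of_mem (f := LinearMap.inl A (LinearMap.ker δ₂) P₂) h1
      have h3 := Submodule.mem_map_of_mem (f := LinearMap.inr A (LinearMap.ker δ₂) P₂) hx'
      rw [Submodule.map_smul''] at h2 h3
      have h4 := Submodule.add_mem _ (Submodule.smul_mono le_rfl le_top h2)
        (Submodule.smul_mono le_rfl le_top h3)
      simpa using h4
    -- The kernel of `g₃` consists of the pairs `(φ₂ x, x)` with `d₂ x = 0`; its second projection
    -- is `ker d₂`.
    have h5 := hZ₂.mem_smul_ker g₃ hg₃s (Subtype.ext (by rw [hg₃]; simp [hx])) hmem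
    have h6 := Submodule.mem_map_of_mem (f := LinearMap.snd A (LinearMap.ker δ₂) P₂) h5
    rw [Submodule.map_smul''] at h6
    refine Submodule.smul_mono le_rfl ?_ h6
    rintro _ ⟨p, hp, rfl⟩
    exact congrArg (fun z : LinearMap.ker g₂ => (z : F₂ × P₁).2) hp
  · intro y hy hy'
    have hyk : ((y, 0) : F₂ × P₁) ∈ LinearMap.ker g₂ := (hker₂ _).mpr ⟨by simp [hy], map_zero _⟩
    have h1 : ((y, 0) : F₂ × P₁) ∈ 𝔪 • LinearMap.ker g₂ := by
      refine hZ₁.mem_smul_ker g₂ hg₂s hyk ?_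
      have h2 := Submodule.mem_map_of_mem (f := LinearMap.inl A F₂ P₁) hy'
      rw [Submodule.map_smul''] at h2
      exact Submodule.smul_mono le_rfl le_top h2
    have h3 : (⟨_, hyk⟩ : LinearMap.ker g₂) ∈ 𝔪 • (⊤ : Submodule A (LinearMap.ker g₂)) :=
      (Submodule.mem_smul_top_iff _ _ _).mpr h1
    -- Surjectivity of `g₃` lifts `(y, 0)` to a pair `(z, x)` with both entries in the
    -- `𝔪`-multiples, and `z = φ₂ x - y`.
    rw [← LinearMap.range_eq_top.mpr hg₃s, ← Submodule.map_top, ← Submodule.map_smul''] at h3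
    obtain ⟨⟨z, x⟩, hzx, h4⟩ := h3
    have h5 : (φ₂ x - (z : F₂), d₂ x) = (y, 0) := congrArg Subtype.val h4
    obtain ⟨h6, h7⟩ := Prod.mk_inj.mp h5
    refine ⟨x, ?_, h7, ?_⟩
    · have h8 := Submodule.mem_map_of_mem (f := LinearMap.snd A (LinearMap.ker δ₂) P₂) hzx
      rw [Submodule.map_smul''] at h8
      exact Submodule.smul_mono le_rfl le_top h8
    · have h8 := Submodule.mem_map_of_mem (f := LinearMap.fst A (LinearMap.ker δ₂) P₂) hzx
      rw [Submodule.map_smul''] at h8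
      have h9 := (Submodule.mem_smul_top_iff 𝔪 (LinearMap.ker δ₂) z).mp
        (Submodule.smul_mono le_rfl le_top h8)
      have h10 : y - φ₂ x = -(z : F₂) := by rw [← h6]; abel
      rw [h10]
      exact neg_mem h9

end Comparison

/-! ### Homogeneous components and graded comparison maps. -/

namespace GrMod

variable {A : Type v} [Ring A] {𝒜 : ℕ → Submodule ℤ A}

/-- The projection of a graded module onto its component of degree `n`. -/
noncomputable def proj (M : GrMod.{v, w} 𝒜) (n : ℕ) : M.carrier →ₗ[ℤ] M.carrier :=
  M.exists_proj.choose n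

variable (M : GrMod.{v, w} 𝒜)

theorem proj_mem (n : ℕ) (x : M.carrier) : M.proj n x ∈ M.comp n :=
  M.exists_proj.choose_spec.1 n x

theorem proj_of_mem {n : ℕ} {x : M.carrier} (hx : x ∈ M.comp n) : M.proj n x = x :=
  M.exists_proj.choose_spec.2.1 n x hx

theorem proj_of_mem_of_ne {n m : ℕ} (h : m ≠ n) {x : M.carrier} (hx : x ∈ M.comp m) :
    M.proj n x = 0 :=
  M.exists_proj.choose_spec.2.2.1 n m h x hx

theorem mem_iSup_comp (x : M.carrier) : x ∈ iSup M.comp := by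
  rw [M.isInternal.submodule_iSup_eq_top]
  trivial

/-- Graded maps commute with the projections onto the components. -/
theorem proj_map {B : Type*} [Ring B] {ℬ : ℕ → Submodule ℤ B} {N : GrMod ℬ}
    {f : M.carrier →+ N.carrier} (hf : ∀ n, ∀ x ∈ M.comp n, f x ∈ N.comp n) (n : ℕ)
    (x : M.carrier) : N.proj n (f x) = f (M.proj n x) := by
  induction M.mem_iSup_comp x using Submodule.iSup_induction' with
  | mem m x hx =>
    by_cases h : m = n
    · subst h; rw [M.proj_of_mem hx, N.proj_of_mem (hf m x hx)]
    · rw [M.proj_of_mem_of_ne h hx, N.proj_of_mem_of_ne h (hf m x hx), map_zero]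
  | zero => simp
  | add x y _ _ hx hy => simp only [map_add, hx, hy]

theorem proj_smul {i : ℕ} {a : A} (ha : a ∈ 𝒜 i) (n : ℕ) (x : M.carrier) :
    M.proj n (a • x) = if i ≤ n then a • M.proj (n - i) x else 0 := by
  induction M.mem_iSup_comp x using Submodule.iSup_induction' with
  | mem m x hx =>
    by_cases h : i + m = n
    · subst h
      rw [M.proj_of_mem (M.smul_mem ha hx), if_pos (by omega), Nat.add_sub_cancel_left,
        M.proj_of_mem hx]
    · rw [M.proj_of_mem_of_ne h (M.smul_mem ha hx)]
      split_ifs with h'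
      · rw [M.proj_of_mem_of_ne (by omega) hx, smul_zero]
      · rfl
  | zero => simp
  | add x y _ _ hx hy =>
    rw [smul_add, map_add, map_add, hx, hy]
    split_ifs <;> simp [smul_add]

variable [GradedRing 𝒜]

theorem proj_mem_smul {𝔪 : Ideal A}
    (h𝔪 : ∀ a ∈ 𝔪, ∀ i, (DirectSum.decompose 𝒜 a i : A) ∈ 𝔪) {L : Submodule A M.carrier}
    (hL : ∀ n, ∀ x ∈ L, M.proj n x ∈ L) (n : ℕ) {x : M.carrier} (hx : x ∈ 𝔪 • L) :
    M.proj n x ∈ 𝔪 • L := by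
  classical
  refine Submodule.smul_induction_on hx ?_ ?_
  · intro a ha y hy
    rw [← DirectSum.sum_support_decompose 𝒜 a, Finset.sum_smul, map_sum]
    refine Submodule.sum_mem _ fun i _ => ?_
    rw [M.proj_smul (SetLike.coe_mem _)]
    split_ifs
    · exact Submodule.smul_mem_smul (h𝔪 a ha i) (hL _ y hy)
    · exact Submodule.zero_mem _
  · intro x y hx hy
    rw [map_add]
    exact Submodule.add_mem _ hx hy

theorem cover_single (s : M.Homog) (a : A) :
    M.cover (Finsupp.single s a : M.Homog →₀ A) = a • (s.2 : M.carrier) :=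
  Finsupp.linearCombination_single A a s

/-- A preimage of a homogeneous basis image is replaced by its component of the same degree, which
is again a preimage because `δ` is graded. -/
theorem exists_lift_of_free {N : GrMod.{v, w} 𝒜} {F F' : GrMod 𝒜}
    {δ : F.carrier →ₗ[A] F'.carrier} (hδ : ∀ n, ∀ x ∈ F.comp n, δ x ∈ F'.comp n)
    {g : N.carrier →ₗ[A] F'.carrier} (hg : ∀ n, ∀ x ∈ N.comp n, g x ∈ F'.comp n)
    (h : ∀ x, ∃ y, δ y = g x) :
    ∃ φ : N.free.carrier →ₗ[A] F.carrier, (∀ n, ∀ x ∈ N.free.comp n, φ x ∈ F.comp n) ∧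
      ∀ x, δ (φ x) = g (N.cover x) := by
  have h' : ∀ s : N.Homog, ∃ y ∈ F.comp s.1, δ y = g s.2 := by
    intro s
    obtain ⟨y, hy⟩ := h s.2
    refine ⟨F.proj s.1 y, F.proj_mem _ _, ?_⟩
    have h1 := F.proj_map (f := δ.toAddMonoidHom) hδ s.1 y
    rw [← F'.proj_of_mem (hg s.1 s.2 s.2.2), ← hy]
    exact h1.symm
  choose y hy hδy using h'
  let φ : N.free.carrier →ₗ[A] F.carrier :=
    (Finsupp.linearCombination A y : (N.Homog →₀ A) →ₗ[A] F.carrier)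
  have hφ : ∀ s a, φ (Finsupp.single s a : N.Homog →₀ A) = a • y s := fun s a =>
    Finsupp.linearCombination_single A a s
  refine ⟨φ, fun n x hx => ?_, fun x => ?_⟩
  · change x ∈ N.freeComp n at hx
    change φ x ∈ _
    induction hx using Submodule.span_induction with
    | mem x hx =>
      obtain ⟨s, l, b, hb, rfl, rfl⟩ := hx
      rw [hφ]
      exact F.smul_mem hb (hy s)
    | zero => rw [map_zero]; exact Submodule.zero_mem _
    | add x y _ _ hx hy => rw [map_add]; exact Submodule.add_mem _ hx hy
    | smul c x _ hx => exact (map_zsmul φ c x).symm ▸ Submodule.smul_mem _ c hx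
  · have : δ.comp φ = g.comp N.cover := by
      refine Finsupp.lhom_ext fun s a => ?_
      change δ (φ (Finsupp.single s a)) = g (N.cover (Finsupp.single s a))
      rw [hφ, map_smul, hδy]
      exact ((congrArg g (N.cover_single s a)).trans (map_smul g a _)).symm
    exact DFunLike.congr_fun this x

theorem isEquationallyFlat_free : IsEquationallyFlat A M.free.carrier :=
  IsEquationallyFlat.finsupp M.Homog

/-- The criterion for the vanishing of `Tor_3` in a given degree, compared between the canonical
resolution and a flat one. -/
theorem forall_mem_smul_ker_iff {F₀ F₁ F₂ : GrMod 𝒜} {ε : F₀.carrier →ₗ[A] M.carrier}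
    {δ₁ : F₁.carrier →ₗ[A] F₀.carrier} {δ₂ : F₂.carrier →ₗ[A] F₁.carrier}
    (hε : ∀ n, ∀ x ∈ F₀.comp n, ε x ∈ M.comp n)
    (hδ₁ : ∀ n, ∀ x ∈ F₁.comp n, δ₁ x ∈ F₀.comp n)
    (hδ₂ : ∀ n, ∀ x ∈ F₂.comp n, δ₂ x ∈ F₁.comp n)
    (hεs : Function.Surjective ε) (hδε : Function.Exact δ₁ ε) (hδδ : Function.Exact δ₂ δ₁)
    (hF₀ : IsEquationallyFlat A F₀.carrier) (hF₁ : IsEquationallyFlat A F₁.carrier)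
    (hF₂ : IsEquationallyFlat A F₂.carrier) {𝔪 : Ideal A}
    (h𝔪 : ∀ a ∈ 𝔪, ∀ i, (DirectSum.decompose 𝒜 a i : A) ∈ 𝔪)
    (hδ𝔪 : ∀ x, δ₂ x = 0 → x ∈ 𝔪 • (⊤ : Submodule A F₂.carrier)) (m : ℕ) :
    (∀ x ∈ (M.resolution 2).comp m, M.resolutionD 1 x = 0 →
      x ∈ 𝔪 • (⊤ : Submodule A (M.resolution 2).carrier) →
        x ∈ 𝔪 • LinearMap.ker (M.resolutionD 1)) ↔
    (∀ x ∈ F₂.comp m, δ₂ x = 0 → x ∈ 𝔪 • LinearMap.ker δ₂) := by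
  have hd₁ : Function.Exact (M.resolutionD 0) M.cover :=
    LinearMap.exact_iff.mpr M.range_resolutionD_zero.symm
  have hd₂ : Function.Exact (M.resolutionD 1) (M.resolutionD 0) :=
    LinearMap.exact_iff.mpr (M.range_resolutionD_succ 0).symm
  obtain ⟨φ₀, hφ₀g, hφ₀⟩ : ∃ φ₀ : (M.resolution 0).carrier →ₗ[A] F₀.carrier,
      (∀ n, ∀ x ∈ (M.resolution 0).comp n, φ₀ x ∈ F₀.comp n) ∧ ∀ x, ε (φ₀ x) = M.cover x :=
    exists_lift_of_free (N := M) (F := F₀) (F' := M) hε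
      (g := LinearMap.id) (fun n x hx => hx) (fun x => hεs x)
  obtain ⟨φ₁, hφ₁g, hφ₁⟩ : ∃ φ₁ : (M.resolution 1).carrier →ₗ[A] F₁.carrier,
      (∀ n, ∀ x ∈ (M.resolution 1).comp n, φ₁ x ∈ F₁.comp n) ∧
        ∀ x, δ₁ (φ₁ x) = φ₀ (M.resolutionD 0 x) :=
    exists_lift_of_free (N := M.syzygy) (F := F₁) (F' := F₀) hδ₁
      (g := φ₀.comp (LinearMap.ker M.cover).subtype) (fun n x hx => hφ₀g n _ hx)
      (fun x => (hδε _).mp ((hφ₀ _).trans x.2))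
  obtain ⟨φ₂, hφ₂g, hφ₂⟩ : ∃ φ₂ : (M.resolution 2).carrier →ₗ[A] F₂.carrier,
      (∀ n, ∀ x ∈ (M.resolution 2).comp n, φ₂ x ∈ F₂.comp n) ∧
        ∀ x, δ₂ (φ₂ x) = φ₁ (M.resolutionD 1 x) :=
    exists_lift_of_free (N := M.syzygy.syzygy) (F := F₂) (F' := F₁) hδ₂
      (g := φ₁.comp (LinearMap.ker M.syzygy.cover).subtype) (fun n x hx => hφ₁g n _ hx)
      (fun x => (hδδ _).mp ((hφ₁ _).trans (by
        have h0 : M.resolutionD 0 x.1 = 0 := congrArg Subtype.val x.2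
        exact (congrArg φ₀ h0).trans (map_zero φ₀))))
  obtain ⟨h1, h2⟩ := compare_resolutions M.cover_surjective hd₁ hd₂ hδε hδδ hφ₀ hφ₁ hφ₂
    M.isEquationallyFlat_free M.syzygy.isEquationallyFlat_free hF₀ hF₁ hF₂ 𝔪
  have hDg : ∀ n, ∀ x ∈ (M.resolution 2).comp n, M.resolutionD 1 x ∈ (M.resolution 1).comp n :=
    fun n x hx => M.syzygy.syzygy.cover_mem hx
  have hkD : ∀ n, ∀ x ∈ LinearMap.ker (M.resolutionD 1),
      (M.resolution 2).proj n x ∈ LinearMap.ker (M.resolutionD 1) := by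
    intro n x hx
    have h3 := (M.resolution 2).proj_map (f := (M.resolutionD 1).toAddMonoidHom) hDg n x
    have h4 : M.resolutionD 1 x = 0 := hx
    exact h3.symm.trans ((congrArg _ h4).trans (map_zero _))
  have hkδ : ∀ n, ∀ x ∈ LinearMap.ker δ₂, F₂.proj n x ∈ LinearMap.ker δ₂ := by
    intro n x hx
    have h3 := F₂.proj_map (f := δ₂.toAddMonoidHom) hδ₂ n x
    have h4 : δ₂ x = 0 := hx
    exact h3.symm.trans ((congrArg _ h4).trans (map_zero _))
  constructor
  · intro h y hy hδy
    -- The comparison gives an `x` that need not be homogeneous. Its component of degree `m` serves,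
    -- since the kernels and their `𝔪`-multiples are stable under projection.
    obtain ⟨x, hx, hDx, hyx⟩ := h2 y hδy (hδ𝔪 y hδy)
    have hx' := h _ ((M.resolution 2).proj_mem m x) (hkD m x hDx)
      ((M.resolution 2).proj_mem_smul h𝔪 (fun _ _ _ => Submodule.mem_top) m hx)
    have h3 := F₂.proj_mem_smul h𝔪 hkδ m hyx
    have h4 : F₂.proj m (φ₂ x) = φ₂ ((M.resolution 2).proj m x) :=
      (M.resolution 2).proj_map (f := φ₂.toAddMonoidHom) hφ₂g m x
    rw [map_sub, F₂.proj_of_mem hy, h4] at h3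
    have h5 := Submodule.mem_map_of_mem (f := φ₂) hx'
    rw [Submodule.map_smul''] at h5
    have h6 : 𝔪 • (LinearMap.ker (M.resolutionD 1)).map φ₂ ≤ 𝔪 • LinearMap.ker δ₂ := by
      refine Submodule.smul_mono le_rfl ?_
      rintro _ ⟨z, hz, rfl⟩
      have hz : M.resolutionD 1 z = 0 := hz
      refine (hφ₂ z).trans ?_
      exact (congrArg φ₁ hz).trans (map_zero φ₁)
    have h7 := Submodule.add_mem _ h3 (h6 h5)
    rwa [sub_add_cancel] at h7
  · intro h x hx hDx hx'
    refine h1 x hDx hx' (h _ (hφ₂g m x hx) ?_)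
    exact (hφ₂ x).trans ((congrArg φ₁ hDx).trans (map_zero φ₁))

end GrMod

theorem GrMod.resolutionD_mem {A : Type v} [Ring A] {𝒜 : ℕ → Submodule ℤ A} [GradedRing 𝒜]
    (M : GrMod.{v, w} 𝒜) (n m : ℕ) (x : (M.resolution (n + 1)).carrier)
    (hx : x ∈ (M.resolution (n + 1)).comp m) : M.resolutionD n x ∈ (M.resolution n).comp m := by
  cases n with
  | zero => exact M.syzygy.cover_mem hx
  | succ n => exact (M.iterSyzygy n).syzygy.cover_mem hx

/-! ### The functor `k ⊗_A -` and graded Tor with coefficients in `k`. -/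

namespace HomogeneousRelations

open TensorRing

variable {k : Type u} {V : Type v} [Ring k] [AddCommGroup V] [Module k V] [Module kᵐᵒᵖ V] {N : ℕ}
variable (R : HomogeneousRelations k V N)

/-- The augmentation ideal of `A`. -/
noncomputable def augIdeal : Ideal R.Alg := RingHom.ker R.augmentation

theorem mem_augIdeal {a : R.Alg} : a ∈ R.augIdeal ↔ R.augmentation a = 0 := RingHom.mem_ker

theorem augmentation_scalar (a : k) : R.augmentation (R.proj (scalar k V a)) = a :=
  lift_scalar _ _ _ _ a

theorem decompose_mem_augIdeal (a : R.Alg) (ha : a ∈ R.augIdeal) (i : ℕ) :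
    (DirectSum.decompose R.algComp a i : R.Alg) ∈ R.augIdeal := by
  classical
  rw [mem_augIdeal] at ha ⊢
  by_cases hi : i = 0
  · subst hi
    rw [← DirectSum.sum_support_decompose R.algComp a, map_sum] at ha
    by_cases h0 : 0 ∈ (DirectSum.decompose R.algComp a).support
    · rwa [Finset.sum_eq_single_of_mem 0 h0
        (fun j _ hj => R.augmentation_eq_zero hj (SetLike.coe_mem _))] at ha
    · rw [DFinsupp.notMem_support_iff.mp h0]
      exact map_zero _
  · exact R.augmentation_eq_zero hi (SetLike.coe_mem _)

/-- The identification of `k` with the trivial module. -/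
def trivialEquiv : k ≃+ R.TrivialModule := AddEquiv.refl k

theorem op_smul_eq (a : R.Alg) (x : R.TrivialModule) :
    MulOpposite.op a • x = R.trivialEquiv (R.trivialEquiv.symm x * R.augmentation a) := rfl

variable {Y : Type w} [AddCommGroup Y] [Module R.Alg Y]

/-- The map `y ↦ 1 ⊗ y` from `Y` to `k ⊗_A Y`. -/
noncomputable def oneTmul (Y : Type w) [AddCommGroup Y] [Module R.Alg Y] :
    Y →+ BalancedTensor R.Alg R.TrivialModule Y :=
  (QuotientAddGroup.mk' _).comp
    (TensorProduct.mk ℤ R.TrivialModule Y (R.trivialEquiv 1)).toAddMonoidHom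

theorem oneTmul_apply (y : Y) :
    R.oneTmul Y y = BalancedTensor.tmul R.Alg (R.trivialEquiv 1) y := rfl

theorem op_smul_tmul (x : R.TrivialModule) (a : R.Alg) (y : Y) :
    BalancedTensor.tmul R.Alg (MulOpposite.op a • x) y =
      BalancedTensor.tmul R.Alg x (a • y) := by
  refine (QuotientAddGroup.eq_iff_sub_mem).mpr ?_
  exact AddSubgroup.subset_closure ⟨x, a, y, rfl⟩

theorem tmul_eq_oneTmul (c : R.TrivialModule) (y : Y) :
    BalancedTensor.tmul R.Alg c y =
      R.oneTmul Y (R.proj (scalar k V (R.trivialEquiv.symm c)) • y) := by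
  rw [oneTmul_apply, ← op_smul_tmul, op_smul_eq, augmentation_scalar, AddEquiv.symm_apply_apply,
    one_mul, AddEquiv.apply_symm_apply]

/-- The map `k ⊗_A Y → Y / A₊ Y`. -/
noncomputable def toQuotient (Y : Type w) [AddCommGroup Y] [Module R.Alg Y] :
    BalancedTensor R.Alg R.TrivialModule Y →+ Y ⧸ R.augIdeal • (⊤ : Submodule R.Alg Y) :=
  QuotientAddGroup.lift _ (TensorProduct.lift (LinearMap.mk₂ ℤ
    (fun (c : R.TrivialModule) (y : Y) =>
      (R.augIdeal • (⊤ : Submodule R.Alg Y)).mkQ (R.proj (scalar k V (R.trivialEquiv.symm c)) • y))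
    (fun c c' y => by simp only [map_add, add_smul])
    (fun n c y => by simp only [map_zsmul, smul_assoc])
    (fun c y y' => by rw [smul_add, map_add])
    (fun n c y => by rw [← map_zsmul, smul_comm]))).toAddMonoidHom (by
      rw [AddSubgroup.closure_le]
      rintro _ ⟨c, a, y, rfl⟩
      change _ = (0 : Y ⧸ R.augIdeal • (⊤ : Submodule R.Alg Y))
      rw [map_sub, sub_eq_zero]
      change (R.augIdeal • (⊤ : Submodule R.Alg Y)).mkQ
          (R.proj (scalar k V (R.trivialEquiv.symm c * R.augmentation a)) • y) =
        (R.augIdeal • (⊤ : Submodule R.Alg Y)).mkQ (R.proj (scalar k V (R.trivialEquiv.symm c)) • a • y)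
      rw [← sub_eq_zero, ← map_sub, ← mul_smul, ← sub_smul, Submodule.mkQ_apply,
        Submodule.Quotient.mk_eq_zero]
      refine Submodule.smul_mem_smul ?_ Submodule.mem_top
      simp only [mem_augIdeal, map_sub, map_mul, augmentation_scalar, sub_self])

/-- This is `k ⊗_A Y = Y / A₊Y`: the map `toQuotient` detects nonzero classes, and conversely `1 ⊗
ay = ε(a) ⊗ y = 0` for `a` in `A₊`. -/
theorem oneTmul_eq_zero_iff (y : Y) :
    R.oneTmul Y y = 0 ↔ y ∈ R.augIdeal • (⊤ : Submodule R.Alg Y) := by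
  constructor
  · intro h
    have h1 : R.toQuotient Y (R.oneTmul Y y) =
        (R.augIdeal • (⊤ : Submodule R.Alg Y)).mkQ (R.proj (scalar k V 1) • y) := rfl
    rw [h, map_zero, map_one, map_one, one_smul] at h1
    exact (Submodule.Quotient.mk_eq_zero _).mp h1.symm
  · intro h
    refine Submodule.smul_induction_on h ?_ ?_
    · intro a ha y _
      rw [oneTmul_apply, ← op_smul_tmul]
      rw [op_smul_eq, R.mem_augIdeal.mp ha, mul_zero, map_zero]
      change QuotientAddGroup.mk ((0 : R.TrivialModule) ⊗ₜ[ℤ] y) = _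
      rw [TensorProduct.zero_tmul]
      rfl
    · intro y y' h h'
      rw [map_add, h, h', add_zero]

/-- As `k` sits in degree `0`, scalars of `k` can be moved across the tensor sign into `A_0`, so
pure tensors `1 ⊗ y` suffice. -/
theorem mem_tensorComp_iff (M : GrMod.{max u v, w} R.algComp) (m : ℕ)
    (t : BalancedTensor R.Alg R.TrivialModule M.carrier) :
    t ∈ M.tensorComp R.trivialComp m ↔ ∃ y ∈ M.comp m, R.oneTmul M.carrier y = t := by
  constructor
  · intro ht
    induction ht using Submodule.span_induction with
    | mem t ht =>
      obtain ⟨i, j, c, y, hc, hy, rfl, rfl⟩ := ht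
      by_cases hi : i = 0
      · subst hi
        exact ⟨R.proj (scalar k V (R.trivialEquiv.symm c)) • y,
          M.smul_mem ⟨_, ⟨R.trivialEquiv.symm c, rfl⟩, rfl⟩ hy,
          (R.tmul_eq_oneTmul c y).symm⟩
      · have : c = 0 := by simpa [trivialComp, hi] using hc
        subst this
        refine ⟨0, Submodule.zero_mem _, ?_⟩
        change _ = QuotientAddGroup.mk ((0 : R.TrivialModule) ⊗ₜ[ℤ] y)
        rw [TensorProduct.zero_tmul, map_zero]
        rfl
    | zero => exact ⟨0, Submodule.zero_mem _, map_zero _⟩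
    | add t t' _ _ h h' =>
      obtain ⟨y, hy, rfl⟩ := h
      obtain ⟨y', hy', rfl⟩ := h'
      exact ⟨y + y', Submodule.add_mem _ hy hy', map_add _ _ _⟩
    | smul c t _ h =>
      obtain ⟨y, hy, rfl⟩ := h
      exact ⟨c • y, Submodule.smul_mem _ _ hy, map_zsmul _ _ _⟩
  · rintro ⟨y, hy, rfl⟩
    refine Submodule.subset_span ⟨0, m, R.trivialEquiv 1, y, ?_, hy, zero_add m, rfl⟩
    simp [trivialComp]

theorem map_oneTmul {Y Z : Type w} [AddCommGroup Y] [Module R.Alg Y] [AddCommGroup Z]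
    [Module R.Alg Z] (f : Y →ₗ[R.Alg] Z) (y : Y) :
    BalancedTensor.map R.Alg R.TrivialModule f (R.oneTmul Y y) = R.oneTmul Z (f y) := rfl

/-- Dimension shift: with `K = ker d_n = im d_{n+1}`, the group `Tor_{n+2}` is the kernel of `K/A₊K
→ P_{n+1}/A₊P_{n+1}`. Its vanishing in degree `m` says that `K ∩ A₊P_{n+1}` is contained in `A₊K` in
that degree. -/
theorem subsingleton_grTor_iff (M : GrMod.{max u v, w} R.algComp) (n m : ℕ) :
    Subsingleton (GrTor R.trivialComp M (n + 2) m) ↔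
      ∀ x ∈ (M.resolution (n + 1)).comp m, M.resolutionD n x = 0 →
        x ∈ R.augIdeal • (⊤ : Submodule R.Alg (M.resolution (n + 1)).carrier) →
          x ∈ R.augIdeal • LinearMap.ker (M.resolutionD n) := by
  have hD : ∀ l j x, (M.resolution l).proj j (M.resolutionD l x) =
      M.resolutionD l ((M.resolution (l + 1)).proj j x) := fun l j x =>
    GrMod.proj_map _ (f := (M.resolutionD l).toAddMonoidHom) (M.resolutionD_mem l) j x
  have hexact : ∀ l x, M.resolutionD l x = 0 → ∃ y, M.resolutionD (l + 1) y = x := fun l x hx =>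
    (LinearMap.exact_iff.mpr (M.range_resolutionD_succ l).symm x).mp hx
  have hzero : ∀ l x, M.resolutionD l (M.resolutionD (l + 1) x) = 0 := fun l x =>
    (LinearMap.exact_iff.mpr (M.range_resolutionD_succ l).symm).apply_apply_eq_zero x
  rw [Submodule.Quotient.subsingleton_iff, Submodule.submoduleOf_eq_top]
  constructor
  · intro h x hx hDx hx'
    obtain ⟨y, rfl⟩ := hexact n x hDx
    have hy : M.resolutionD (n + 1) ((M.resolution (n + 2)).proj m y) = M.resolutionD (n + 1) y := by
      rw [← hD, GrMod.proj_of_mem _ hx]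
    generalize hw : (M.resolution (n + 2)).proj m y = w at hy
    have hwm : w ∈ (M.resolution (n + 2)).comp m := hw ▸ GrMod.proj_mem _ _ _
    rw [← hy] at hx' ⊢
    obtain ⟨t, ht, htw⟩ := h (x := R.oneTmul _ w)
      ⟨(R.mem_tensorComp_iff _ _ _).mpr ⟨w, hwm, rfl⟩, by
        rw [SetLike.mem_coe, LinearMap.mem_ker, map_oneTmul, oneTmul_eq_zero_iff]
        exact hx'⟩
    obtain ⟨z, -, rfl⟩ := (R.mem_tensorComp_iff _ _ _).mp ht
    rw [map_oneTmul, eq_comm, ← sub_eq_zero, ← map_sub, oneTmul_eq_zero_iff] at htw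
    have h1 := Submodule.mem_map_of_mem (f := M.resolutionD (n + 1)) htw
    rw [Submodule.map_smul'', map_sub, hzero, sub_zero, Submodule.map_top,
      M.range_resolutionD_succ] at h1
    exact h1
  · rintro h t ⟨ht, ht'⟩
    obtain ⟨y, hy, rfl⟩ := (R.mem_tensorComp_iff _ _ _).mp ht
    rw [SetLike.mem_coe, LinearMap.mem_ker, map_oneTmul, oneTmul_eq_zero_iff] at ht'
    have h1 := h _ (M.resolutionD_mem _ _ _ hy) (hzero n y) ht'
    rw [← M.range_resolutionD_succ, ← Submodule.map_top, ← Submodule.map_smul''] at h1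
    obtain ⟨y', hy', hyy'⟩ := h1
    obtain ⟨z, hz⟩ := hexact (n + 1) (y - y') (by rw [map_sub, hyy', sub_self])
    have hz' : M.resolutionD (n + 2) ((M.resolution (n + 3)).proj m z) =
        y - (M.resolution (n + 2)).proj m y' := by
      rw [← hD, hz, map_sub, GrMod.proj_of_mem _ hy]
    refine ⟨R.oneTmul _ ((M.resolution (n + 3)).proj m z), (R.mem_tensorComp_iff _ _ _).mpr
      ⟨_, GrMod.proj_mem _ _ _, rfl⟩, ?_⟩
    have h2 : R.oneTmul _ ((M.resolution (n + 2)).proj m y') = 0 :=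
      (R.oneTmul_eq_zero_iff _).mpr (GrMod.proj_mem_smul _ R.decompose_mem_augIdeal
        (fun _ _ _ => Submodule.mem_top) m hy')
    rw [map_oneTmul, hz', map_sub, h2, sub_zero]

end HomogeneousRelations

/-! ### The grading of `T(V)` and its graded subgroups. -/

namespace TensorRing

variable {k : Type u} {V : Type v} [Ring k] [AddCommGroup V] [Module k V] [Module kᵐᵒᵖ V]

theorem one_mem_tensorPow_zero : (1 : TensorRing k V) ∈ tensorPow k V 0 :=
  ⟨1, map_one (scalar k V)⟩

theorem scalar_mem_tensorPow_zero (a : k) : scalar k V a ∈ tensorPow k V 0 := ⟨a, rfl⟩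

theorem tensorPow_mul_tensorPow (i j : ℕ) :
    tensorPow k V i * tensorPow k V j = tensorPow k V (i + j) := by
  induction j with
  | zero =>
    refine le_antisymm ?_ fun x hx => ?_
    · exact Submodule.mul_le.mpr fun x hx y hy =>
        HomogeneousRelations.mul_mem_tensorPow i 0 x y hx hy
    · rw [← mul_one x]
      exact Submodule.mul_mem_mul hx one_mem_tensorPow_zero
  | succ j ih =>
    change tensorPow k V i * (tensorPow k V j * _) = tensorPow k V (i + j) * _
    rw [← mul_assoc, ih]

variable (k V) in
/-- The ring homomorphism `T(V) → T(V)[X]` which is `x ↦ x Xⁿ` on `V^{⊗ n}`. -/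
noncomputable def gradingHom : TensorRing k V →+* Polynomial (TensorRing k V) :=
  lift (Polynomial.C.comp (scalar k V))
    ((Polynomial.monomial 1).toAddMonoidHom.comp (vector k V))
    (fun a x => by simp [vector_smul]) (fun a x => by simp [vector_op_smul])

theorem gradingHom_of_mem {n : ℕ} {x : TensorRing k V} (hx : x ∈ tensorPow k V n) :
    gradingHom k V x = Polynomial.monomial n x := by
  refine HomogeneousRelations.tensorPow_induction
    (P := fun n x => gradingHom k V x = Polynomial.monomial n x) ?_ ?_ ?_ n x hx
  · intro a; exact lift_scalar _ _ _ _ a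
  · intro n x y hx hy; rw [map_add, hx, hy, map_add]
  · intro n x v _ hx
    have hv : gradingHom k V (vector k V v) = Polynomial.monomial 1 (vector k V v) :=
      lift_vector _ _ _ _ v
    rw [map_mul, hx, hv, Polynomial.monomial_mul_monomial]

/-- The projection of `T(V)` onto its component of degree `n`. -/
noncomputable def tensorProj (n : ℕ) : TensorRing k V →ₗ[ℤ] TensorRing k V :=
  ((Polynomial.lcoeff (TensorRing k V) n).toAddMonoidHom.comp
    (gradingHom k V).toAddMonoidHom).toIntLinearMap

theorem tensorProj_apply (n : ℕ) (x : TensorRing k V) :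
    tensorProj n x = (gradingHom k V x).coeff n := rfl

theorem tensorProj_of_mem {n : ℕ} {x : TensorRing k V} (hx : x ∈ tensorPow k V n) :
    tensorProj n x = x := by
  rw [tensorProj_apply, gradingHom_of_mem hx, Polynomial.coeff_monomial_same]

theorem tensorProj_of_mem_of_ne {n m : ℕ} (h : m ≠ n) {x : TensorRing k V}
    (hx : x ∈ tensorPow k V m) : tensorProj n x = 0 := by
  rw [tensorProj_apply, gradingHom_of_mem hx, Polynomial.coeff_monomial_of_ne _ h.symm]

theorem eq_sum_tensorProj (x : TensorRing k V) :
    x = ∑ n ∈ (gradingHom k V x).support, tensorProj n x := by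
  have h : ∀ x : TensorRing k V, (gradingHom k V x).eval 1 = x := by
    intro x
    induction HomogeneousRelations.exists_tensorPow_decomp x using Submodule.iSup_induction' with
    | mem n x hx => rw [gradingHom_of_mem hx]; simp
    | zero => simp
    | add x y _ _ hx hy => rw [map_add, Polynomial.eval_add, hx, hy]
  conv_lhs => rw [← h x, Polynomial.eval_eq_sum, Polynomial.sum]
  simp [tensorProj_apply]

/-- The subgroup `E` of `T(V)` is graded, with components `e n`. -/
structure IsGradedBy (e : ℕ → Submodule ℤ (TensorRing k V))
    (E : Submodule ℤ (TensorRing k V)) : Prop where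
  le_tensorPow : ∀ n, e n ≤ tensorPow k V n
  eq_iSup : E = ⨆ n, e n

variable (k V) in
theorem isGradedBy_top : IsGradedBy (tensorPow k V) ⊤ :=
  ⟨fun _ => le_rfl, (eq_top_iff.mpr fun x _ =>
    HomogeneousRelations.exists_tensorPow_decomp x).symm⟩

namespace IsGradedBy

variable {e f : ℕ → Submodule ℤ (TensorRing k V)} {E F : Submodule ℤ (TensorRing k V)}

theorem le (h : IsGradedBy e E) (n : ℕ) : e n ≤ E := h.eq_iSup ▸ le_iSup e n

theorem tensorProj_mem_comp (h : IsGradedBy e E) (n : ℕ) {x : TensorRing k V} (hx : x ∈ E) :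
    tensorProj n x ∈ e n := by
  rw [h.eq_iSup] at hx
  induction hx using Submodule.iSup_induction' with
  | mem m x hx =>
    by_cases hm : m = n
    · subst hm; rwa [tensorProj_of_mem (h.le_tensorPow _ hx)]
    · rw [tensorProj_of_mem_of_ne hm (h.le_tensorPow _ hx)]; exact Submodule.zero_mem _
  | zero => rw [map_zero]; exact Submodule.zero_mem _
  | add x y _ _ hx hy => rw [map_add]; exact Submodule.add_mem _ hx hy

theorem tensorProj_mem (h : IsGradedBy e E) (n : ℕ) {x : TensorRing k V} (hx : x ∈ E) :
    tensorProj n x ∈ E := h.le n (h.tensorProj_mem_comp n hx)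

theorem mem_comp_iff (h : IsGradedBy e E) {n : ℕ} {x : TensorRing k V} :
    x ∈ e n ↔ x ∈ E ∧ x ∈ tensorPow k V n := by
  refine ⟨fun hx => ⟨h.le n hx, h.le_tensorPow n hx⟩, fun hx => ?_⟩
  rw [← tensorProj_of_mem hx.2]
  exact h.tensorProj_mem_comp n hx.1

theorem mul_right (h : IsGradedBy e E) {q : ℕ} {S : Submodule ℤ (TensorRing k V)}
    (hS : S ≤ tensorPow k V q) :
    IsGradedBy (fun n => if q ≤ n then e (n - q) * S else ⊥) (E * S) := by
  refine ⟨fun n => ?_, ?_⟩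
  · split_ifs with hn
    · refine (mul_le_mul' (h.le_tensorPow _) hS).trans ?_
      rw [tensorPow_mul_tensorPow, Nat.sub_add_cancel hn]
    · exact bot_le
  · rw [h.eq_iSup, Submodule.iSup_mul]
    refine le_antisymm (iSup_le fun n => le_iSup_of_le (n + q) (by simp)) (iSup_le fun n => ?_)
    split_ifs
    exacts [le_iSup (fun i => e i * S) (n - q), bot_le]

theorem mul_left (h : IsGradedBy e E) {q : ℕ} {S : Submodule ℤ (TensorRing k V)}
    (hS : S ≤ tensorPow k V q) :
    IsGradedBy (fun n => if q ≤ n then S * e (n - q) else ⊥) (S * E) := by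
  refine ⟨fun n => ?_, ?_⟩
  · split_ifs with hn
    · refine (mul_le_mul' hS (h.le_tensorPow _)).trans ?_
      rw [tensorPow_mul_tensorPow, Nat.add_sub_cancel' hn]
    · exact bot_le
  · rw [h.eq_iSup, Submodule.mul_iSup]
    refine le_antisymm (iSup_le fun n => le_iSup_of_le (n + q) (by simp)) (iSup_le fun n => ?_)
    split_ifs
    exacts [le_iSup (fun i => S * e i) (n - q), bot_le]

theorem inf (h : IsGradedBy e E) (h' : IsGradedBy f F) :
    IsGradedBy (fun n => e n ⊓ f n) (E ⊓ F) := by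
  refine ⟨fun n => inf_le_left.trans (h.le_tensorPow n), le_antisymm ?_ (iSup_le fun n =>
    inf_le_inf (h.le n) (h'.le n))⟩
  rintro x ⟨hx, hx'⟩
  rw [eq_sum_tensorProj x]
  exact Submodule.sum_mem _ fun n _ => Submodule.mem_iSup_of_mem n
    ⟨h.tensorProj_mem_comp n hx, h'.tensorProj_mem_comp n hx'⟩

end IsGradedBy

end TensorRing

/-! ### The ideal `I(R)` and its components. -/

namespace HomogeneousRelations

open TensorRing

variable {k : Type u} {V : Type v} [Ring k] [AddCommGroup V] [Module k V] [Module kᵐᵒᵖ V] {N : ℕ}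
variable (R : HomogeneousRelations k V N)

/-- The ideal `I(R)` as an additive subgroup. -/
noncomputable def relIdeal : Submodule ℤ (TensorRing k V) := ⊤ * R.carrier * ⊤

theorem carrier_mul_tensorPow_zero : R.carrier * tensorPow k V 0 = R.carrier := by
  refine le_antisymm (Submodule.mul_le.mpr ?_) fun x hx => ?_
  · rintro x hx _ ⟨a, rfl⟩; exact R.mul_scalar_mem a hx
  · rw [← mul_one x]; exact Submodule.mul_mem_mul hx one_mem_tensorPow_zero

theorem tensorPow_zero_mul_carrier : tensorPow k V 0 * R.carrier = R.carrier := by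
  refine le_antisymm (Submodule.mul_le.mpr ?_) fun x hx => ?_
  · rintro _ ⟨a, rfl⟩ x hx; exact R.scalar_mul_mem a hx
  · rw [← one_mul x]; exact Submodule.mul_mem_mul one_mem_tensorPow_zero hx

theorem mul_mem_relIdeal_left (t : TensorRing k V) {x : TensorRing k V} (hx : x ∈ R.relIdeal) :
    t * x ∈ R.relIdeal := by
  have h : (⊤ : Submodule ℤ (TensorRing k V)) * R.relIdeal ≤ R.relIdeal := by
    rw [relIdeal, ← mul_assoc, ← mul_assoc]
    exact mul_le_mul' (mul_le_mul' le_top le_rfl) le_rfl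
  exact h (Submodule.mul_mem_mul Submodule.mem_top hx)

theorem mul_mem_relIdeal_right (t : TensorRing k V) {x : TensorRing k V} (hx : x ∈ R.relIdeal) :
    x * t ∈ R.relIdeal := by
  have h : R.relIdeal * (⊤ : Submodule ℤ (TensorRing k V)) ≤ R.relIdeal := by
    rw [relIdeal, mul_assoc]
    exact mul_le_mul' le_rfl le_top
  exact h (Submodule.mul_mem_mul hx Submodule.mem_top)

theorem mem_ideal_iff {x : TensorRing k V} : x ∈ R.ideal ↔ x ∈ R.relIdeal := by
  constructor
  · intro hx
    let I : TwoSidedIdeal (TensorRing k V) := TwoSidedIdeal.mk' (R.relIdeal : Set (TensorRing k V))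
      (Submodule.zero_mem _) (fun h h' => Submodule.add_mem _ h h') (fun h => neg_mem h)
      (fun {t _} h => R.mul_mem_relIdeal_left t h) (fun {_ t} h => R.mul_mem_relIdeal_right t h)
    have hI : ∀ y, y ∈ I ↔ y ∈ R.relIdeal := fun y =>
      TwoSidedIdeal.mem_mk' _ _ _ _ _ _ _
    have h : TwoSidedIdeal.span (R.carrier : Set (TensorRing k V)) ≤ I := by
      refine TwoSidedIdeal.span_le.mpr fun y hy => (hI y).mpr ?_
      have := Submodule.mul_mem_mul (Submodule.mul_mem_mul
        (Submodule.mem_top : (1 : TensorRing k V) ∈ (⊤ : Submodule ℤ _)) hy)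
        (Submodule.mem_top : (1 : TensorRing k V) ∈ (⊤ : Submodule ℤ _))
      rwa [one_mul, mul_one] at this
    exact (hI x).mp (h hx)
  · intro hx
    have h1 : ∀ y ∈ R.carrier, y ∈ TwoSidedIdeal.span (R.carrier : Set (TensorRing k V)) :=
      fun y hy => TwoSidedIdeal.subset_span hy
    change x ∈ TwoSidedIdeal.span (R.carrier : Set (TensorRing k V))
    refine Submodule.mul_induction_on hx ?_ (fun x y hx hy => TwoSidedIdeal.add_mem _ hx hy)
    intro y hy t _
    refine TwoSidedIdeal.mul_mem_right _ _ _ ?_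
    refine Submodule.mul_induction_on hy ?_ (fun x y hx hy => TwoSidedIdeal.add_mem _ hx hy)
    intro s _ r hr
    exact TwoSidedIdeal.mul_mem_left _ _ _ (h1 r hr)

theorem proj_eq_zero_iff {x : TensorRing k V} : R.proj x = 0 ↔ x ∈ R.relIdeal :=
  Ideal.Quotient.eq_zero_iff_mem.trans R.mem_ideal_iff

theorem proj_surjective : Function.Surjective R.proj := Ideal.Quotient.mk_surjective

theorem isGradedBy_relIdeal : IsGradedBy R.idealComp R.relIdeal := by
  refine ⟨fun n => ?_, ?_⟩
  · refine iSup_le fun i => iSup_le fun j => iSup_le fun h => ?_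
    refine (mul_le_mul' (mul_le_mul' le_rfl R.le_tensorPow) le_rfl).trans ?_
    rw [tensorPow_mul_tensorPow, tensorPow_mul_tensorPow, h]
  · have h := (isGradedBy_top k V).eq_iSup
    rw [relIdeal]
    conv_lhs => rw [h]
    rw [Submodule.iSup_mul, Submodule.iSup_mul]
    simp only [Submodule.mul_iSup]
    refine le_antisymm (iSup_le fun i => iSup_le fun j => ?_) (iSup_le fun n => ?_)
    · exact le_iSup_of_le (i + N + j) (le_iSup_of_le i (le_iSup_of_le j (le_iSup_of_le rfl le_rfl)))
    · exact iSup_le fun i => iSup_le fun j => iSup_le fun _ => le_iSup_of_le i (le_iSup_of_le j le_rfl)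

/-- The kernel of the augmentation is both `V T(V)` and `T(V) V`. The left form generates `A₊` by
`V`, the right form gives exactness at `A`. -/
theorem sub_scalar_mem (t : TensorRing k V) :
    t - scalar k V (R.augmentation (R.proj t)) ∈
      tensorPow k V 1 * (⊤ : Submodule ℤ (TensorRing k V)) ⊓
        (⊤ : Submodule ℤ (TensorRing k V)) * tensorPow k V 1 := by
  have hv : ∀ x, vector k V x ∈ tensorPow k V 1 := fun x => by
    rw [← one_mul (vector k V x)]
    exact Submodule.mul_mem_mul one_mem_tensorPow_zero ⟨x, rfl⟩
  have hl : ∀ x y, x ∈ tensorPow k V 1 * (⊤ : Submodule ℤ (TensorRing k V)) →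
      x * y ∈ tensorPow k V 1 * (⊤ : Submodule ℤ (TensorRing k V)) := fun x y hx => by
    have h : tensorPow k V 1 * (⊤ : Submodule ℤ (TensorRing k V)) * ⊤ ≤ tensorPow k V 1 * ⊤ := by
      rw [mul_assoc]; exact mul_le_mul' le_rfl le_top
    exact h (Submodule.mul_mem_mul hx Submodule.mem_top)
  have hr : ∀ x y, y ∈ (⊤ : Submodule ℤ (TensorRing k V)) * tensorPow k V 1 →
      x * y ∈ (⊤ : Submodule ℤ (TensorRing k V)) * tensorPow k V 1 := fun x y hy => by
    have h : (⊤ : Submodule ℤ (TensorRing k V)) * (⊤ * tensorPow k V 1) ≤ ⊤ * tensorPow k V 1 := by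
      rw [← mul_assoc]; exact mul_le_mul' le_top le_rfl
    exact h (Submodule.mul_mem_mul Submodule.mem_top hy)
  have hls : ∀ a x, x ∈ tensorPow k V 1 * (⊤ : Submodule ℤ (TensorRing k V)) →
      scalar k V a * x ∈ tensorPow k V 1 * (⊤ : Submodule ℤ (TensorRing k V)) := fun a x hx => by
    have h := Submodule.mul_mem_mul (scalar_mem_tensorPow_zero (V := V) a) hx
    rwa [← mul_assoc, tensorPow_mul_tensorPow] at h
  have hrs : ∀ a x, x ∈ (⊤ : Submodule ℤ (TensorRing k V)) * tensorPow k V 1 →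
      x * scalar k V a ∈ (⊤ : Submodule ℤ (TensorRing k V)) * tensorPow k V 1 := fun a x hx => by
    have h := Submodule.mul_mem_mul hx (scalar_mem_tensorPow_zero (V := V) a)
    rwa [mul_assoc, tensorPow_mul_tensorPow] at h
  induction t using TensorRing.induction with
  | hs a => rw [augmentation_scalar, sub_self]; exact Submodule.zero_mem _
  | hv x =>
    have : R.augmentation (R.proj (vector k V x)) = 0 := lift_vector _ _ _ _ x
    rw [this, map_zero, sub_zero]
    refine ⟨?_, ?_⟩
    · rw [← mul_one (vector k V x)]
      exact Submodule.mul_mem_mul (hv x) Submodule.mem_top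
    · rw [← one_mul (vector k V x)]
      exact Submodule.mul_mem_mul Submodule.mem_top (hv x)
  | hadd x y hx hy =>
    rw [map_add, map_add, map_add, add_sub_add_comm]
    exact Submodule.add_mem _ hx hy
  | hmul x y hx hy =>
    rw [map_mul, map_mul, map_mul]
    refine ⟨?_, ?_⟩
    · have : x * y - scalar k V (R.augmentation (R.proj x)) * scalar k V (R.augmentation (R.proj y)) =
          (x - scalar k V (R.augmentation (R.proj x))) * y +
          scalar k V (R.augmentation (R.proj x)) *
            (y - scalar k V (R.augmentation (R.proj y))) := by noncomm_ring
      rw [this]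
      exact Submodule.add_mem _ (hl _ _ hx.1) (hls _ _ hy.1)
    · have : x * y - scalar k V (R.augmentation (R.proj x)) * scalar k V (R.augmentation (R.proj y)) =
          x * (y - scalar k V (R.augmentation (R.proj y))) +
          (x - scalar k V (R.augmentation (R.proj x))) *
            scalar k V (R.augmentation (R.proj y)) := by noncomm_ring
      rw [this]
      exact Submodule.add_mem _ (hr _ _ hy.2) (hrs _ _ hx.2)

/-- Since `T(V) = k + T(V)V`, the right factor in `T(V) R T(V)` is either a scalar, absorbed by `R`,
or ends in `V`. This yields the exactness at `A ⊗ V`. -/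
theorem relIdeal_le : R.relIdeal ≤ ⊤ * R.carrier ⊔ R.relIdeal * tensorPow k V 1 := by
  have h : (⊤ : Submodule ℤ (TensorRing k V)) ≤ tensorPow k V 0 ⊔ ⊤ * tensorPow k V 1 := by
    intro t _
    rw [← sub_add_cancel t (scalar k V (R.augmentation (R.proj t)))]
    exact Submodule.add_mem _ (Submodule.mem_sup_right (R.sub_scalar_mem t).2)
      (Submodule.mem_sup_left (scalar_mem_tensorPow_zero _))
  have h' : R.relIdeal ≤ ⊤ * R.carrier * (tensorPow k V 0 ⊔ ⊤ * tensorPow k V 1) :=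
    mul_le_mul' le_rfl h
  rwa [Submodule.mul_sup, ← mul_assoc, mul_assoc ⊤ R.carrier (tensorPow k V 0),
    carrier_mul_tensorPow_zero] at h'

end HomogeneousRelations

theorem IsEquationallyFlat.self (A : Type u) [Ring A] : IsEquationallyFlat A A := by
  intro ι _ a q h
  exact ⟨Unit, inferInstance, fun i _ => q i, fun _ => 1, fun i => by simp, fun _ => h⟩

/-! ### The graded modules `A ⊗_k S` as subquotients of `T(V)`, and their flatness. -/

namespace HomogeneousRelations

open TensorRing

variable {k : Type u} {V : Type v} [Ring k] [AddCommGroup V] [Module k V] [Module kᵐᵒᵖ V] {N : ℕ}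

/-- Graded left ideals `top` and `bot` of `T(V)` for which `top / (top ∩ bot)` is an
`A`-module. -/
structure GradedPair (R : HomogeneousRelations k V N) where
  /-- the numerator -/
  top : Ideal (TensorRing k V)
  /-- the denominator -/
  bot : Ideal (TensorRing k V)
  tensorProj_mem_top : ∀ n, ∀ x ∈ top, tensorProj n x ∈ top
  tensorProj_mem_bot : ∀ n, ∀ x ∈ bot, tensorProj n x ∈ bot
  mul_mem_bot : ∀ x ∈ R.ideal, ∀ y ∈ top, x * y ∈ bot

namespace GradedPair

variable {R : HomogeneousRelations k V N} (P : R.GradedPair)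

/-- The module `top / (top ∩ bot)`. -/
def Quot : Type (max u v) := P.top ⧸ P.bot.submoduleOf P.top

noncomputable instance : AddCommGroup P.Quot :=
  inferInstanceAs (AddCommGroup (P.top ⧸ P.bot.submoduleOf P.top))

noncomputable instance : Module (TensorRing k V) P.Quot :=
  inferInstanceAs (Module (TensorRing k V) (P.top ⧸ P.bot.submoduleOf P.top))

/-- The projection onto the quotient. -/
noncomputable def cls : P.top →ₗ[TensorRing k V] P.Quot := (P.bot.submoduleOf P.top).mkQ

theorem cls_surjective : Function.Surjective P.cls := Submodule.mkQ_surjective _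

theorem cls_eq_zero_iff (x : P.top) : P.cls x = 0 ↔ (x : TensorRing k V) ∈ P.bot :=
  Submodule.Quotient.mk_eq_zero _

theorem isTorsionBySet : Module.IsTorsionBySet (TensorRing k V) P.Quot R.ideal := by
  rintro x ⟨a, ha⟩
  obtain ⟨x, rfl⟩ := P.cls_surjective x
  change a • P.cls x = 0
  rw [← map_smul, cls_eq_zero_iff]
  exact P.mul_mem_bot a ha x x.2

noncomputable instance : Module R.Alg P.Quot :=
  (P.isTorsionBySet.module : Module (TensorRing k V ⧸ R.ideal) P.Quot)

theorem proj_smul (t : TensorRing k V) (x : P.Quot) : R.proj t • x = t • x := rfl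

theorem proj_smul_cls (t : TensorRing k V) (x : P.top) : R.proj t • P.cls x = P.cls (t • x) :=
  (P.proj_smul t _).trans (map_smul P.cls t x).symm

/-- Construction of linear maps on the quotient. -/
noncomputable def lift {Y : Type w} [AddCommGroup Y] [Module R.Alg Y] (f : P.top →+ Y)
    (hf : ∀ t x, f (t • x) = R.proj t • f x)
    (h : ∀ x : P.top, (x : TensorRing k V) ∈ P.bot → f x = 0) :
    P.Quot →ₗ[R.Alg] Y where
  toFun := QuotientAddGroup.lift (P.bot.submoduleOf P.top).toAddSubgroup f h
  map_add' := map_add (QuotientAddGroup.lift (P.bot.submoduleOf P.top).toAddSubgroup f h)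
  map_smul' := by
    intro a x
    obtain ⟨t, rfl⟩ := R.proj_surjective a
    obtain ⟨x, rfl⟩ := P.cls_surjective x
    rw [proj_smul_cls]
    exact hf t x

/-- The components of the quotient. -/
noncomputable def comp (n : ℕ) : Submodule ℤ P.Quot :=
  ((tensorPow k V n).comap P.top.subtype.toAddMonoidHom.toIntLinearMap).map
    P.cls.toAddMonoidHom.toIntLinearMap

/-- The graded module `top / (top ∩ bot)`. -/
noncomputable def toGrMod : GrMod.{max u v, max u v} R.algComp where
  carrier := P.Quot
  comp := P.comp
  smul_mem := by
    rintro i j _ _ ⟨t, ht, rfl⟩ ⟨x, hx, rfl⟩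
    exact ⟨t • x, mul_mem_tensorPow i j t x ht hx, (P.proj_smul_cls t x).symm⟩
  isInternal := by
    let p : ℕ → P.top →+ P.top := fun n => AddMonoidHom.mk'
      (fun x => ⟨tensorProj n x, P.tensorProj_mem_top n x x.2⟩)
      (fun x y => Subtype.ext (map_add (tensorProj n) _ _))
    refine isInternal_of_proj _ (fun n => (QuotientAddGroup.map
      (P.bot.submoduleOf P.top).toAddSubgroup (P.bot.submoduleOf P.top).toAddSubgroup (p n)
      (fun x hx => P.tensorProj_mem_bot n x hx)).toIntLinearMap) ?_ ?_ ?_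
    · rintro n _ ⟨x, hx, rfl⟩
      exact congrArg P.cls (Subtype.ext (tensorProj_of_mem hx))
    · rintro n m hm _ ⟨x, hx, rfl⟩
      have : p n x = 0 := Subtype.ext (tensorProj_of_mem_of_ne hm hx)
      exact (congrArg P.cls this).trans (map_zero P.cls)
    · rw [eq_top_iff]
      intro y _
      obtain ⟨x, rfl⟩ := P.cls_surjective y
      have hx : x = ∑ n ∈ (gradingHom k V (x : TensorRing k V)).support, p n x := by
        refine Subtype.ext ?_
        rw [AddSubmonoidClass.coe_finsetSum]
        exact eq_sum_tensorProj _
      rw [hx, map_sum]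
      refine Submodule.sum_mem _ fun n _ => Submodule.mem_iSup_of_mem n ⟨p n x, ?_, rfl⟩
      exact (isGradedBy_top k V).tensorProj_mem_comp n Submodule.mem_top

end GradedPair

variable (R : HomogeneousRelations k V N)

/-- The left ideal `T(V) S`. -/
noncomputable def leftIdeal (S : Submodule ℤ (TensorRing k V)) : Ideal (TensorRing k V) where
  toAddSubmonoid := ((⊤ : Submodule ℤ (TensorRing k V)) * S).toAddSubmonoid
  smul_mem' := by
    intro t x hx
    have h : (⊤ : Submodule ℤ (TensorRing k V)) * (⊤ * S) ≤ ⊤ * S := by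
      rw [← mul_assoc]; exact mul_le_mul' le_top le_rfl
    exact h (Submodule.mul_mem_mul Submodule.mem_top hx)

/-- The left ideal `I(R) S`. -/
noncomputable def relLeftIdeal (S : Submodule ℤ (TensorRing k V)) : Ideal (TensorRing k V) where
  toAddSubmonoid := (R.relIdeal * S).toAddSubmonoid
  smul_mem' := by
    intro t x hx
    have h : (⊤ : Submodule ℤ (TensorRing k V)) * (R.relIdeal * S) ≤ R.relIdeal * S := by
      rw [← mul_assoc]
      exact mul_le_mul' (Submodule.mul_le.mpr fun t _ x hx => R.mul_mem_relIdeal_left t hx) le_rfl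
    exact h (Submodule.mul_mem_mul Submodule.mem_top hx)

/-- The graded `A`-module `A ⊗_k S = T(V) S / I(R) S`, for `S ⊆ V^{⊗ q}`. -/
noncomputable def tensorPair {q : ℕ} {S : Submodule ℤ (TensorRing k V)}
    (hS : S ≤ tensorPow k V q) : R.GradedPair where
  top := leftIdeal S
  bot := R.relLeftIdeal S
  tensorProj_mem_top := fun n _ hx => ((isGradedBy_top k V).mul_right hS).tensorProj_mem n hx
  tensorProj_mem_bot := fun n _ hx => (R.isGradedBy_relIdeal.mul_right hS).tensorProj_mem n hx
  mul_mem_bot := by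
    intro x hx y hy
    have h : R.relIdeal * (⊤ * S) ≤ R.relIdeal * S := by
      rw [← mul_assoc]
      exact mul_le_mul' (Submodule.mul_le.mpr fun x hx t _ => R.mul_mem_relIdeal_right t hx) le_rfl
    exact h (Submodule.mul_mem_mul (R.mem_ideal_iff.mp hx) hy)

theorem mem_tensorPair_top {q : ℕ} {S : Submodule ℤ (TensorRing k V)}
    (hS : S ≤ tensorPow k V q) {x : TensorRing k V} : x ∈ (R.tensorPair hS).top ↔ x ∈ ⊤ * S := Iff.rfl

theorem mem_tensorPair_bot {q : ℕ} {S : Submodule ℤ (TensorRing k V)}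
    (hS : S ≤ tensorPow k V q) {x : TensorRing k V} :
    x ∈ (R.tensorPair hS).bot ↔ x ∈ R.relIdeal * S := Iff.rfl

/-- Lifted to `T(V)`, a relation over `A` becomes a sum in `I(R)S`. The matrix over `k` from the
equational criterion, applied with `J = I(R)`, supplies the new coefficients, and the elements of
`S` themselves serve as generators. -/
theorem isEquationallyFlat_tensorPair [SMulCommClass k kᵐᵒᵖ V] (hk : IsVonNeumannRegular k) {q : ℕ}
    {S : Submodule ℤ (TensorRing k V)} (hS : S ≤ tensorPow k V q) :
    IsEquationallyFlat R.Alg (R.tensorPair hS).Quot := by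
  intro ι _ a y h
  choose α hα using fun i => R.proj_surjective (a i)
  choose x hx using fun i => (R.tensorPair hS).cls_surjective (y i)
  obtain ⟨κ, _, β, s, -, hs, hβ⟩ :=
    Submodule.exists_sum_of_forall_mem_mul (M := ⊤) (N := S) (fun i => (x i).2)
  have hsum : ∑ i, α i * (x i : TensorRing k V) ∈ R.relIdeal * S := by
    rw [← R.mem_tensorPair_bot hS]
    have h1 : (R.tensorPair hS).cls (∑ i, α i • x i) = 0 := by
      rw [map_sum, ← h]
      refine Finset.sum_congr rfl fun i _ => ?_
      rw [← GradedPair.proj_smul_cls, hx, hα]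
    have h2 := ((R.tensorPair hS).cls_eq_zero_iff _).mp h1
    simpa using h2
  obtain ⟨Q, hQ, hxQ⟩ := exists_matrix_of_sum_mem_mul hk
    (fun t ht a => R.mul_mem_relIdeal_right (scalar k V a) ht)
    (fun m => ∑ i, α i * β i m) s (fun m => hS (hs m)) (by
      have h3 : ∑ m, (∑ i, α i * β i m) * s m = ∑ i, α i * (x i : TensorRing k V) := by
        simp only [hβ, Finset.sum_mul, Finset.mul_sum, mul_assoc]
        exact Finset.sum_comm
      rw [h3]
      exact mul_le_mul' le_rfl hS hsum)
  have hmem : ∀ m, s m ∈ (R.tensorPair hS).top := fun m => by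
    rw [mem_tensorPair_top, ← one_mul (s m)]
    exact Submodule.mul_mem_mul Submodule.mem_top (hs m)
  refine ⟨κ, inferInstance, fun i j => R.proj (∑ m, β i m * scalar k V (Q m j)),
    fun j => (R.tensorPair hS).cls ⟨s j, hmem j⟩, fun i => ?_, fun j => ?_⟩
  · simp only [GradedPair.proj_smul_cls]
    rw [← map_sum, ← hx i]
    congr 1
    refine Subtype.ext ?_
    rw [AddSubmonoidClass.coe_finsetSum, hβ i]
    simp only [Submodule.coe_smul, smul_eq_mul, Finset.sum_mul]
    rw [Finset.sum_comm]
    refine Finset.sum_congr rfl fun m _ => ?_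
    conv_lhs => rw [hQ m, Finset.mul_sum]
    simp only [mul_assoc]
  · simp only [← hα, ← map_mul, ← map_sum]
    rw [proj_eq_zero_iff]
    have h4 : ∑ i, α i * ∑ m, β i m * scalar k V (Q m j) =
        ∑ m, (∑ i, α i * β i m) * scalar k V (Q m j) := by
      simp only [Finset.sum_mul, Finset.mul_sum, mul_assoc]
      exact Finset.sum_comm
    rw [h4]
    exact hxQ j

end HomogeneousRelations

/-! ### The start of the minimal resolution, `A ⊗ R → A ⊗ V → A → k`. -/

namespace HomogeneousRelations

open TensorRing

variable {k : Type u} {V : Type v} [Ring k] [AddCommGroup V] [Module k V] [Module kᵐᵒᵖ V] {N : ℕ}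
variable (R : HomogeneousRelations k V N)

theorem carrier_le_mul : R.carrier ≤ tensorPow k V (N - 1) * tensorPow k V 1 := by
  rw [tensorPow_mul_tensorPow, Nat.sub_add_cancel (by have := R.two_le; omega)]
  exact R.le_tensorPow

theorem top_mul_carrier_le : ⊤ * R.carrier ≤ ⊤ * tensorPow k V 1 := by
  refine (mul_le_mul' le_rfl R.carrier_le_mul).trans ?_
  rw [← mul_assoc]
  exact mul_le_mul' le_top le_rfl

theorem relIdeal_mul_carrier_le : R.relIdeal * R.carrier ≤ R.relIdeal * tensorPow k V 1 := by
  refine (mul_le_mul' le_rfl R.carrier_le_mul).trans ?_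
  rw [← mul_assoc]
  exact mul_le_mul' (Submodule.mul_le.mpr fun x hx t _ => R.mul_mem_relIdeal_right t hx) le_rfl

/-- The graded module `A`. -/
noncomputable def algGrMod : GrMod.{max u v, max u v} R.algComp where
  carrier := R.Alg
  comp := R.algComp
  smul_mem := fun ha hx => SetLike.mul_mem_graded ha hx
  isInternal := DirectSum.Decomposition.isInternal R.algComp

/-- The pair `T(V) V`, `I(R) V`, with quotient `A ⊗_k V`. -/
noncomputable abbrev vectorPair : R.GradedPair := R.tensorPair (le_refl (tensorPow k V 1))

/-- The pair `T(V) R`, `I(R) R`, with quotient `A ⊗_k R`. -/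
noncomputable abbrev relPair : R.GradedPair := R.tensorPair R.le_tensorPow

/-- The map `A ⊗_k V → A`. -/
noncomputable def vectorMap : R.vectorPair.Quot →ₗ[R.Alg] R.Alg :=
  R.vectorPair.lift (R.proj.toAddMonoidHom.comp R.vectorPair.top.subtype.toAddMonoidHom)
    (fun t _ => map_mul R.proj t _) (fun x hx => by
      have h : (x : TensorRing k V) ∈ R.relIdeal :=
        Submodule.mul_le.mpr (fun y hy t _ => R.mul_mem_relIdeal_right t hy) hx
      exact R.proj_eq_zero_iff.mpr h)

/-- The map `A ⊗_k R → A ⊗_k V`. -/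
noncomputable def relMap : R.relPair.Quot →ₗ[R.Alg] R.vectorPair.Quot :=
  R.relPair.lift (R.vectorPair.cls.toAddMonoidHom.comp
    (Submodule.inclusion (p := R.relPair.top) (p' := R.vectorPair.top)
      (fun _ hx => R.top_mul_carrier_le hx)).toAddMonoidHom)
    (fun t ⟨x, hx⟩ => (map_smul R.vectorPair.cls t ⟨x, R.top_mul_carrier_le hx⟩).trans
      (R.vectorPair.proj_smul t _).symm)
    (fun x hx => (R.vectorPair.cls_eq_zero_iff _).mpr (R.relIdeal_mul_carrier_le hx))

theorem vectorMap_cls (x : R.vectorPair.top) :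
    R.vectorMap (R.vectorPair.cls x) = R.proj (x : TensorRing k V) := rfl

theorem relMap_cls (x : R.relPair.top) :
    R.relMap (R.relPair.cls x) = R.vectorPair.cls ⟨x, R.top_mul_carrier_le x.2⟩ := rfl

theorem relMap_cls_eq_zero_iff (x : R.relPair.top) :
    R.relMap (R.relPair.cls x) = 0 ↔ (x : TensorRing k V) ∈ R.relIdeal * tensorPow k V 1 := by
  rw [relMap_cls, GradedPair.cls_eq_zero_iff]
  rfl

/-- The augmentation as a linear map. -/
noncomputable def augMap : R.Alg →ₗ[R.Alg] R.TrivialModule where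
  toFun a := R.trivialEquiv (R.augmentation a)
  map_add' a b := by rw [map_add, map_add]
  map_smul' a b := by
    rw [smul_eq_mul, map_mul]
    rfl

theorem augMap_eq_zero_iff (a : R.Alg) : R.augMap a = 0 ↔ R.augmentation a = 0 := Iff.rfl

theorem augmentation_proj_eq_zero {x : TensorRing k V}
    (hx : x ∈ (⊤ : Submodule ℤ (TensorRing k V)) * tensorPow k V 1) :
    R.augmentation (R.proj x) = 0 := by
  induction hx using Submodule.mul_induction_on' with
  | mem_mul_mem t _ v hv =>
    have hv' : R.proj v ∈ R.algComp 1 := ⟨v, hv, rfl⟩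
    rw [map_mul, map_mul, R.augmentation_eq_zero one_ne_zero hv', mul_zero]
  | add x _ y _ hx hy => rw [map_add, map_add, hx, hy, add_zero]

theorem exact_vectorMap_augMap : Function.Exact R.vectorMap R.augMap := by
  intro a
  rw [augMap_eq_zero_iff]
  constructor
  · intro h
    obtain ⟨t, rfl⟩ := R.proj_surjective a
    have ht := (R.sub_scalar_mem t).2
    rw [h, map_zero, sub_zero] at ht
    exact ⟨R.vectorPair.cls ⟨t, ht⟩, rfl⟩
  · rintro ⟨y, rfl⟩
    obtain ⟨x, rfl⟩ := R.vectorPair.cls_surjective y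
    rw [vectorMap_cls]
    exact R.augmentation_proj_eq_zero x.2

theorem exact_relMap_vectorMap : Function.Exact R.relMap R.vectorMap := by
  intro y
  constructor
  · intro h
    obtain ⟨⟨x, hx'⟩, rfl⟩ := R.vectorPair.cls_surjective y
    rw [vectorMap_cls, proj_eq_zero_iff] at h
    obtain ⟨r, hr, j, hj, rfl⟩ := Submodule.mem_sup.mp (R.relIdeal_le h)
    refine ⟨R.relPair.cls ⟨r, hr⟩, ?_⟩
    rw [relMap_cls, ← sub_eq_zero, ← map_sub, GradedPair.cls_eq_zero_iff]
    have : r - (r + j) = -j := by abel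
    change r - (r + j) ∈ _
    rw [this]
    exact neg_mem hj
  · rintro ⟨z, rfl⟩
    obtain ⟨x, rfl⟩ := R.relPair.cls_surjective z
    rw [relMap_cls, vectorMap_cls, proj_eq_zero_iff]
    have h : (⊤ : Submodule ℤ (TensorRing k V)) * R.carrier ≤ R.relIdeal := by
      intro t ht
      rw [← mul_one t]
      exact Submodule.mul_mem_mul ht Submodule.mem_top
    exact h x.2

theorem mul_carrier_mem_smul_top {q : ℕ} (hq : q ≠ 0) {t r : TensorRing k V}
    (ht : t ∈ tensorPow k V q) (hr : r ∈ R.relPair.top) {L : Submodule R.Alg R.relPair.Quot}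
    (hL : R.relPair.cls ⟨r, hr⟩ ∈ L) :
    R.relPair.cls ⟨t * r, R.relPair.top.mul_mem_left t hr⟩ ∈ R.augIdeal • L := by
  have : R.relPair.cls ⟨t * r, R.relPair.top.mul_mem_left t hr⟩ =
      R.proj t • R.relPair.cls ⟨r, hr⟩ := (R.relPair.proj_smul_cls t ⟨r, hr⟩).symm
  rw [this]
  refine Submodule.smul_mem_smul ?_ hL
  rw [mem_augIdeal]
  exact R.augmentation_eq_zero hq ⟨t, ht, rfl⟩

/-- Additive induction for classes in `A₊ L`. -/
theorem cls_mem_of_le {E : Submodule ℤ (TensorRing k V)} {L : Submodule R.Alg R.relPair.Quot}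
    (hE : E ≤ ⊤ * R.carrier) (x : TensorRing k V) (hx : x ∈ E)
    {S S' : Submodule ℤ (TensorRing k V)} (hES : E ≤ S * S')
    (hS : ∀ s ∈ S, ∀ s' ∈ S', ∃ h : s * s' ∈ R.relPair.top, R.relPair.cls ⟨s * s', h⟩ ∈ L) :
    R.relPair.cls ⟨x, hE hx⟩ ∈ L := by
  suffices H : ∃ h : x ∈ R.relPair.top, R.relPair.cls ⟨x, h⟩ ∈ L from H.2
  refine Submodule.mul_induction_on (hES hx) hS ?_
  rintro x y ⟨hx, hx'⟩ ⟨hy, hy'⟩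
  refine ⟨add_mem hx hy, ?_⟩
  have : R.relPair.cls ⟨x + y, add_mem hx hy⟩ = R.relPair.cls ⟨x, hx⟩ + R.relPair.cls ⟨y, hy⟩ := by
    rw [← map_add]; rfl
  rw [this]
  exact add_mem hx' hy'

/-! ### The kernel of `A ⊗ R → A ⊗ V`, degree by degree. -/

/-- The component of degree `n` of the kernel of `T(V) R → A ⊗_k V`. -/
noncomputable def kerComp (n : ℕ) : Submodule ℤ (TensorRing k V) :=
  (if N ≤ n then tensorPow k V (n - N) * R.carrier else ⊥) ⊓
    (if 1 ≤ n then R.idealComp (n - 1) * tensorPow k V 1 else ⊥)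

theorem isGradedBy_kerComp :
    IsGradedBy R.kerComp (⊤ * R.carrier ⊓ R.relIdeal * tensorPow k V 1) :=
  ((isGradedBy_top k V).mul_right R.le_tensorPow).inf (R.isGradedBy_relIdeal.mul_right le_rfl)

theorem kerComp_eq {n : ℕ} (hn : N ≤ n) : R.kerComp n =
    tensorPow k V (n - N) * R.carrier ⊓ R.idealComp (n - 1) * tensorPow k V 1 := by
  have := R.two_le
  rw [kerComp, if_pos hn, if_pos (by omega)]

theorem idealComp_eq_bot {n : ℕ} (hn : n < N) : R.idealComp n = ⊥ := by
  rw [idealComp, iSup₂_eq_bot]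
  intro i j
  exact iSup_eq_bot.mpr fun h => by omega

/-- Below degree `N` the factor `R` does not fit; in degree `N` the other side is `I(R)_{N-1}V = 0`.
-/
theorem kerComp_eq_bot {n : ℕ} (hn : n ≤ N) : R.kerComp n = ⊥ := by
  have := R.two_le
  rcases hn.lt_or_eq with h | rfl
  · rw [kerComp, if_neg (by omega), bot_inf_eq]
  · rw [R.kerComp_eq le_rfl, R.idealComp_eq_bot (by omega), Submodule.bot_mul, inf_bot_eq]

theorem idealComp_self : R.idealComp N = R.carrier := by
  refine le_antisymm (iSup_le fun i => iSup_le fun j => iSup_le fun h => ?_) ?_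
  · obtain ⟨rfl, rfl⟩ : i = 0 ∧ j = 0 := by omega
    rw [tensorPow_zero_mul_carrier, carrier_mul_tensorPow_zero]
  · refine le_iSup_of_le 0 (le_iSup_of_le 0 (le_iSup_of_le (by omega) ?_))
    rw [tensorPow_zero_mul_carrier, carrier_mul_tensorPow_zero]

theorem tensorPow_mul_idealComp_le (a n : ℕ) :
    tensorPow k V a * R.idealComp n ≤ R.idealComp (a + n) := by
  simp only [idealComp, Submodule.mul_iSup]
  refine iSup_le fun i => iSup_le fun j => iSup_le fun h => ?_
  refine le_iSup_of_le (a + i) (le_iSup_of_le j (le_iSup_of_le (by omega) ?_))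
  rw [← mul_assoc, ← mul_assoc, tensorPow_mul_tensorPow]

theorem idealComp_mul_tensorPow_le (a n : ℕ) :
    R.idealComp n * tensorPow k V a ≤ R.idealComp (n + a) := by
  simp only [idealComp, Submodule.iSup_mul]
  refine iSup_le fun i => iSup_le fun j => iSup_le fun h => ?_
  refine le_iSup_of_le i (le_iSup_of_le (j + a) (le_iSup_of_le (by omega) ?_))
  rw [mul_assoc, tensorPow_mul_tensorPow]

theorem W_succ : R.W (N + 1) = tensorPow k V 1 * R.carrier ⊓ R.carrier * tensorPow k V 1 := by
  refine le_antisymm (le_inf ?_ ?_) (le_iInf fun i => le_iInf fun j => le_iInf fun h => ?_)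
  · have h : R.W (N + 1) ≤ tensorPow k V 1 * R.carrier * tensorPow k V 0 := by
      rw [W]
      exact iInf_le_of_le 1 (iInf_le_of_le 0 (iInf_le_of_le (by omega) le_rfl))
    rwa [mul_assoc, carrier_mul_tensorPow_zero] at h
  · have h : R.W (N + 1) ≤ tensorPow k V 0 * R.carrier * tensorPow k V 1 := by
      rw [W]
      exact iInf_le_of_le 0 (iInf_le_of_le 1 (iInf_le_of_le (by omega) le_rfl))
    rwa [tensorPow_zero_mul_carrier] at h
  · obtain ⟨rfl, rfl⟩ | ⟨rfl, rfl⟩ : (i = 1 ∧ j = 0) ∨ (i = 0 ∧ j = 1) := by omega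
    · rw [mul_assoc, carrier_mul_tensorPow_zero]
      exact inf_le_left
    · rw [tensorPow_zero_mul_carrier]
      exact inf_le_right

theorem kerComp_succ : R.kerComp (N + 1) = R.W (N + 1) := by
  rw [R.kerComp_eq (by omega), W_succ, Nat.add_sub_cancel_left, Nat.add_sub_cancel, idealComp_self]

/-- This is the inclusion that always holds in (ec) and (d): the first summand comes from the two
descriptions of `W_{N+1}`, the second from `R ⊆ V^{⊗(N-1)}V`. -/
theorem tensorPow_mul_W_sup_le {n : ℕ} (hn : N + 1 ≤ n) :
    tensorPow k V (n - N - 1) * R.W (N + 1) ⊔ R.idealComp (n - N) * R.carrier ≤ R.kerComp n := by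
  have h2 := R.two_le
  rw [R.kerComp_eq (by omega), W_succ]
  refine sup_le (le_inf ?_ ?_) (le_inf ?_ ?_)
  · refine (mul_le_mul' le_rfl inf_le_left).trans ?_
    rw [← mul_assoc, tensorPow_mul_tensorPow, show n - N - 1 + 1 = n - N by omega]
  · refine (mul_le_mul' le_rfl inf_le_right).trans ?_
    rw [← mul_assoc, ← idealComp_self]
    refine mul_le_mul' ((R.tensorPow_mul_idealComp_le _ _).trans_eq ?_) le_rfl
    rw [show n - N - 1 + N = n - 1 by omega]
  · exact mul_le_mul' (R.isGradedBy_relIdeal.le_tensorPow _) le_rfl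
  · refine (mul_le_mul' le_rfl R.carrier_le_mul).trans ?_
    rw [← mul_assoc]
    refine mul_le_mul' ((R.idealComp_mul_tensorPow_le _ _).trans_eq ?_) le_rfl
    rw [show n - N + (N - 1) = n - 1 by omega]

/-- The kernel of `A ⊗_k R → A ⊗_k V` needs no generators of degree `m`. -/
def KernelDecomposable (m : ℕ) : Prop :=
  ∀ x ∈ R.relPair.toGrMod.comp m, R.relMap x = 0 → x ∈ R.augIdeal • LinearMap.ker R.relMap

/-- The criterion for the canonical resolution is transported to the flat sequence. There the
condition of lying in `A₊(A ⊗ R)` disappears, because the sequence is minimal at `A ⊗ R`. -/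
theorem subsingleton_tor_three_iff [SMulCommClass k kᵐᵒᵖ V] (hk : IsVonNeumannRegular k) (m : ℕ) :
    Subsingleton (R.Tor 3 m) ↔ R.KernelDecomposable m := by
  refine (R.subsingleton_grTor_iff R.trivialGrMod 1 m).trans ?_
  refine R.trivialGrMod.forall_mem_smul_ker_iff (F₀ := R.algGrMod) (F₁ := R.vectorPair.toGrMod)
    (F₂ := R.relPair.toGrMod) (ε := R.augMap) (δ₁ := R.vectorMap) (δ₂ := R.relMap)
    ?_ ?_ ?_ ?_ R.exact_vectorMap_augMap R.exact_relMap_vectorMap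
    (IsEquationallyFlat.self R.Alg) (R.isEquationallyFlat_tensorPair hk _)
    (R.isEquationallyFlat_tensorPair hk _) R.decompose_mem_augIdeal ?_ m
  · intro n a ha
    by_cases hn : n = 0
    · subst hn
      change _ ∈ R.trivialComp 0
      rw [trivialComp, if_pos rfl]
      exact Submodule.mem_top
    · have : R.augMap a = 0 := (R.augMap_eq_zero_iff a).mpr (R.augmentation_eq_zero hn ha)
      exact (congrArg (· ∈ R.trivialComp n) this).mpr (Submodule.zero_mem _)
  · rintro n _ ⟨x, hx, rfl⟩
    exact ⟨x, hx, rfl⟩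
  · rintro n _ ⟨x, hx, rfl⟩
    exact ⟨⟨x, R.top_mul_carrier_le x.2⟩, hx, rfl⟩
  · intro c
    exact ⟨R.proj (scalar k V (R.trivialEquiv.symm c)), R.augmentation_scalar _⟩
  -- Minimality: a kernel element has components only in degrees `n > N`, where it lies in
  -- `V^{⊗(n-N)}R` with `n - N > 0`.
  · intro y hy
    obtain ⟨⟨x, hx⟩, rfl⟩ := R.relPair.cls_surjective y
    have hx' : x ∈ ⨆ n, R.kerComp n := by
      rw [← R.isGradedBy_kerComp.eq_iSup]
      exact ⟨hx, (R.relMap_cls_eq_zero_iff _).mp hy⟩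
    suffices H : ∃ h : x ∈ R.relPair.top,
        R.relPair.cls ⟨x, h⟩ ∈ R.augIdeal • (⊤ : Submodule R.Alg R.relPair.Quot) from H.2
    clear hx hy
    induction hx' using Submodule.iSup_induction' with
    | mem n x hx =>
      have hxT := (R.isGradedBy_kerComp.le n hx).1
      refine ⟨hxT, ?_⟩
      by_cases hn : n ≤ N
      · rw [R.kerComp_eq_bot hn, Submodule.mem_bot] at hx
        subst hx
        have : R.relPair.cls ⟨0, hxT⟩ = 0 := map_zero R.relPair.cls
        rw [this]
        exact Submodule.zero_mem _
      · rw [R.kerComp_eq (by omega)] at hx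
        refine R.cls_mem_of_le (mul_le_mul' le_top le_rfl) x hx.1 le_rfl fun s hs r hr => ?_
        have hr' : r ∈ R.relPair.top := by
          rw [mem_tensorPair_top, ← one_mul r]
          exact Submodule.mul_mem_mul Submodule.mem_top hr
        exact ⟨_, R.mul_carrier_mem_smul_top (q := n - N) (by omega) hs hr' Submodule.mem_top⟩
    | zero =>
      refine ⟨Submodule.zero_mem _, ?_⟩
      have : R.relPair.cls ⟨0, Submodule.zero_mem _⟩ = 0 := map_zero R.relPair.cls
      rw [this]
      exact Submodule.zero_mem _
    | add x y _ _ hx hy =>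
      obtain ⟨hx, hx'⟩ := hx
      obtain ⟨hy, hy'⟩ := hy
      refine ⟨add_mem hx hy, ?_⟩
      have : R.relPair.cls ⟨x + y, add_mem hx hy⟩ =
          R.relPair.cls ⟨x, hx⟩ + R.relPair.cls ⟨y, hy⟩ := by
        rw [← map_add]; rfl
      rw [this]
      exact add_mem hx' hy'

theorem kernelDecomposable_of_le {m : ℕ} (hm : m ≤ N) : R.KernelDecomposable m := by
  rintro _ ⟨x, hx, rfl⟩ h
  have hx' : (x : TensorRing k V) ∈ R.kerComp m :=
    R.isGradedBy_kerComp.mem_comp_iff.mpr ⟨⟨x.2, (R.relMap_cls_eq_zero_iff x).mp h⟩, hx⟩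
  rw [R.kerComp_eq_bot hm, Submodule.mem_bot] at hx'
  have : x = 0 := Subtype.ext hx'
  subst this
  change R.relPair.cls 0 ∈ _
  rw [map_zero]
  exact Submodule.zero_mem _

/-- As `A₊` is the image of `V T(V)`, and the preimage of the kernel in `T(V)R` is a left ideal, an
element of `A₊K` lifts to `V` times that preimage. The error of the lift is in `I(R)R`, and
projecting to degree `m` gives the bound. -/
theorem kerComp_le_of_kernelDecomposable {m : ℕ} (hm : N + 1 ≤ m) (h : R.KernelDecomposable m) :
    R.kerComp m ≤ tensorPow k V 1 * R.kerComp (m - 1) ⊔ R.idealComp (m - N) * R.carrier := by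
  intro x hx
  obtain ⟨⟨hxT, hxI⟩, hxm⟩ := R.isGradedBy_kerComp.mem_comp_iff.mp hx
  have h1 := h (R.relPair.cls ⟨x, hxT⟩) ⟨⟨x, hxT⟩, hxm, rfl⟩
    ((R.relMap_cls_eq_zero_iff _).mpr hxI)
  have h2 : ∃ z : R.relPair.top, R.relPair.cls z = R.relPair.cls ⟨x, hxT⟩ ∧
      (z : TensorRing k V) ∈
        tensorPow k V 1 * (⊤ * R.carrier ⊓ R.relIdeal * tensorPow k V 1) := by
    refine Submodule.smul_induction_on
      (p := fun y => ∃ z : R.relPair.top, R.relPair.cls z = y ∧ (z : TensorRing k V) ∈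
        tensorPow k V 1 * (⊤ * R.carrier ⊓ R.relIdeal * tensorPow k V 1)) h1 ?_ ?_
    · intro a ha y hy
      obtain ⟨t, rfl⟩ := R.proj_surjective a
      obtain ⟨z, rfl⟩ := R.relPair.cls_surjective y
      refine ⟨t • z, (R.relPair.proj_smul_cls t z).symm, ?_⟩
      have ht := (R.sub_scalar_mem t).1
      rw [R.mem_augIdeal.mp ha, map_zero, sub_zero] at ht
      have h3 : (t • z : TensorRing k V) ∈ tensorPow k V 1 * (⊤ : Submodule ℤ (TensorRing k V)) *
          (⊤ * R.carrier ⊓ R.relIdeal * tensorPow k V 1) :=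
        Submodule.mul_mem_mul ht ⟨z.2, (R.relMap_cls_eq_zero_iff z).mp hy⟩
      rw [mul_assoc] at h3
      refine mul_le_mul' le_rfl (Submodule.mul_le.mpr fun s _ y hy => ?_) h3
      exact ⟨R.relPair.top.mul_mem_left s hy.1, R.vectorPair.bot.mul_mem_left s hy.2⟩
    · rintro _ _ ⟨z, rfl, hz⟩ ⟨z', rfl, hz'⟩
      exact ⟨z + z', map_add _ _ _, add_mem hz hz'⟩
  obtain ⟨z, hz, hz'⟩ := h2
  rw [eq_comm, ← sub_eq_zero, ← map_sub, GradedPair.cls_eq_zero_iff] at hz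
  have hz : x - z ∈ R.relIdeal * R.carrier := hz
  have h4 := (R.isGradedBy_kerComp.mul_left (le_refl (tensorPow k V 1))).tensorProj_mem_comp m hz'
  have h5 := (R.isGradedBy_relIdeal.mul_right R.le_tensorPow).tensorProj_mem_comp m hz
  rw [if_pos (by omega)] at h4 h5
  rw [← tensorProj_of_mem hxm, ← add_sub_cancel (z : TensorRing k V) x, map_add]
  exact Submodule.add_mem _ (Submodule.mem_sup_left h4) (Submodule.mem_sup_right h5)

/-- The summand in `I(R)R` is zero in `A ⊗ R`. The other is a multiple of `W_{N+1} ⊆ ker` by tensors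
of degree `m - N - 1 ≥ 1`, whose images lie in `A₊`. -/
theorem kernelDecomposable_of_kerComp_le {m : ℕ} (hm : N + 2 ≤ m)
    (h : R.kerComp m ≤
      tensorPow k V (m - N - 1) * R.W (N + 1) ⊔ R.idealComp (m - N) * R.carrier) :
    R.KernelDecomposable m := by
  rintro _ ⟨⟨x, hxT⟩, hx, rfl⟩ h'
  have hx' := h (R.isGradedBy_kerComp.mem_comp_iff.mpr
    ⟨⟨hxT, (R.relMap_cls_eq_zero_iff _).mp h'⟩, hx⟩)
  obtain ⟨y, hy, z, hz, rfl⟩ := Submodule.mem_sup.mp hx'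
  have hWT : R.W (N + 1) ≤ ⊤ * R.carrier := by
    rw [← R.kerComp_succ]
    exact (R.isGradedBy_kerComp.le _).trans inf_le_left
  have hle : tensorPow k V (m - N - 1) * R.W (N + 1) ≤ ⊤ * R.carrier :=
    Submodule.mul_le.mpr fun t _ w hw => R.relPair.top.mul_mem_left t (hWT hw)
  have hz' : z ∈ R.relIdeal * R.carrier := mul_le_mul' (R.isGradedBy_relIdeal.le _) le_rfl hz
  have hzy : R.relPair.cls ⟨y + z, hxT⟩ = R.relPair.cls ⟨y, hle hy⟩ := by
    rw [← sub_eq_zero, ← map_sub, GradedPair.cls_eq_zero_iff]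
    change y + z - y ∈ R.relIdeal * R.carrier
    rwa [add_sub_cancel_left]
  change R.relPair.cls _ ∈ _
  rw [hzy]
  refine R.cls_mem_of_le hle y hy le_rfl fun t ht w hw => ?_
  refine ⟨_, R.mul_carrier_mem_smul_top (q := m - N - 1) (by omega) ht (hWT hw) ?_⟩
  rw [LinearMap.mem_ker, relMap_cls_eq_zero_iff]
  rw [← R.kerComp_succ] at hw
  exact (R.isGradedBy_kerComp.le _ hw).2

theorem kernelDecomposable_iff :
    (∀ m, m ≠ N + 1 → R.KernelDecomposable m) ↔ ∀ n, N + 2 ≤ n →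
      tensorPow k V (n - N) * R.carrier ⊓ R.idealComp (n - 1) * tensorPow k V 1 =
        tensorPow k V (n - N - 1) * R.W (N + 1) ⊔ R.idealComp (n - N) * R.carrier := by
  constructor
  · intro h
    -- Degreewise decomposability is iterated down to degree `N + 1`, where the kernel is `W_{N+1}`;
    -- at each step the factor `V` is absorbed by `V^{⊗j}` or by `I(R)`.
    have H : ∀ j, R.kerComp (N + 1 + j) ≤
        tensorPow k V j * R.W (N + 1) ⊔ R.idealComp (j + 1) * R.carrier := by
      intro j
      induction j with
      | zero =>
        refine le_sup_of_le_left ?_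
        rw [add_zero, kerComp_succ]
        intro x hx
        rw [← one_mul x]
        exact Submodule.mul_mem_mul one_mem_tensorPow_zero hx
      | succ j ih =>
        have h1 := R.kerComp_le_of_kernelDecomposable (m := N + 1 + (j + 1)) (by omega)
          (h _ (by omega))
        rw [show N + 1 + (j + 1) - 1 = N + 1 + j by omega,
          show N + 1 + (j + 1) - N = j + 1 + 1 by omega] at h1
        refine h1.trans (sup_le ((mul_le_mul' le_rfl ih).trans ?_) le_sup_right)
        rw [Submodule.mul_sup, ← mul_assoc, ← mul_assoc, tensorPow_mul_tensorPow, add_comm 1 j]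
        refine sup_le_sup le_rfl (mul_le_mul' ((R.tensorPow_mul_idealComp_le _ _).trans_eq ?_) le_rfl)
        rw [add_comm 1]
    intro n hn
    rw [← R.kerComp_eq (by omega)]
    refine le_antisymm ?_ (R.tensorPow_mul_W_sup_le (by omega))
    have h2 := H (n - N - 1)
    rwa [show N + 1 + (n - N - 1) = n by omega, show n - N - 1 + 1 = n - N by omega] at h2
  · intro h m hm
    by_cases hmN : m ≤ N
    · exact R.kernelDecomposable_of_le hmN
    · refine R.kernelDecomposable_of_kerComp_le (by omega) ?_
      rw [R.kerComp_eq (by omega)]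
      exact (h m (by omega)).le

/-! ### The extra condition and the distributivity relations. -/

theorem idealComp_mul_eq {n : ℕ} (hn : N + 1 ≤ n) : R.idealComp (n - 1) * tensorPow k V 1 =
    ⨆ i ∈ Finset.range (n - N), tensorPow k V i * R.carrier * tensorPow k V (n - N - i) := by
  simp only [idealComp, Submodule.iSup_mul]
  refine le_antisymm (iSup_le fun i => iSup_le fun j => iSup_le fun h => ?_)
    (iSup₂_le fun i hi => ?_)
  · refine le_iSup₂_of_le i (Finset.mem_range.mpr (by omega)) ?_
    rw [mul_assoc, tensorPow_mul_tensorPow, show n - N - i = j + 1 by omega]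
  · have := Finset.mem_range.mp hi
    refine le_iSup_of_le i (le_iSup_of_le (n - N - i - 1) (le_iSup_of_le (by omega) ?_))
    rw [mul_assoc _ (tensorPow k V _) (tensorPow k V 1), tensorPow_mul_tensorPow,
      show n - N - i - 1 + 1 = n - N - i by omega]

/-- In the range of (ec) one has `n - N < N`, so `I(R)_{n-N} = 0` and the identity has the same
shape as (d). -/
theorem extraCondition_iff : R.ExtraCondition ↔ ∀ n, N + 2 ≤ n → n ≤ 2 * N - 1 →
    tensorPow k V (n - N) * R.carrier ⊓ R.idealComp (n - 1) * tensorPow k V 1 =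
      tensorPow k V (n - N - 1) * R.W (N + 1) ⊔ R.idealComp (n - N) * R.carrier := by
  refine forall_congr' fun n => forall_congr' fun hn => forall_congr' fun hn' => ?_
  rw [R.idealComp_mul_eq (by omega), R.idealComp_eq_bot (n := n - N) (by omega),
    Submodule.bot_mul, sup_bot_eq]

theorem idealComp_mul_sup {n : ℕ} (hn : 2 * N ≤ n) :
    R.idealComp (n - N) * tensorPow k V N ⊔
        tensorPow k V (n - 2 * N + 1) * R.idealComp (2 * N - 2) * tensorPow k V 1 =
      R.idealComp (n - 1) * tensorPow k V 1 := by
  have h2 := R.two_le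
  refine le_antisymm (sup_le ?_ ?_) ?_
  · rw [show tensorPow k V N = tensorPow k V (N - 1) * tensorPow k V 1 by
      rw [tensorPow_mul_tensorPow, show N - 1 + 1 = N by omega], ← mul_assoc]
    refine mul_le_mul' ((R.idealComp_mul_tensorPow_le _ _).trans_eq ?_) le_rfl
    rw [show n - N + (N - 1) = n - 1 by omega]
  · refine mul_le_mul' ((R.tensorPow_mul_idealComp_le _ _).trans_eq ?_) le_rfl
    rw [show n - 2 * N + 1 + (2 * N - 2) = n - 1 by omega]
  · conv_lhs => rw [idealComp]
    simp only [Submodule.iSup_mul]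
    refine iSup_le fun i => iSup_le fun j => iSup_le fun h => ?_
    -- Either at least `N` factors `V` stand to the right of `R`, counting the extra one, and the
    -- term is in `F`; or at least `n - 2N + 1` stand to its left, and it is in `G`.
    by_cases hi : i ≤ n - 2 * N
    · refine le_sup_of_le_left ?_
      have h3 : tensorPow k V i * R.carrier * tensorPow k V (n - 2 * N - i) ≤ R.idealComp (n - N) :=
        le_iSup_of_le i (le_iSup_of_le (n - 2 * N - i) (le_iSup_of_le (by omega) le_rfl))
      refine le_trans (le_of_eq ?_) (mul_le_mul' h3 le_rfl)
      rw [mul_assoc, tensorPow_mul_tensorPow, mul_assoc _ (tensorPow k V _) (tensorPow k V N),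
        tensorPow_mul_tensorPow, show n - 2 * N - i + N = j + 1 by omega]
    · refine le_sup_of_le_right (mul_le_mul' ?_ le_rfl)
      have h3 : tensorPow k V (i - (n - 2 * N + 1)) * R.carrier * tensorPow k V j ≤
          R.idealComp (2 * N - 2) :=
        le_iSup_of_le _ (le_iSup_of_le j (le_iSup_of_le (by omega) le_rfl))
      refine le_trans (le_of_eq ?_) (mul_le_mul' le_rfl h3)
      rw [← mul_assoc, ← mul_assoc, tensorPow_mul_tensorPow,
        show n - 2 * N + 1 + (i - (n - 2 * N + 1)) = i by omega]

theorem idealComp_mul_scalar {n : ℕ} (x : TensorRing k V) (hx : x ∈ R.idealComp n) (a : k) :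
    x * scalar k V a ∈ R.idealComp n :=
  R.idealComp_mul_tensorPow_le 0 n (Submodule.mul_mem_mul hx (scalar_mem_tensorPow_zero a))

theorem scalar_mul_mem_mul {q : ℕ} {S : Submodule ℤ (TensorRing k V)} (a : k) {x : TensorRing k V}
    (hx : x ∈ tensorPow k V q * S) : scalar k V a * x ∈ tensorPow k V q * S := by
  have h := Submodule.mul_mem_mul (scalar_mem_tensorPow_zero (V := V) a) hx
  rwa [← mul_assoc, tensorPow_mul_tensorPow, zero_add] at h

variable [SMulCommClass k kᵐᵒᵖ V]

theorem mul_carrier_inf_idealComp_mul (hk : IsVonNeumannRegular k) (n : ℕ) :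
    tensorPow k V n * R.carrier ⊓ R.idealComp n * tensorPow k V N = R.idealComp n * R.carrier :=
  le_antisymm (mul_inf_mul_le hk R.idealComp_mul_scalar R.le_tensorPow)
    (le_inf (mul_le_mul' (R.isGradedBy_relIdeal.le_tensorPow n) le_rfl)
      (mul_le_mul' le_rfl R.le_tensorPow))

/-- Both subgroups have the common left factor `V^{⊗(n-2N+1)}`, which `mul_inf_mul` extracts. What
remains is an intersection in degree `2N - 1`, the last degree covered by (ec). -/
theorem mul_carrier_inf_mul_idealComp_mul (hk : IsVonNeumannRegular k) (h : R.ExtraCondition) {n : ℕ}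
    (hn : 2 * N ≤ n) :
    tensorPow k V (n - N) * R.carrier ⊓
        tensorPow k V (n - 2 * N + 1) * R.idealComp (2 * N - 2) * tensorPow k V 1 =
      tensorPow k V (n - N - 1) * R.W (N + 1) := by
  have h2 := R.two_le
  have h3 : tensorPow k V (N - 1) * R.carrier ⊓ R.idealComp (2 * N - 2) * tensorPow k V 1 =
      tensorPow k V (N - 2) * R.W (N + 1) := by
    -- For `N = 2` the degree `2N - 1 = N + 1` is outside the range of (ec), which is empty, and the
    -- identity is the definition of `W_3`.
    by_cases hN : N = 2
    · subst hN
      have h4 : tensorPow k V 0 * R.W (2 + 1) = R.W (2 + 1) := by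
        refine le_antisymm (Submodule.mul_le.mpr ?_) fun x hx => ?_
        · rintro _ ⟨a, rfl⟩ x hx
          rw [W_succ] at hx ⊢
          refine ⟨scalar_mul_mem_mul a hx.1, ?_⟩
          have h5 := Submodule.mul_mem_mul (scalar_mem_tensorPow_zero (V := V) a) hx.2
          rwa [← mul_assoc, tensorPow_zero_mul_carrier] at h5
        · rw [← one_mul x]
          exact Submodule.mul_mem_mul one_mem_tensorPow_zero hx
      rw [show 2 - 2 = 0 from rfl, h4, W_succ, show 2 * 2 - 2 = 2 from rfl, idealComp_self]
    · have h4 := R.extraCondition_iff.mp h (2 * N - 1) (by omega) (by omega)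
      rwa [show 2 * N - 1 - N = N - 1 by omega, show 2 * N - 1 - 1 = 2 * N - 2 by omega,
        show N - 1 - 1 = N - 2 by omega, R.idealComp_eq_bot (n := N - 1) (by omega),
        Submodule.bot_mul, sup_bot_eq] at h4
  have h5 := mul_inf_mul hk (q := 2 * N - 1) (X := tensorPow k V (n - 2 * N + 1))
    (P := tensorPow k V (N - 1) * R.carrier) (P' := R.idealComp (2 * N - 2) * tensorPow k V 1)
    (by
      refine (mul_le_mul' le_rfl R.le_tensorPow).trans_eq ?_
      rw [tensorPow_mul_tensorPow, show N - 1 + N = 2 * N - 1 by omega])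
    (by
      refine (mul_le_mul' (R.isGradedBy_relIdeal.le_tensorPow _) le_rfl).trans_eq ?_
      rw [tensorPow_mul_tensorPow, show 2 * N - 2 + 1 = 2 * N - 1 by omega])
    (fun x hx a => scalar_mul_mem_mul a hx)
    (fun x hx a => by
      have h6 := Submodule.mul_mem_mul (scalar_mem_tensorPow_zero (V := V) a) hx
      rw [← mul_assoc] at h6
      refine mul_le_mul' ((R.tensorPow_mul_idealComp_le _ _).trans_eq ?_) le_rfl h6
      rw [zero_add])
  rw [h3, ← mul_assoc, ← mul_assoc, ← mul_assoc, tensorPow_mul_tensorPow,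
    tensorPow_mul_tensorPow, show n - 2 * N + 1 + (N - 1) = n - N by omega,
    show n - 2 * N + 1 + (N - 2) = n - N - 1 by omega] at h5
  exact h5

end HomogeneousRelations

open TensorRing in
theorem theorem2p6 {k : Type u} [Ring k] (hk : IsVonNeumannRegular k)
    {V : Type v} [AddCommGroup V] [Module k V] [Module kᵐᵒᵖ V] [SMulCommClass k kᵐᵒᵖ V]
    {N : ℕ} (R : HomogeneousRelations k V N) :
    (IsConcentratedInDegree (fun m => R.Tor 3 m) (N + 1) ↔
      R.ExtraCondition ∧
      ∀ n, 2 * N ≤ n →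
        (tensorPow k V (n - N) * R.carrier) ⊓ (R.idealComp (n - 1) * tensorPow k V 1) =
          tensorPow k V (n - N - 1) * R.W (N + 1) ⊔ R.idealComp (n - N) * R.carrier) ∧
    (R.ExtraCondition → ∀ n, 2 * N ≤ n →
      ∀ E F G : Submodule ℤ (TensorRing k V),
        E = tensorPow k V (n - N) * R.carrier →
        F = R.idealComp (n - N) * tensorPow k V N →
        G = tensorPow k V (n - 2 * N + 1) * R.idealComp (2 * N - 2) * tensorPow k V 1 →
        (tensorPow k V (n - N) * R.carrier) ⊓ (R.idealComp (n - 1) * tensorPow k V 1) =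
            E ⊓ (F ⊔ G) ∧
          tensorPow k V (n - N - 1) * R.W (N + 1) ⊔ R.idealComp (n - N) * R.carrier =
            (E ⊓ F) ⊔ (E ⊓ G)) := by
  have h2 := R.two_le
  refine ⟨?_, ?_⟩
  · have h : IsConcentratedInDegree (fun m => R.Tor 3 m) (N + 1) ↔
        ∀ m, m ≠ N + 1 → R.KernelDecomposable m :=
      forall_congr' fun m => forall_congr' fun _ => R.subsingleton_tor_three_iff hk m
    rw [h, R.kernelDecomposable_iff, R.extraCondition_iff]
    constructor
    -- The degrees `N + 2 ≤ n ≤ 2N - 1` and `n ≥ 2N` exhaust `n ≥ N + 2`; conversely `2N ≥ N + 2`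
    -- because `N ≥ 2`.
    · exact fun H => ⟨fun n hn _ => H n hn, fun n hn => H n (by omega)⟩
    · rintro ⟨H, H'⟩ n hn
      by_cases hn' : n ≤ 2 * N - 1
      · exact H n hn hn'
      · exact H' n (by omega)
  · rintro h n hn _ _ _ rfl rfl rfl
    rw [R.idealComp_mul_sup hn, R.mul_carrier_inf_idealComp_mul hk,
      R.mul_carrier_inf_mul_idealComp_mul hk h hn]
    exact ⟨rfl, sup_comm _ _⟩
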